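/- Let $m\ge 0$ and let $H_0=-i\sigma_1\frac{d}{dx}+m\sigma_3$, with $\sigma_1=\begin{pmatrix}0&1\\1&0\end{pmatrix}$, $\sigma_3=\begin{pmatrix}1&0\\0&-1\end{pmatrix}$, be the free Dirac operator in $\mathcal H=L^2(\mathbb R)\otimes\mathbb C^2$ with domain $H^1(\mathbb R)\otimes\mathbb C^2$. For a closed densely defined operator $T$ let $\rho(T)$ be its resolvent set and $\sigma_e(T)=\{z\in\mathbb C: T-z \text{ is not Fredholm}\}$. Let $V=(V_{ij})_{i,j=1}^2$ with $V_{ij}\in L^1(\mathbb R)+L^\infty_0(\mathbb R)$, where $L^\infty_0(\mathbb R)$ is the space of essentially bounded functions vanishing at infinity. Matrix functions are identified with maximal multiplication operators. With the polar decomposition $V=U|V|$ ($U$ a pointwise partial isometry), put $A_V=|V|^{1/2}$, $B_V=U|V|^{1/2}$. Consider the factorization $V=BA$ with $A=A_V$, $B=B_V$, and, for every decomposition $V=W+X$ with $W_{ij}\in L^1(\mathbb R)$, $X_{ij}\in L^\infty_0(\mathbb R)$, the factorization with $A=\begin{pmatrix}A_W\\A_X\end{pmatrix}:\mathcal H\to\mathcal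 H\oplus\mathcal H$, $B=\begin{pmatrix}B_W&B_X\end{pmatrix}:\mathcal H\oplus\mathcal H\to\mathcal H$. Write $R_0(z)=(H_0-z)^{-1}$. Then for each of these factorizations $A$, $B$, $H_0$ are closed and densely defined, $\rho(H_0)\ne\emptyset$, for all $z\in\rho(H_0)$ the operator $AR_0(z)$ is bounded and everywhere defined and $R_0(z)B$ and $AR_0(z)B$ have bounded everywhere defined closures, and, with $Q(z)=\overline{AR_0(z)B}$, one has $-1\in\rho(Q(z_0))$ for some $z_0\in\rho(H_0)$. There is exactly one closed densely defined operator $H$ that for all of these factorizations is an extension of $H_0+BA$ with $\rho(H)\cap\rho(H_0)=\{z\in\rho(H_0): -1\in\rho(Q(z))\}$ and $$(H-z)^{-1}=R_0(z)-\overline{R_0(z)B}\,(I+Q(z))^{-1}AR_0(z),\qquad z\in\rho(H_0)\cap\rho(H).$$ For this $H$, the difference $(H-z)^{-1}-(H_0-z)^{-1}$ is compact for all $z\in\rho(H)\cap\rho(H_0)$, and $$\sigma_e(H)=\sigma_e(H_0)=(-\infty,-m]\cup[m,\infty).$$ -/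

import Mathlib

open MeasureTheory
open scoped ContDiff

/-! ### Unbounded operators -/

namespace UnboundedOp

variable {E F G : Type*}
  [NormedAddCommGroup E] [InnerProductSpace ℂ E]
  [NormedAddCommGroup F] [InnerProductSpace ℂ F]
  [NormedAddCommGroup G] [InnerProductSpace ℂ G]

/-- A bounded operator, seen as an everywhere defined partial operator. -/
def ofCLM (S : E →L[ℂ] F) : E →ₗ.[ℂ] F := (S : E →ₗ[ℂ] F).toPMap ⊤

/-- The composition `g f` on its natural domain `{x ∈ dom f | f x ∈ dom g}`. -/
def pcomp (g : F →ₗ.[ℂ] G) (f : E →ₗ.[ℂ] F) : E →ₗ.[ℂ] G where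
  domain := (g.domain.comap f.toFun).map f.domain.subtype
  toFun :=
    { toFun := fun x =>
        g ⟨f ⟨x, by obtain ⟨y, -, hy⟩ := x.2; exact hy ▸ y.2⟩,
          by obtain ⟨_, ⟨y, hy, rfl⟩⟩ := x; exact hy⟩
      map_add' := fun x y => by rw [← LinearPMap.map_add]; congr 1; exact Subtype.ext (f.map_add ⟨x, _⟩ ⟨y, _⟩)
      map_smul' := fun c x => by
        rw [RingHom.id_apply, ← LinearPMap.map_smul]; congr 1
        exact Subtype.ext (f.map_smul c ⟨x, _⟩) }

/-- The operator `T - z` with domain `dom T`. -/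
def shift (T : E →ₗ.[ℂ] E) (z : ℂ) : E →ₗ.[ℂ] E where
  domain := T.domain
  toFun := T.toFun - z • T.domain.subtype

/-- `R` is a bounded everywhere defined two-sided inverse of `T - z`. -/
def IsResolventAt (T : E →ₗ.[ℂ] E) (z : ℂ) (R : E →L[ℂ] E) : Prop :=
  (∀ y : E, ∃ h : R y ∈ T.domain, shift T z ⟨R y, h⟩ = y) ∧
    ∀ x : T.domain, R (shift T z x) = x

/-- The resolvent set `ρ(T)`. -/
def rho (T : E →ₗ.[ℂ] E) : Set ℂ := {z | ∃ R : E →L[ℂ] E, IsResolventAt T z R}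

open Classical in
/-- The resolvent `(T - z)⁻¹` for `z ∈ ρ(T)` (and `0` for other `z`). -/
noncomputable def res (T : E →ₗ.[ℂ] E) (z : ℂ) : E →L[ℂ] E :=
  if h : z ∈ rho T then h.choose else 0

/-- `T` has a closure that is bounded and everywhere defined. -/
def HasBoundedClosure (T : E →ₗ.[ℂ] F) : Prop := ∃ S : E →L[ℂ] F, T.closure = ofCLM S

open Classical in
/-- The bounded closure of `T` as a bounded operator (and `0` if there is none). -/
noncomputable def boundedClosure (T : E →ₗ.[ℂ] F) : E →L[ℂ] F :=
  if h : HasBoundedClosure T then h.choose else 0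

/-- Closed densely defined Fredholm operators: finite nullity, closed range and finite
deficiency. -/
structure IsFredholm (T : E →ₗ.[ℂ] F) : Prop where
  closed : T.IsClosed
  dense : Dense (T.domain : Set E)
  finite_ker : FiniteDimensional ℂ (LinearMap.ker T.toFun)
  closed_range : IsClosed (LinearMap.range T.toFun : Set F)
  finite_coker : FiniteDimensional ℂ (F ⧸ LinearMap.range T.toFun)

/-- The essential spectrum: all `z` such that `T - z` is not Fredholm. -/
def essSpectrum (T : E →ₗ.[ℂ] E) : Set ℂ := {z | ¬ IsFredholm (shift T z)}

/-- The operator `A R₀(z)`, where `R₀(z) = (H₀ - z)⁻¹`. -/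
noncomputable def AR (H₀ : E →ₗ.[ℂ] E) (A : E →ₗ.[ℂ] F) (z : ℂ) : E →ₗ.[ℂ] F :=
  pcomp A (ofCLM (res H₀ z))

/-- The operator `R₀(z) B`, with domain `dom B`. -/
noncomputable def RB (H₀ : E →ₗ.[ℂ] E) (B : F →ₗ.[ℂ] E) (z : ℂ) : F →ₗ.[ℂ] E :=
  pcomp (ofCLM (res H₀ z)) B

/-- The operator `A R₀(z) B` on its natural domain. -/
noncomputable def ARB (H₀ : E →ₗ.[ℂ] E) (A : E →ₗ.[ℂ] F) (B : F →ₗ.[ℂ] E) (z : ℂ) :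
    F →ₗ.[ℂ] F := pcomp A (RB H₀ B z)

/-- The Birman-Schwinger operator `Q(z)`, the bounded closure of `A R₀(z) B`. -/
noncomputable def Q (H₀ : E →ₗ.[ℂ] E) (A : E →ₗ.[ℂ] F) (B : F →ₗ.[ℂ] E) (z : ℂ) :
    F →L[ℂ] F := boundedClosure (ARB H₀ A B z)

/-- The conditions on `H₀`, `A`, `B` under which the perturbed operator is constructed. -/
structure IsAdmissible (H₀ : E →ₗ.[ℂ] E) (A : E →ₗ.[ℂ] F) (B : F →ₗ.[ℂ] E) : Prop where
  closed_free : H₀.IsClosed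
  dense_free : Dense (H₀.domain : Set E)
  closed_A : A.IsClosed
  dense_A : Dense (A.domain : Set E)
  closed_B : B.IsClosed
  dense_B : Dense (B.domain : Set F)
  rho_nonempty : (rho H₀).Nonempty
  bounded_AR : ∀ z ∈ rho H₀, ∃ S : E →L[ℂ] F, AR H₀ A z = ofCLM S
  bounded_RB : ∀ z ∈ rho H₀, HasBoundedClosure (RB H₀ B z)
  bounded_ARB : ∀ z ∈ rho H₀, HasBoundedClosure (ARB H₀ A B z)
  exists_neg_one_mem : ∃ z ∈ rho H₀, (-1 : ℂ) ∈ resolventSet ℂ (Q H₀ A B z)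

/-- `H` is the closed densely defined extension of `H₀ + B A` given by the factorized resolvent
formula `R(z) = R₀(z) - closure(R₀(z) B) (1 + Q(z))⁻¹ A R₀(z)`. -/
structure IsFactorizedExtension (H₀ : E →ₗ.[ℂ] E) (A : E →ₗ.[ℂ] F) (B : F →ₗ.[ℂ] E)
    (H : E →ₗ.[ℂ] E) : Prop where
  admissible : IsAdmissible H₀ A B
  closed : H.IsClosed
  dense : Dense (H.domain : Set E)
  extends_sum : H₀ + pcomp B A ≤ H
  rho_inter : rho H ∩ rho H₀ = {z ∈ rho H₀ | (-1 : ℂ) ∈ resolventSet ℂ (Q H₀ A B z)}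
  res_eq : ∀ z ∈ rho H₀ ∩ rho H,
    res H z = res H₀ z -
      boundedClosure (RB H₀ B z) ∘L Ring.inverse (1 + Q H₀ A B z) ∘L boundedClosure (AR H₀ A z)

/-- The column operator `f ↦ (A₁ f, A₂ f)` with domain `dom A₁ ∩ dom A₂`. -/
noncomputable def column (A₁ : E →ₗ.[ℂ] F) (A₂ : E →ₗ.[ℂ] G) : E →ₗ.[ℂ] WithLp 2 (F × G) where
  domain := A₁.domain ⊓ A₂.domain
  toFun := (WithLp.linearEquiv 2 ℂ (F × G)).symm.toLinearMap ∘ₗ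
    ((A₁.toFun ∘ₗ Submodule.inclusion inf_le_left).prod
      (A₂.toFun ∘ₗ Submodule.inclusion inf_le_right))

/-- The row operator `(f, g) ↦ B₁ f + B₂ g` with domain `dom B₁ ⊕ dom B₂`. -/
noncomputable def row (B₁ : F →ₗ.[ℂ] E) (B₂ : G →ₗ.[ℂ] E) : WithLp 2 (F × G) →ₗ.[ℂ] E where
  domain := (B₁.domain.prod B₂.domain).comap (WithLp.linearEquiv 2 ℂ (F × G)).toLinearMap
  toFun :=
    { toFun := fun k => B₁ ⟨(k : WithLp 2 (F × G)).fst, k.2.1⟩ +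
        B₂ ⟨(k : WithLp 2 (F × G)).snd, k.2.2⟩
      map_add' := fun k l => by
        rw [add_add_add_comm, ← LinearPMap.map_add, ← LinearPMap.map_add]; rfl
      map_smul' := fun c k => by
        rw [RingHom.id_apply, smul_add, ← LinearPMap.map_smul, ← LinearPMap.map_smul]; rfl }

end UnboundedOp

/-! ### The one-dimensional Dirac operator -/

namespace Dirac

open UnboundedOp

/-- The space `ℂ²` with its Euclidean norm. -/
abbrev Spinor : Type := EuclideanSpace ℂ (Fin 2)

/-- The Hilbert space `L²(ℝ) ⊗ ℂ² = L²(ℝ; ℂ²)`. -/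
abbrev SpinorL2 : Type := Lp Spinor 2 (volume : Measure ℝ)

theorem integrable_test_smul {φ : ℝ → ℝ} (hφ : Continuous φ) (hc : HasCompactSupport φ)
    (f : SpinorL2) : Integrable (fun x => φ x • f x) := by
  have h1 : MemLp φ 2 (volume : Measure ℝ) := hφ.memLp_of_hasCompactSupport hc
  have h2 := (Lp.memLp f).smul (r := 1) h1
  exact memLp_one_iff_integrable.1 h2

/-- The pairs `(f, g)` such that `f, g ∈ L²(ℝ; ℂ²)` and `g` is the weak derivative of `f`. -/
noncomputable def weakDerivGraph : Submodule ℂ (SpinorL2 × SpinorL2) where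
  carrier := {p | ∀ φ : ℝ → ℝ, ContDiff ℝ ∞ φ → HasCompactSupport φ →
    ∫ x, deriv φ x • p.1 x = -∫ x, φ x • p.2 x}
  add_mem' := by
    rintro p q hp hq φ h1 h2
    have hd : Continuous (deriv φ) := h1.continuous_deriv (by simp)
    have e1 : ∫ x, deriv φ x • (p + q).1 x =
        ∫ x, (deriv φ x • p.1 x + deriv φ x • q.1 x) := by
      refine integral_congr_ae ?_
      filter_upwards [Lp.coeFn_add p.1 q.1] with x hx
      simp only [Prod.fst_add, hx, Pi.add_apply, smul_add]
    have e2 : ∫ x, φ x • (p + q).2 x = ∫ x, (φ x • p.2 x + φ x • q.2 x) := by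
      refine integral_congr_ae ?_
      filter_upwards [Lp.coeFn_add p.2 q.2] with x hx
      simp only [Prod.snd_add, hx, Pi.add_apply, smul_add]
    rw [e1, e2, integral_add (integrable_test_smul hd h2.deriv _)
      (integrable_test_smul hd h2.deriv _), integral_add
      (integrable_test_smul h1.continuous h2 _) (integrable_test_smul h1.continuous h2 _),
      hp φ h1 h2, hq φ h1 h2, neg_add]
  zero_mem' := by
    intro φ h1 h2
    have e : ∀ ψ : ℝ → ℝ, ∫ x, ψ x • (0 : SpinorL2) x = 0 := fun ψ => by
      rw [← integral_zero ℝ Spinor]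
      refine integral_congr_ae ?_
      filter_upwards [Lp.coeFn_zero Spinor 2 (volume : Measure ℝ)] with x hx
      rw [hx]; simp
    simp only [Prod.fst_zero, Prod.snd_zero, e, neg_zero]
  smul_mem' := by
    intro c p hp φ h1 h2
    have e : ∀ (ψ : ℝ → ℝ) (f : SpinorL2),
        ∫ x, ψ x • (c • f) x = c • ∫ x, ψ x • f x := fun ψ f => by
      rw [← integral_smul]
      refine integral_congr_ae ?_
      filter_upwards [Lp.coeFn_smul c f] with x hx
      rw [hx, Pi.smul_apply, smul_comm]
    simp only [Prod.smul_fst, Prod.smul_snd, e, hp φ h1 h2, smul_neg]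

/-- Weak derivatives are unique, so that `weakDerivGraph` is the graph of an operator. -/
theorem weakDerivGraph_unique (p : SpinorL2 × SpinorL2) (hp : p ∈ weakDerivGraph)
    (h0 : p.1 = 0) : p.2 = 0 := by
  have hloc : LocallyIntegrable (p.2 : ℝ → Spinor) volume :=
    (Lp.memLp p.2).locallyIntegrable (by norm_num)
  have h := ae_eq_zero_of_integral_contDiff_smul_eq_zero hloc (fun φ h1 h2 => by
    have := hp φ h1 h2
    have e : ∫ x, deriv φ x • p.1 x = 0 := by
      rw [h0, ← integral_zero ℝ Spinor]
      refine integral_congr_ae ?_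
      filter_upwards [Lp.coeFn_zero Spinor 2 (volume : Measure ℝ)] with x hx
      rw [hx]; simp
    rw [e] at this
    exact neg_eq_zero.mp this.symm)
  exact (Lp.eq_zero_iff_ae_eq_zero).2 h

/-- The weak derivative `d/dx` in `L²(ℝ; ℂ²)` with domain `H¹(ℝ; ℂ²)`. -/
noncomputable def weakDeriv : SpinorL2 →ₗ.[ℂ] SpinorL2 := weakDerivGraph.toLinearPMap

theorem weakDeriv_graph : weakDeriv.graph = weakDerivGraph :=
  Submodule.toLinearPMap_graph_eq _ weakDerivGraph_unique

/-- The operator on `ℂ²` given by a `2 × 2` matrix. -/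
noncomputable def matOp (M : Matrix (Fin 2) (Fin 2) ℂ) : Spinor →L[ℂ] Spinor :=
  Matrix.toEuclideanCLM (n := Fin 2) (𝕜 := ℂ) M

/-- The operator on `L²(ℝ; ℂ²)` given by a constant matrix. -/
noncomputable def constMat (M : Matrix (Fin 2) (Fin 2) ℂ) : SpinorL2 →L[ℂ] SpinorL2 :=
  (matOp M).compLpL 2 volume

/-- The free Dirac operator `H₀ = -i σ₁ d/dx + m σ₃` (with `c = ħ = 1`) on `H¹(ℝ; ℂ²)`. -/
noncomputable def freeDirac (m : ℝ) : SpinorL2 →ₗ.[ℂ] SpinorL2 where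
  domain := weakDeriv.domain
  toFun :=
    (-Complex.I) • ((constMat !![0, 1; 1, 0] : SpinorL2 →ₗ[ℂ] SpinorL2) ∘ₗ weakDeriv.toFun) +
    (m : ℂ) • ((constMat !![1, 0; 0, -1] : SpinorL2 →ₗ[ℂ] SpinorL2) ∘ₗ
      weakDeriv.domain.subtype)

theorem mul_add_ae (M : ℝ → Spinor →L[ℂ] Spinor) (f g : SpinorL2) :
    (fun x => M x (f x)) + (fun x => M x (g x)) =ᵐ[volume] fun x => M x ((f + g) x) := by
  filter_upwards [Lp.coeFn_add f g] with x hx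
  rw [hx, Pi.add_apply, Pi.add_apply, map_add]

theorem mul_smul_ae (M : ℝ → Spinor →L[ℂ] Spinor) (c : ℂ) (f : SpinorL2) :
    (c • fun x => M x (f x)) =ᵐ[volume] fun x => M x ((c • f) x) := by
  filter_upwards [Lp.coeFn_smul c f] with x hx
  rw [hx, Pi.smul_apply, Pi.smul_apply, map_smul]

/-- The maximal domain `{f ∈ L²(ℝ; ℂ²) | M f ∈ L²(ℝ; ℂ²)}` of a multiplication operator. -/
noncomputable def mulDomain (M : ℝ → Spinor →L[ℂ] Spinor) : Submodule ℂ SpinorL2 where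
  carrier := {f | MemLp (fun x => M x (f x)) 2 volume}
  add_mem' := fun {f g} hf hg => (MemLp.add hf hg).ae_eq (mul_add_ae M f g)
  zero_mem' := by
    refine (MemLp.zero (ε := Spinor)).ae_eq ?_
    filter_upwards [Lp.coeFn_zero Spinor 2 (volume : Measure ℝ)] with x hx
    rw [hx, Pi.zero_apply, map_zero]
  smul_mem' := fun c f hf => (MemLp.const_smul hf c).ae_eq (mul_smul_ae M c f)

/-- The maximal multiplication operator `(M f)(x) = M(x) f(x)` in `L²(ℝ; ℂ²)`. -/
noncomputable def mulOp (M : ℝ → Spinor →L[ℂ] Spinor) : SpinorL2 →ₗ.[ℂ] SpinorL2 where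
  domain := mulDomain M
  toFun :=
    { toFun := fun f => MemLp.toLp (fun x => M x (f.1 x)) f.2
      map_add' := fun f g =>
        (MemLp.toLp_congr (f + g).2 (MemLp.add f.2 g.2) (mul_add_ae M f.1 g.1).symm).trans
          (MemLp.toLp_add f.2 g.2)
      map_smul' := fun c f =>
        (MemLp.toLp_congr (c • f).2 (MemLp.const_smul f.2 c) (mul_smul_ae M c f.1).symm).trans
          (MemLp.toLp_const_smul c f.2) }

/-- The square root `|T|^{1/2}` of the absolute value `|T| = (T* T)^{1/2}`. -/
noncomputable def absSqrt (T : Spinor →L[ℂ] Spinor) : Spinor →L[ℂ] Spinor :=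
  CFC.sqrt (CFC.abs T)

/-- The partial isometry `U` of the polar decomposition `T = U |T|`, namely `U = T |T|⁺`, where the
pseudo-inverse `|T|⁺` inverts the nonzero eigenvalues of `|T|` and vanishes on its kernel. -/
noncomputable def polarU (T : Spinor →L[ℂ] Spinor) : Spinor →L[ℂ] Spinor :=
  T * cfc (fun t : ℝ => t⁻¹) (CFC.abs T)

/-- The multiplication operator `|V|^{1/2}`. -/
noncomputable def factorA (V : ℝ → Matrix (Fin 2) (Fin 2) ℂ) : SpinorL2 →ₗ.[ℂ] SpinorL2 :=
  mulOp fun x => absSqrt (matOp (V x))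

/-- The multiplication operator `U |V|^{1/2}`, where `V = U |V|` is the polar decomposition. -/
noncomputable def factorB (V : ℝ → Matrix (Fin 2) (Fin 2) ℂ) : SpinorL2 →ₗ.[ℂ] SpinorL2 :=
  mulOp fun x => polarU (matOp (V x)) * absSqrt (matOp (V x))

/-- The class `L^∞_0(ℝ)` of essentially bounded functions vanishing at infinity. -/
def MemLinfZero (f : ℝ → ℂ) : Prop :=
  MemLp f ⊤ volume ∧ ∀ ε > (0 : ℝ), ∃ r : ℝ, ∀ᵐ x : ℝ, r ≤ |x| → ‖f x‖ ≤ ε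

/-- `V = W + X` almost everywhere, where `W` has entries in `L¹(ℝ)` and `X` in `L^∞_0(ℝ)`. -/
structure IsDecomposition (V W X : ℝ → Matrix (Fin 2) (Fin 2) ℂ) : Prop where
  eq_add : ∀ᵐ x : ℝ, V x = W x + X x
  integrable : ∀ i j, Integrable fun x => W x i j
  linf_zero : ∀ i j, MemLinfZero fun x => X x i j

/-- `H` is the Dirac operator with potential `V`: the common closed extension of `H₀ + V` obtained
from the factorization `V = (U |V|^{1/2}) |V|^{1/2}` and from the factorizations
`V = (B_W  B_X) (A_W  A_X)ᵀ` belonging to all decompositions `V = W + X`. -/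
structure IsDiracOperator (m : ℝ) (V : ℝ → Matrix (Fin 2) (Fin 2) ℂ)
    (H : SpinorL2 →ₗ.[ℂ] SpinorL2) : Prop where
  polar : IsFactorizedExtension (freeDirac m) (factorA V) (factorB V) H
  decomposition : ∀ W X, IsDecomposition V W X →
    IsFactorizedExtension (freeDirac m) (column (factorA W) (factorA X))
      (row (factorB W) (factorB X)) H

end Dirac

/-! For `z ∈ ρ(H₀)` and `H = H₀ + BA`, the equation `(H - z) g = f` can be read as `g + S A g =
R₀(z) f`, where `S` is the closure of `R₀(z) B`. The pairs `(g, h)` with `g + S A g = R₀(z) (h - z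
g)` are taken as the graph of `H` (`perturbedGraph`); this makes sense even where `BA` has a poor
domain. The resolvent identity shows that the graph does not depend on `z`. Applying `A` turns the
equation into `(1 + Q(z)) A g = A R₀(z) f`, so inverting `1 + Q(z)` solves it and gives the
resolvent formula; conversely, a resolvent of `H` inverts `1 + Q(z)`. By
`FactorData.isFactorizedExtension`, bounded data at a single `z` with `1 + Q(z)` invertible yield
every claim at all points.

For the Dirac operator `R₀(z)` is convolution with an explicit exponential kernel `G`, and `S A g =
G * (V g)` for every factorization. The equation forces `g` to be bounded, and bounded functions lie
in the domain of every `A`. Hence the graph depends on `V` alone (`mem_perturbedGraph_mulOp`,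
`mem_perturbedGraph_column`), so one `H` serves all factorizations. The factors lie in `L² + L^∞`
with arbitrarily small `L²` part, while at `z = iη` the kernel stays bounded and its integral is
`O(1/η)`; together these make `Q(iη)` small. Uniqueness holds because an operator is determined by
its resolvent at one point.

The difference of resolvents contains the factor `A R₀(z)`. It is compact: `A` is approximated by
bounded multipliers of bounded support, and `G * f` is equicontinuous for `f` in the unit ball, so
freezing it on a fine grid gives finite rank approximations. A compact difference preserves
Fredholmness off the spectrum of `H₀`. On the spectrum, orthonormal wave packets that are
approximate eigenvectors of `H₀` exclude it, for `H` as for `H₀`. -/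

namespace UnboundedOp

/-! ### Unbounded operators and resolvents in terms of graphs -/

section Graphs

variable {E F G : Type*}
  [NormedAddCommGroup E] [InnerProductSpace ℂ E]
  [NormedAddCommGroup F] [InnerProductSpace ℂ F]
  [NormedAddCommGroup G] [InnerProductSpace ℂ G]

theorem mem_graph_ofCLM {S : E →L[ℂ] F} {x : E} {y : F} :
    (x, y) ∈ (ofCLM S).graph ↔ S x = y := by
  rw [LinearPMap.mem_graph_iff]
  constructor
  · rintro ⟨u, rfl, rfl⟩; rfl
  · rintro rfl; exact ⟨⟨x, trivial⟩, rfl, rfl⟩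

theorem mem_graph_shift {T : E →ₗ.[ℂ] E} {z : ℂ} {x y : E} :
    (x, y) ∈ (shift T z).graph ↔ (x, y + z • x) ∈ T.graph := by
  simp only [LinearPMap.mem_graph_iff]
  constructor
  · rintro ⟨u, rfl, rfl⟩
    exact ⟨u, rfl, by change T u = (T u - z • (u : E)) + z • (u : E); simp⟩
  · rintro ⟨u, rfl, hu⟩
    refine ⟨u, rfl, ?_⟩
    change T u - z • (u : E) = y
    rw [show T u = y + z • (u : E) from hu]; simp

theorem mem_graph_pcomp {g : F →ₗ.[ℂ] G} {f : E →ₗ.[ℂ] F} {x : E} {w : G} :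
    (x, w) ∈ (pcomp g f).graph ↔ ∃ y, (x, y) ∈ f.graph ∧ (y, w) ∈ g.graph := by
  simp only [LinearPMap.mem_graph_iff]
  constructor
  · rintro ⟨⟨_, ⟨u, hu, rfl⟩⟩, rfl, rfl⟩
    exact ⟨f u, ⟨u, rfl, rfl⟩, ⟨f u, hu⟩, rfl, rfl⟩
  · rintro ⟨_, ⟨u, rfl, rfl⟩, ⟨v, hv, rfl⟩⟩
    refine ⟨⟨u, ⟨u, ?_, rfl⟩⟩, rfl, ?_⟩
    · change f u ∈ g.domain
      exact hv ▸ v.2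
    · change g ⟨f u, _⟩ = g v
      congr 1
      exact Subtype.ext hv.symm

theorem isClosed_ofCLM (S : E →L[ℂ] F) : (ofCLM S).IsClosed := by
  have : ((ofCLM S).graph : Set (E × F)) = {p | S p.1 = p.2} := by
    ext ⟨x, y⟩; exact mem_graph_ofCLM
  rw [LinearPMap.IsClosed, this]
  exact isClosed_eq (by fun_prop) (by fun_prop)

theorem ofCLM_injective {S S' : E →L[ℂ] F} (h : ofCLM S = ofCLM S') : S = S' := by
  ext x
  have : (x, S x) ∈ (ofCLM S').graph := h ▸ mem_graph_ofCLM.2 rfl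
  exact (mem_graph_ofCLM.1 this).symm

theorem closure_of_isClosed {T : E →ₗ.[ℂ] F} (h : T.IsClosed) : T.closure = T := by
  apply LinearPMap.eq_of_eq_graph
  rw [← h.isClosable.graph_closure_eq_closure_graph]
  exact h.submodule_topologicalClosure_eq

/-- The graph of `S` is closed and contains that of `T`; continuity of `u ↦ (u, S u)` carries
density of the domain to density of the graph. -/
theorem closure_eq_ofCLM {T : E →ₗ.[ℂ] F} {S : E →L[ℂ] F} (hd : Dense (T.domain : Set E))
    (h : ∀ x y, (x, y) ∈ T.graph → S x = y) : T.closure = ofCLM S := by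
  have hle : T ≤ ofCLM S := by
    apply LinearPMap.le_of_le_graph
    rintro ⟨x, y⟩ hxy
    exact mem_graph_ofCLM.2 (h x y hxy)
  have hc : T.IsClosable := (isClosed_ofCLM S).isClosable.leIsClosable hle
  apply LinearPMap.eq_of_eq_graph
  rw [← hc.graph_closure_eq_closure_graph]
  apply le_antisymm
  · exact Submodule.topologicalClosure_minimal _ (LinearPMap.le_graph_of_le hle)
      (isClosed_ofCLM S)
  · rintro ⟨x, y⟩ hxy
    obtain rfl := mem_graph_ofCLM.1 hxy
    change (x, S x) ∈ closure (T.graph : Set (E × F))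
    have hmem : ∀ u ∈ (T.domain : Set E), (u, S u) ∈ (T.graph : Set (E × F)) := by
      intro u hu
      have := T.mem_graph ⟨u, hu⟩
      rwa [← h _ _ this] at this
    exact map_mem_closure (f := fun u => (u, S u)) (by fun_prop) (hd x) hmem

theorem boundedClosure_eq {T : E →ₗ.[ℂ] F} {S : E →L[ℂ] F} (h : T.closure = ofCLM S) :
    boundedClosure T = S := by
  have hb : HasBoundedClosure T := ⟨S, h⟩
  rw [boundedClosure, dif_pos hb]
  exact ofCLM_injective (hb.choose_spec.symm.trans h)

/-- The form used throughout: no membership proofs for domains occur in it. -/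
theorem isResolventAt_iff {T : E →ₗ.[ℂ] E} {z : ℂ} {R : E →L[ℂ] E} :
    IsResolventAt T z R ↔ (∀ f, (R f, f + z • R f) ∈ T.graph) ∧
      ∀ g h, (g, h) ∈ T.graph → R (h - z • g) = g := by
  refine and_congr (forall_congr' fun f => ?_) ⟨fun H g h hg => ?_, fun H u => ?_⟩
  · rw [← mem_graph_shift, LinearPMap.mem_graph_iff]
    constructor
    · rintro ⟨h, hf⟩; exact ⟨⟨_, h⟩, rfl, hf⟩
    · rintro ⟨u, hu, hf⟩
      have hu' : (u : E) = R f := hu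
      refine ⟨hu' ▸ u.2, ?_⟩
      exact (congrArg (shift T z) (Subtype.ext hu'.symm)).trans hf
  · have : (g, h - z • g) ∈ (shift T z).graph := mem_graph_shift.2 (by simpa using hg)
    obtain ⟨u, rfl, hu⟩ := (LinearPMap.mem_graph_iff _).1 this
    rw [← show shift T z u = h - z • (u : E) from hu]; exact H u
  · have := (shift T z).mem_graph u
    have h2 := H _ _ (mem_graph_shift.1 this)
    simpa using h2

theorem IsResolventAt.unique {T : E →ₗ.[ℂ] E} {z : ℂ} {R R' : E →L[ℂ] E}
    (h : IsResolventAt T z R) (h' : IsResolventAt T z R') : R = R' := by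
  rw [isResolventAt_iff] at h h'
  ext f
  have := h'.2 _ _ (h.1 f)
  simpa using this.symm

theorem IsResolventAt.mem_rho {T : E →ₗ.[ℂ] E} {z : ℂ} {R : E →L[ℂ] E}
    (h : IsResolventAt T z R) : z ∈ rho T := ⟨R, h⟩

theorem isResolventAt_res {T : E →ₗ.[ℂ] E} {z : ℂ} (h : z ∈ rho T) :
    IsResolventAt T z (res T z) := by
  rw [res, dif_pos h]; exact h.choose_spec

theorem IsResolventAt.res_eq {T : E →ₗ.[ℂ] E} {z : ℂ} {R : E →L[ℂ] E}
    (h : IsResolventAt T z R) : res T z = R :=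
  (isResolventAt_res h.mem_rho).unique h

/-- One resolvent determines the whole operator; closedness and uniqueness follow from this
description. -/
theorem IsResolventAt.mem_graph_iff {T : E →ₗ.[ℂ] E} {z : ℂ} {R : E →L[ℂ] E}
    (h : IsResolventAt T z R) {x y : E} : (x, y) ∈ T.graph ↔ R (y - z • x) = x := by
  rw [isResolventAt_iff] at h
  refine ⟨h.2 x y, fun hx => ?_⟩
  have := h.1 (y - z • x)
  rw [hx] at this
  simpa using this

theorem IsResolventAt.isClosed {T : E →ₗ.[ℂ] E} {z : ℂ} {R : E →L[ℂ] E}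
    (h : IsResolventAt T z R) : T.IsClosed := by
  have : (T.graph : Set (E × E)) = {p | R (p.2 - z • p.1) = p.1} := by
    ext ⟨x, y⟩; exact h.mem_graph_iff
  rw [LinearPMap.IsClosed, this]
  exact isClosed_eq (by fun_prop) (by fun_prop)

theorem IsResolventAt.ext {T T' : E →ₗ.[ℂ] E} {z : ℂ} {R : E →L[ℂ] E}
    (h : IsResolventAt T z R) (h' : IsResolventAt T' z R) : T = T' := by
  apply LinearPMap.eq_of_eq_graph
  ext ⟨x, y⟩
  rw [h.mem_graph_iff, h'.mem_graph_iff]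

/-- The resolvent identity. -/
theorem IsResolventAt.identity {T : E →ₗ.[ℂ] E} {z w : ℂ} {R R' : E →L[ℂ] E}
    (h : IsResolventAt T z R) (h' : IsResolventAt T w R') (f : E) :
    R f = R' f + (z - w) • R' (R f) := by
  rw [isResolventAt_iff] at h h'
  have := h'.2 _ _ (h.1 f)
  rw [← map_smul, ← map_add, sub_smul, ← add_sub_assoc]
  exact this.symm

theorem IsResolventAt.identity' {T : E →ₗ.[ℂ] E} {z w : ℂ} {R R' : E →L[ℂ] E}
    (h : IsResolventAt T z R) (h' : IsResolventAt T w R') (f : E) :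
    R f = R' f + (z - w) • R (R' f) := by
  rw [eq_sub_of_add_eq (h'.identity h f).symm, ← neg_sub w z, neg_smul, sub_eq_add_neg]

end Graphs

/-! ### The factorized perturbation in abstract form -/

section Factorization

variable {E F : Type*}
  [NormedAddCommGroup E] [InnerProductSpace ℂ E]
  [NormedAddCommGroup F] [InnerProductSpace ℂ F]

/-- The bounded operators `T = A R`, `S = closure (R B)` and `Q = closure (A R B)` attached to a
factorization and a bounded operator `R`. -/
structure FactorData (A : E →ₗ.[ℂ] F) (B : F →ₗ.[ℂ] E) (R : E →L[ℂ] E)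
    (T : E →L[ℂ] F) (S : F →L[ℂ] E) (Q : F →L[ℂ] F) : Prop where
  left : ∀ f, (R f, T f) ∈ A.graph
  right : ∀ k b, (k, b) ∈ B.graph → S k = R b
  both : ∀ k, (S k, Q k) ∈ A.graph

variable {H₀ : E →ₗ.[ℂ] E} {A : E →ₗ.[ℂ] F} {B : F →ₗ.[ℂ] E} {R R' : E →L[ℂ] E}
  {T : E →L[ℂ] F} {S : F →L[ℂ] E} {Q₀ : F →L[ℂ] F} {z w : ℂ}

theorem graph_add_smul {p q : E × F} (hp : p ∈ A.graph) (hq : q ∈ A.graph) (c : ℂ) :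
    (p.1 + c • q.1, p.2 + c • q.2) ∈ A.graph :=
  A.graph.add_mem hp (A.graph.smul_mem c hq)

/-- The resolvent identity, in its two orders, expresses `A R'` and `R' B` through the data at `z`.
Thus bounds need to be proved at only one spectral parameter. -/
theorem FactorData.transfer (D : FactorData A B R T S Q₀) (hR : IsResolventAt H₀ z R)
    (hR' : IsResolventAt H₀ w R') :
    FactorData A B R' (T + (w - z) • T ∘L R') (S + (w - z) • R' ∘L S)
      (Q₀ + (w - z) • T ∘L (S + (w - z) • R' ∘L S)) where
  left f := by
    have := graph_add_smul (D.left f) (D.left (R' f)) (w - z)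
    rw [hR'.identity hR f]
    exact this
  right k b hk := by
    simp only [add_apply, smul_apply,
      ContinuousLinearMap.comp_apply, D.right k b hk]
    exact (hR'.identity' hR b).symm
  both k := by
    have := graph_add_smul (D.both k) (D.left ((S + (w - z) • R' ∘L S) k)) (w - z)
    -- With `S'` the new right factor, `S' = S + (w - z) R S'` exhibits its values as sums of
    -- vectors on which `A` is already known.
    have e : (S + (w - z) • R' ∘L S) k = S k + (w - z) • R ((S + (w - z) • R' ∘L S) k) := by
      have h1 := hR'.identity hR (S k)
      simp only [add_apply, smul_apply,
        ContinuousLinearMap.comp_apply, map_add, map_smul, ← h1]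
    nth_rewrite 1 [e]
    exact this

theorem FactorData.AR_eq (D : FactorData A B R T S Q₀) (hR : IsResolventAt H₀ z R) :
    AR H₀ A z = ofCLM T := by
  apply LinearPMap.eq_of_eq_graph
  ext ⟨x, y⟩
  rw [AR, mem_graph_pcomp, mem_graph_ofCLM, hR.res_eq]
  constructor
  · rintro ⟨u, hu, huy⟩
    rw [mem_graph_ofCLM] at hu
    subst hu
    exact LinearPMap.mem_graph_snd_inj A (D.left x) huy rfl
  · rintro rfl
    exact ⟨R x, mem_graph_ofCLM.2 rfl, D.left x⟩

theorem FactorData.closure_RB (D : FactorData A B R T S Q₀) (hR : IsResolventAt H₀ z R)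
    (hB : Dense (B.domain : Set F)) : (RB H₀ B z).closure = ofCLM S := by
  refine closure_eq_ofCLM (hB.mono ?_) ?_
  · intro k hk
    have hk' := B.mem_graph ⟨k, hk⟩
    exact LinearPMap.mem_domain_of_mem_graph
      (mem_graph_pcomp.2 ⟨_, hk', mem_graph_ofCLM.2 rfl⟩)
  · intro k y hk
    rw [RB, mem_graph_pcomp, hR.res_eq] at hk
    obtain ⟨b, hb, hy⟩ := hk
    rw [D.right k b hb, mem_graph_ofCLM.1 hy]

theorem FactorData.closure_ARB (D : FactorData A B R T S Q₀) (hR : IsResolventAt H₀ z R)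
    (hB : Dense (B.domain : Set F)) : (ARB H₀ A B z).closure = ofCLM Q₀ := by
  have key : ∀ k b, (k, b) ∈ B.graph → (R b, Q₀ k) ∈ A.graph := fun k b hk =>
    D.right k b hk ▸ D.both k
  refine closure_eq_ofCLM (hB.mono ?_) ?_
  · intro k hk
    have hk' := B.mem_graph ⟨k, hk⟩
    refine LinearPMap.mem_domain_of_mem_graph (y := Q₀ k)
      (mem_graph_pcomp.2 ⟨_, mem_graph_pcomp.2 ⟨_, hk', mem_graph_ofCLM.2 rfl⟩, ?_⟩)
    rw [hR.res_eq]
    exact key _ _ hk'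
  · intro k y hk
    rw [ARB, mem_graph_pcomp] at hk
    obtain ⟨u, hu, hy⟩ := hk
    rw [RB, mem_graph_pcomp, hR.res_eq] at hu
    obtain ⟨b, hb, hu⟩ := hu
    rw [mem_graph_ofCLM] at hu
    subst hu
    exact LinearPMap.mem_graph_snd_inj A (key k b hb) hy rfl

theorem FactorData.Q_eq (D : FactorData A B R T S Q₀) (hR : IsResolventAt H₀ z R)
    (hB : Dense (B.domain : Set F)) : Q H₀ A B z = Q₀ :=
  boundedClosure_eq (D.closure_ARB hR hB)

theorem neg_one_mem_resolventSet_iff {K : F →L[ℂ] F} :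
    (-1 : ℂ) ∈ resolventSet ℂ K ↔ IsUnit (1 + K) := by
  rw [spectrum.mem_resolventSet_iff, ← IsUnit.neg_iff, map_neg, map_one]
  simp only [neg_sub, sub_neg_eq_add, add_comm]

theorem FactorData.isAdmissible (D : FactorData A B R T S Q₀) (hR : IsResolventAt H₀ z R)
    (hd : Dense (H₀.domain : Set E)) (hAc : A.IsClosed) (hA : Dense (A.domain : Set E))
    (hBc : B.IsClosed) (hB : Dense (B.domain : Set F)) (hu : IsUnit (1 + Q₀)) :
    IsAdmissible H₀ A B where
  closed_free := hR.isClosed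
  dense_free := hd
  closed_A := hAc
  dense_A := hA
  closed_B := hBc
  dense_B := hB
  rho_nonempty := ⟨z, hR.mem_rho⟩
  bounded_AR w hw := ⟨_, (D.transfer hR (isResolventAt_res hw)).AR_eq (isResolventAt_res hw)⟩
  bounded_RB w hw :=
    ⟨_, (D.transfer hR (isResolventAt_res hw)).closure_RB (isResolventAt_res hw) hB⟩
  bounded_ARB w hw :=
    ⟨_, (D.transfer hR (isResolventAt_res hw)).closure_ARB (isResolventAt_res hw) hB⟩
  exists_neg_one_mem := ⟨z, hR.mem_rho, by
    rw [D.Q_eq hR hB]; exact neg_one_mem_resolventSet_iff.2 hu⟩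

/-- The pairs `(g, h)` such that `g + S A g = R (h - z g)`, which is a form of `H g = h` for
`H = H₀ + B A`. -/
def perturbedGraph (A : E →ₗ.[ℂ] F) (S : F →L[ℂ] E) (R : E →L[ℂ] E) (z : ℂ) :
    Submodule ℂ (E × E) where
  carrier := {p | ∃ a, (p.1, a) ∈ A.graph ∧ p.1 + S a = R (p.2 - z • p.1)}
  add_mem' := by
    rintro p q ⟨a, ha, hp⟩ ⟨b, hb, hq⟩
    refine ⟨a + b, A.graph.add_mem ha hb, ?_⟩
    simp only [Prod.fst_add, Prod.snd_add, map_add, map_sub, smul_add] at *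
    rw [add_add_add_comm, hp, hq]; abel
  zero_mem' := ⟨0, A.graph.zero_mem, by simp⟩
  smul_mem' := by
    rintro c p ⟨a, ha, hp⟩
    refine ⟨c • a, A.graph.smul_mem c ha, ?_⟩
    simp only [Prod.smul_fst, Prod.smul_snd, map_smul]
    rw [← smul_add, hp, smul_comm z c, ← smul_sub, map_smul]

theorem mem_perturbedGraph {g h : E} :
    (g, h) ∈ perturbedGraph A S R z ↔ ∃ a, (g, a) ∈ A.graph ∧ g + S a = R (h - z • g) :=
  Iff.rfl

/-- The perturbed graph does not depend on the spectral parameter. -/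
theorem perturbedGraph_le (hR : IsResolventAt H₀ z R) (hR' : IsResolventAt H₀ w R') :
    perturbedGraph A S R z ≤ perturbedGraph A (S + (w - z) • R' ∘L S) R' w := by
  rintro ⟨g, h⟩ ⟨a, ha, e⟩
  refine ⟨a, ha, ?_⟩
  simp only [add_apply, smul_apply,
    ContinuousLinearMap.comp_apply] at e ⊢
  have h1 := hR'.identity' hR (h - z • g)
  rw [← e] at h1
  have h2 : h - w • g = (h - z • g) - (w - z) • g := by rw [sub_smul]; abel
  rw [h2, map_sub, h1, map_smul, map_add, smul_add]
  abel

/-- The reverse inclusion is the same lemma with the two points exchanged, since carrying `S` to `w`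
and back returns `S`. -/
theorem perturbedGraph_eq (hR : IsResolventAt H₀ z R) (hR' : IsResolventAt H₀ w R') :
    perturbedGraph A S R z = perturbedGraph A (S + (w - z) • R' ∘L S) R' w := by
  refine le_antisymm (perturbedGraph_le hR hR') ?_
  have := perturbedGraph_le (A := A) (S := S + (w - z) • R' ∘L S) hR' hR
  convert this using 2
  ext k
  simp only [add_apply, smul_apply,
    ContinuousLinearMap.comp_apply, map_add, map_smul]
  have h1 := hR'.identity hR (S k)
  rw [← neg_sub w z, neg_smul, ← map_smul R, ← map_add, map_add R, map_smul R, ← h1]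
  abel

/-- Identifies an `S` transferred from another point with one constructed directly as an integral
operator. -/
theorem FactorData.right_unique {A' : E →ₗ.[ℂ] F} {T' : E →L[ℂ] F} {S' : F →L[ℂ] E}
    {Q' : F →L[ℂ] F} (D : FactorData A B R T S Q₀) (D' : FactorData A' B R T' S' Q')
    (hB : Dense (B.domain : Set F)) : S = S' := by
  refine DFunLike.coe_injective (Continuous.ext_on hB S.continuous S'.continuous ?_)
  intro k hk
  have := B.mem_graph ⟨k, hk⟩
  exact (D.right _ _ this).trans (D'.right _ _ this).symm

/-- At `g = 0` the defining equation becomes `R h = 0`, and a resolvent is injective. -/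
theorem perturbedGraph_snd (hR : IsResolventAt H₀ z R)
    (p : E × E) (hp : p ∈ perturbedGraph A S R z) (h0 : p.1 = 0) : p.2 = 0 := by
  obtain ⟨a, ha, e⟩ := hp
  have h1 : a = 0 := LinearPMap.graph_fst_eq_zero_snd A ha h0
  rw [h0, h1] at e
  simp only [map_zero, add_zero, smul_zero, sub_zero] at e
  have := (isResolventAt_iff.1 hR).1 p.2
  rw [← e] at this
  simpa using LinearPMap.graph_fst_eq_zero_snd H₀ this rfl

variable {H : E →ₗ.[ℂ] E}

/-- Applying `A` to `g + S a = R f`, where `a = A g`, gives `(1 + Q₀) a = T f`. Hence `a = N T f`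
and `g = R f - S N T f`. -/
theorem FactorData.isResolventAt (D : FactorData A B R T S Q₀)
    (hH : H.graph = perturbedGraph A S R z) {N : F →L[ℂ] F}
    (h1 : ∀ k, N k + Q₀ (N k) = k) (h2 : ∀ k, N (k + Q₀ k) = k) :
    IsResolventAt H z (R - S ∘L N ∘L T) := by
  rw [isResolventAt_iff, hH]
  constructor
  · intro f
    refine ⟨N (T f), ?_, ?_⟩
    · have := A.graph.sub_mem (D.left f) (D.both (N (T f)))
      have e : T f - Q₀ (N (T f)) = N (T f) := by
        rw [sub_eq_iff_eq_add]; exact (h1 _).symm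
      simpa [e] using this
    · simp
  · rintro g h ⟨a, ha, e⟩
    have hT : a + Q₀ a = T (h - z • g) := by
      have := A.graph.add_mem ha (D.both a)
      refine LinearPMap.mem_graph_snd_inj A this (D.left (h - z • g)) ?_
      exact e
    simp only [sub_apply, ContinuousLinearMap.comp_apply, ← hT, h2, ← e]
    simp

/-- Here `Y` plays the role of the closure of `(H - z)⁻¹ B`. Applying `A` to `Y + S A Y = S` gives
`(1 + Q₀)(1 - A Y) = 1`; injectivity of `1 + Q₀` makes this right inverse two-sided. -/
theorem FactorData.isUnit_of_mem_rho (D : FactorData A B R T S Q₀)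
    (hH : H.graph = perturbedGraph A S R z)
    {Y : F →L[ℂ] E} {AY : F →L[ℂ] F} (hY : ∀ k, (Y k, AY k) ∈ A.graph)
    (hYS : ∀ k, Y k + S (AY k) = S k) (hz : z ∈ rho H) : IsUnit (1 + Q₀) := by
  obtain ⟨RH, hRH⟩ := hz
  rw [isResolventAt_iff, hH] at hRH
  have inj : ∀ k, k + Q₀ k = 0 → k = 0 := by
    intro k hk
    have hQ : Q₀ k = -k := by rw [eq_neg_iff_add_eq_zero, add_comm]; exact hk
    -- A null vector `k` of `1 + Q₀` makes `S k` an eigenvector of `H` at `z`, so `S k = 0`; then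
    -- `Q₀ k = A S k = 0`, which gives `k = 0`.
    have hmem : (S k, z • S k) ∈ perturbedGraph A S R z := by
      refine ⟨Q₀ k, D.both k, ?_⟩
      simp [hQ]
    have h0 := hRH.2 _ _ hmem
    rw [sub_self, map_zero] at h0
    have := LinearPMap.graph_fst_eq_zero_snd A (D.both k) h0.symm
    rw [hQ] at this
    simpa using this
  have right : ∀ k, (k - AY k) + Q₀ (k - AY k) = k := by
    intro k
    have h1 := A.graph.add_mem (hY k) (D.both (AY k))
    have h2 := LinearPMap.mem_graph_snd_inj A h1 (D.both k) (hYS k)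
    simp only at h2
    rw [map_sub, ← h2]; abel
  have e1 : (1 + Q₀) * (1 - AY) = 1 := by
    ext k; simpa using right k
  have e2 : (1 - AY) * (1 + Q₀) = 1 := by
    ext k
    have : (1 + Q₀) (((1 - AY) * (1 + Q₀)) k - k) = 0 := by
      have := congrArg (fun X : F →L[ℂ] F => X ((1 + Q₀) k)) e1
      rw [map_sub, sub_eq_zero]
      exact this
    have := inj _ this
    exact sub_eq_zero.1 this
  exact ⟨⟨1 + Q₀, 1 - AY, e1, e2⟩, rfl⟩

theorem FactorData.extends_sum (D : FactorData A B R T S Q₀) (hR : IsResolventAt H₀ z R)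
    (hH : H.graph = perturbedGraph A S R z) : H₀ + pcomp B A ≤ H := by
  apply LinearPMap.le_of_le_graph
  rintro ⟨g, h⟩ hg
  obtain ⟨u, rfl, rfl⟩ := (LinearPMap.mem_graph_iff _).1 hg
  have h1 : ((u : E), H₀ ⟨u, u.2.1⟩) ∈ H₀.graph := H₀.mem_graph ⟨u, u.2.1⟩
  have h2 : ((u : E), pcomp B A ⟨u, u.2.2⟩) ∈ (pcomp B A).graph :=
    (pcomp B A).mem_graph ⟨u, u.2.2⟩
  obtain ⟨a, ha, hb⟩ := mem_graph_pcomp.1 h2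
  rw [hH]
  refine ⟨a, ha, ?_⟩
  have h3 := (isResolventAt_iff.1 hR).2 _ _ h1
  change (u : E) + S a = R (H₀ ⟨u, u.2.1⟩ + pcomp B A ⟨u, u.2.2⟩ - z • (u : E))
  rw [D.right _ _ hb, add_sub_right_comm, map_add, h3]

variable [CompleteSpace E] [CompleteSpace F]

/-- Let `h` be orthogonal to the range of `R - S N T` and put `k = N* S* h`. Then `R* h = T* k`, and
restricting to the range of `B` gives `S* h = Q₀* k`. Since also `(1 + Q₀)* k = S* h`, it follows
that `k = 0`, so `h` is orthogonal to the dense domain of `H₀`. -/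
theorem FactorData.dense_domain (D : FactorData A B R T S Q₀) (hR : IsResolventAt H₀ z R)
    (hd : Dense (H₀.domain : Set E)) (hB : Dense (B.domain : Set F))
    (hH : H.graph = perturbedGraph A S R z) {N : F →L[ℂ] F}
    (h1 : ∀ k, N k + Q₀ (N k) = k) (h2 : ∀ k, N (k + Q₀ k) = k) :
    Dense (H.domain : Set E) := by
  have hRH := D.isResolventAt hH h1 h2
  rw [Submodule.dense_iff_topologicalClosure_eq_top,
    Submodule.topologicalClosure_eq_top_iff, Submodule.eq_bot_iff]
  intro h hh
  have e0 : ∀ f, inner ℂ h (R f) = inner ℂ h (S (N (T f))) := by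
    intro f
    have hf : R f - S (N (T f)) ∈ H.domain :=
      LinearPMap.mem_domain_of_mem_graph ((isResolventAt_iff.1 hRH).1 f)
    have := (Submodule.mem_orthogonal' _ _).1 hh _ hf
    rw [inner_sub_right, sub_eq_zero] at this
    exact this
  let k : F := N.adjoint (S.adjoint h)
  have e1 : ∀ f, inner ℂ h (R f) = inner ℂ k (T f) := fun f => by
    rw [e0, ContinuousLinearMap.adjoint_inner_left, ContinuousLinearMap.adjoint_inner_left]
  have e2 : ∀ l, inner ℂ h (S l) = inner ℂ k (Q₀ l) := by
    have : Set.EqOn (fun l => inner ℂ h (S l)) (fun l => inner ℂ k (Q₀ l)) B.domain := by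
      intro l hl
      have hb := B.mem_graph ⟨l, hl⟩
      have hr := D.right _ _ hb
      simp only at hr
      have ht : T (B ⟨l, hl⟩) = Q₀ l :=
        LinearPMap.mem_graph_snd_inj A (D.left _) (D.both l) hr.symm
      simp only
      rw [hr, e1, ht]
    intro l
    exact congrFun (Continuous.ext_on hB (by fun_prop) (by fun_prop) this) l
  have e3 : ∀ l, inner ℂ k l = 0 := by
    intro l
    have a1 : inner ℂ k (l + Q₀ l) = inner ℂ h (S l) := by
      rw [ContinuousLinearMap.adjoint_inner_left, ContinuousLinearMap.adjoint_inner_left, h2]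
    rw [inner_add_right, e2] at a1
    simpa using a1
  have e4 : ∀ f, inner ℂ h (R f) = 0 := fun f => by rw [e1, e3]
  have : (H₀.domain)ᗮ = ⊥ := by
    rw [← Submodule.topologicalClosure_eq_top_iff, ← Submodule.dense_iff_topologicalClosure_eq_top]
    exact hd
  rw [Submodule.eq_bot_iff] at this
  refine this h ((Submodule.mem_orthogonal' _ _).2 fun u hu => ?_)
  have hu' := (isResolventAt_iff.1 hR).2 _ _ (H₀.mem_graph ⟨u, hu⟩)
  rw [← show R _ = u from hu']
  exact e4 _

/-- Everything is known at `z`, and the data and the graph move to any `w ∈ ρ(H₀)`. The delicate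
point is that `w ∈ ρ(H)` makes `1 + Q(w)` invertible: this needs a bounded version of `(H - w)⁻¹ B`,
obtained from its analogue `S N` at `z` by the resolvent identity for `H`. -/
theorem FactorData.isFactorizedExtension (D : FactorData A B R T S Q₀)
    (hR : IsResolventAt H₀ z R)
    (hd : Dense (H₀.domain : Set E)) (hAc : A.IsClosed) (hA : Dense (A.domain : Set E))
    (hBc : B.IsClosed) (hB : Dense (B.domain : Set F)) (hu : IsUnit (1 + Q₀))
    (hH : H.graph = perturbedGraph A S R z) : IsFactorizedExtension H₀ A B H := by
  obtain ⟨U, hU⟩ := hu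
  have hinv : ∀ {K : F →L[ℂ] F} (U : (F →L[ℂ] F)ˣ), (U : F →L[ℂ] F) = 1 + K →
      (∀ k, (↑U⁻¹ : F →L[ℂ] F) k + K ((↑U⁻¹ : F →L[ℂ] F) k) = k) ∧
      (∀ k, (↑U⁻¹ : F →L[ℂ] F) (k + K k) = k) := by
    intro K U hU
    refine ⟨fun k => ?_, fun k => ?_⟩
    · have := congrArg (fun X : F →L[ℂ] F => X k) U.mul_inv
      rw [hU] at this
      simpa using this
    · have := congrArg (fun X : F →L[ℂ] F => X k) U.inv_mul
      rw [hU] at this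
      simpa using this
  obtain ⟨hN1, hN2⟩ := hinv U hU
  set N : F →L[ℂ] F := ↑U⁻¹ with hN
  have hRH := D.isResolventAt hH hN1 hN2
  have hres : ∀ w R' (hR' : IsResolventAt H₀ w R') (U' : (F →L[ℂ] F)ˣ),
      (U' : F →L[ℂ] F) = 1 + Q H₀ A B w →
      IsResolventAt H w (R' - boundedClosure (RB H₀ B w) ∘L Ring.inverse (1 + Q H₀ A B w) ∘L
        boundedClosure (AR H₀ A w)) := by
    intro w R' hR' U' hU'
    have D' := D.transfer hR hR'
    have hQ := D'.Q_eq hR' hB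
    obtain ⟨a1, a2⟩ := hinv U' hU'
    rw [← hU', Ring.inverse_unit, boundedClosure_eq (D'.closure_RB hR' hB),
      boundedClosure_eq (S := T + (w - z) • T ∘L R')
        (by rw [D'.AR_eq hR', closure_of_isClosed (isClosed_ofCLM _)])]
    rw [hQ] at a1 a2
    exact D'.isResolventAt (hH.trans (perturbedGraph_eq hR hR')) a1 a2
  have hunit : ∀ w R' (_ : IsResolventAt H₀ w R'), w ∈ rho H → IsUnit (1 + Q H₀ A B w) := by
    intro w R' hR' hw
    have D' := D.transfer hR hR'
    rw [D'.Q_eq hR' hB]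
    obtain ⟨RH, hw⟩ := hw
    have hHw := hH.trans (perturbedGraph_eq hR hR')
    -- `Y` is the bounded closure of `(H - w)⁻¹ B`
    set S' := S + (w - z) • R' ∘L S with hS'
    have hRA : ∀ g, ∃ a, (RH g, a) ∈ A.graph ∧ RH g + S' a = R' g := by
      intro g
      have := (isResolventAt_iff.1 hw).1 g
      rw [hHw] at this
      obtain ⟨a, ha, e⟩ := this
      exact ⟨a, ha, by simpa using e⟩
    -- By the resolvent identity `RH g` is `(H - z)⁻¹` applied to `g + (w - z) RH g`, and `A (H -
    -- z)⁻¹ = N T`.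
    have hNA : ∀ g, (RH g, (N ∘L T) (g + (w - z) • RH g)) ∈ A.graph := by
      intro g
      have e := hw.identity hRH g
      have := A.graph.sub_mem (D.left (g + (w - z) • RH g))
        (D.both (N (T (g + (w - z) • RH g))))
      have e' : T (g + (w - z) • RH g) - Q₀ (N (T (g + (w - z) • RH g))) =
          N (T (g + (w - z) • RH g)) := by
        rw [sub_eq_iff_eq_add]; exact (hN1 _).symm
      rw [← map_smul, ← map_add] at e
      have e2 : RH g = R (g + (w - z) • RH g) - S (N (T (g + (w - z) • RH g))) := e
      rw [Prod.mk_sub_mk, e', ← e2] at this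
      exact this
    refine FactorData.isUnit_of_mem_rho D' hHw
      (Y := S ∘L N + (w - z) • RH ∘L S ∘L N)
      (AY := Q₀ ∘L N + (w - z) • (N ∘L T ∘L (1 + (w - z) • RH)) ∘L S ∘L N) ?_ ?_ ⟨RH, hw⟩
    · intro k
      exact graph_add_smul (D.both (N k)) (hNA (S (N k))) (w - z)
    · intro k
      obtain ⟨a, ha, e⟩ := hRA (S (N k))
      have ea : (N ∘L T) (S (N k) + (w - z) • RH (S (N k))) = a :=
        LinearPMap.mem_graph_snd_inj A (hNA (S (N k))) ha rfl
      have hk : k = N k + Q₀ (N k) := (hN1 k).symm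
      have e5 : (Q₀ ∘L N + (w - z) • (N ∘L T ∘L (1 + (w - z) • RH)) ∘L S ∘L N) k
          = Q₀ (N k) + (w - z) • a := by
        rw [← ea]; rfl
      rw [e5]
      change S (N k) + (w - z) • RH (S (N k)) + S' (Q₀ (N k) + (w - z) • a) = S' k
      have e6 : S' k = S' (N k) + S' (Q₀ (N k)) := by rw [← map_add, hN1]
      have e7 : S' (N k) = S (N k) + (w - z) • R' (S (N k)) := rfl
      rw [e6, e7, map_add, map_smul, ← e, smul_add]
      abel
  exact
  { admissible := D.isAdmissible hR hd hAc hA hBc hB ⟨U, hU⟩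
    closed := hRH.isClosed
    dense := D.dense_domain hR hd hB hH hN1 hN2
    extends_sum := D.extends_sum hR hH
    rho_inter := by
      ext w
      simp only [Set.mem_inter_iff, Set.mem_ofPred_eq, neg_one_mem_resolventSet_iff]
      constructor
      · rintro ⟨hw, R', hR'⟩
        exact ⟨⟨R', hR'⟩, hunit w R' hR' hw⟩
      · rintro ⟨⟨R', hR'⟩, U', hU'⟩
        exact ⟨⟨_, hres w R' hR' U' hU'⟩, R', hR'⟩
    res_eq := by
      rintro w ⟨⟨R', hR'⟩, hw⟩
      obtain ⟨U', hU'⟩ := hunit w R' hR' hw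
      rw [hR'.res_eq]
      exact (hres w R' hR' U' hU').res_eq }

omit [CompleteSpace E] [CompleteSpace F] in
-- The right side of the resolvent formula does not involve the extension, and admissibility
-- supplies a point where the formula applies.
theorem IsFactorizedExtension.unique {H' : E →ₗ.[ℂ] E} (h : IsFactorizedExtension H₀ A B H)
    (h' : IsFactorizedExtension H₀ A B H') : H = H' := by
  obtain ⟨z, hz, hQ⟩ := h.admissible.exists_neg_one_mem
  have h1 : z ∈ rho H ∩ rho H₀ := by rw [h.rho_inter]; exact ⟨hz, hQ⟩
  have h2 : z ∈ rho H' ∩ rho H₀ := by rw [h'.rho_inter]; exact ⟨hz, hQ⟩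
  have e : res H z = res H' z := by
    rw [h.res_eq z ⟨hz, h1.1⟩, h'.res_eq z ⟨hz, h2.1⟩]
  exact (isResolventAt_res h1.1).ext (e ▸ isResolventAt_res h2.1)

end Factorization

end UnboundedOp

namespace UnboundedOp

/-! ### Fredholm operators and compact differences of resolvents -/

section Fredholm

open scoped LinearMap.FiniteRangeSetoid
open Filter Topology

variable {E : Type*} [NormedAddCommGroup E] [InnerProductSpace ℂ E]

/-- Compose `K` with the orthogonal projection onto the span of a finite `ε`-net of the image of the
unit ball. -/
theorem exists_finiteRange_approx {K : E →L[ℂ] E} (hK : IsCompactOperator K) {ε : ℝ}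
    (hε : 0 < ε) : ∃ F : E →L[ℂ] E, (F : E →ₗ[ℂ] E).HasFiniteRange ∧ ‖K - F‖ ≤ ε := by
  have hc := hK.isCompact_closure_image_closedBall 1
  obtain ⟨t, ht, hcov⟩ := Metric.totallyBounded_iff.1 hc.totallyBounded ε hε
  let U : Submodule ℂ E := Submodule.span ℂ t
  have : FiniteDimensional ℂ U := FiniteDimensional.span_of_finite ℂ ht
  refine ⟨U.starProjection ∘L K, ?_, ?_⟩
  · rw [LinearMap.hasFiniteRange_iff_range, Submodule.fg_iff_finiteDimensional]
    refine Submodule.finiteDimensional_of_le (S₂ := U) ?_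
    rintro _ ⟨x, rfl⟩
    exact U.starProjection_apply_mem (K x)
  · refine ContinuousLinearMap.opNorm_le_of_unit_norm hε.le fun x hx => ?_
    have hx' : K x ∈ closure (K '' Metric.closedBall 0 1) :=
      subset_closure ⟨x, by simp [hx], rfl⟩
    obtain ⟨y, hy, hxy⟩ := Set.mem_iUnion₂.1 (hcov hx')
    have hyU : y ∈ U := Submodule.subset_span hy
    have h1 : (K - U.starProjection ∘L K) x = Uᗮ.starProjection (K x - y) := by
      have h2 : Uᗮ.starProjection y = 0 :=
        (Submodule.starProjection_apply_eq_zero_iff _).2 (U.le_orthogonal_orthogonal hyU)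
      rw [map_sub, h2, sub_zero, Submodule.starProjection_orthogonal']
      simp
    rw [h1]
    refine (Submodule.norm_starProjection_apply_le _ _).trans ?_
    rw [← dist_eq_norm]
    exact (Metric.mem_ball.1 hxy).le

variable [CompleteSpace E]

/-- Write `K = F + (K - F)` with `F` of finite rank and `M = 1 + (K - F)` invertible. Then `M⁻¹ W`
inverts `T` on both sides modulo finite rank. -/
theorem isFredholm_of_isUnit_add_compact {W T K : E →L[ℂ] E} (hW : IsUnit W)
    (hT : W * T = 1 + K) (hK : IsCompactOperator K) : ContinuousLinearMap.IsFredholm T := by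
  obtain ⟨F, hF, hKF⟩ := exists_finiteRange_approx hK (ε := 1 / 2) (by norm_num)
  obtain ⟨W, rfl⟩ := hW
  obtain ⟨M, hM⟩ : IsUnit (1 + (K - F)) := by
    have : ‖-(K - F)‖ < 1 := by rw [norm_neg]; linarith
    have h := isUnit_one_sub_of_norm_lt_one this
    rwa [sub_neg_eq_add] at h
  have h1 : (↑M⁻¹ * ↑W : E →L[ℂ] E) * T = 1 + ↑M⁻¹ * F := by
    rw [mul_assoc, hT, show 1 + K = ↑M + F by rw [hM]; abel, mul_add, M.inv_mul]
  have h2 : T * (↑M⁻¹ * ↑W : E →L[ℂ] E) = 1 + ↑W⁻¹ * F * (↑M⁻¹ * ↑W) := by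
    have : T = ↑W⁻¹ * (↑M + F) := by
      rw [hM, show 1 + (K - F) + F = 1 + K by abel, ← hT, ← mul_assoc, W.inv_mul, one_mul]
    rw [this, mul_add, add_mul, mul_assoc _ _ (↑M⁻¹ * (W : E →L[ℂ] E)),
      ← mul_assoc (M : E →L[ℂ] E), M.mul_inv, one_mul, W.inv_mul]
  refine ContinuousLinearMap.IsFredholm.of_isQuasiInverse (v := ↑M⁻¹ * ↑W) ⟨?_, ?_⟩
  · refine LinearMap.FiniteRangeSetoid.equiv_iff_hasFiniteRange.2 ?_
    have : (((↑M⁻¹ * ↑W : E →L[ℂ] E) : E →ₗ[ℂ] E) ∘ₗ (T : E →ₗ[ℂ] E)) - LinearMap.id =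
        ((↑M⁻¹ : E →L[ℂ] E) : E →ₗ[ℂ] E) ∘ₗ (F : E →ₗ[ℂ] E) := by
      ext x
      have := congrArg (fun X : E →L[ℂ] E => X x) h1
      simp only [LinearMap.sub_apply, LinearMap.comp_apply, LinearMap.id_apply, sub_eq_iff_eq_add]
      simpa [add_comm] using this
    rw [this]
    exact hF.comp_left _
  · refine LinearMap.FiniteRangeSetoid.equiv_iff_hasFiniteRange.2 ?_
    have : ((T : E →ₗ[ℂ] E) ∘ₗ ((↑M⁻¹ * ↑W : E →L[ℂ] E) : E →ₗ[ℂ] E)) - LinearMap.id =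
        ((↑W⁻¹ : E →L[ℂ] E) : E →ₗ[ℂ] E) ∘ₗ ((F : E →ₗ[ℂ] E) ∘ₗ
          ((↑M⁻¹ * ↑W : E →L[ℂ] E) : E →ₗ[ℂ] E)) := by
      ext x
      have := congrArg (fun X : E →L[ℂ] E => X x) h2
      simp only [LinearMap.sub_apply, LinearMap.comp_apply, LinearMap.id_apply, sub_eq_iff_eq_add]
      simpa [add_comm] using this
    rw [this]
    exact (hF.comp_right _).comp_left _

variable {H H₀ : E →ₗ.[ℂ] E} {z w : ℂ} {R R₀ Rz : E →L[ℂ] E}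

omit [CompleteSpace E] in
-- On the domain, `H - z = (1 - (z - w) R)(H - w)`, and `H - w` is onto. Fredholm questions about `H
-- - z` thus concern a bounded operator.
theorem IsResolventAt.range_shift (hR : IsResolventAt H w R) :
    LinearMap.range (shift H z).toFun = (1 - (z - w) • R : E →L[ℂ] E).range := by
  rw [isResolventAt_iff] at hR
  ext y
  constructor
  · rintro ⟨x, rfl⟩
    have hx := mem_graph_shift.1 ((shift H z).mem_graph x)
    have h2 := hR.2 _ _ hx
    refine ⟨(shift H z x + z • (x : E)) - w • (x : E), ?_⟩
    simp only [ContinuousLinearMap.coe_coe, sub_apply, one_apply_eq_self,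
      smul_apply, h2]
    change _ = shift H z x
    rw [sub_smul]; abel
  · rintro ⟨f, rfl⟩
    have : (R f, (1 - (z - w) • R : E →L[ℂ] E) f) ∈ (shift H z).graph := by
      rw [mem_graph_shift]
      convert hR.1 f using 2
      simp only [sub_apply, one_apply_eq_self, smul_apply, sub_smul]
      abel
    obtain ⟨u, -, hu⟩ := (LinearPMap.mem_graph_iff _).1 this
    exact ⟨u, hu⟩

omit [CompleteSpace E] in
theorem IsResolventAt.mem_ker_shift (hR : IsResolventAt H w R) {x : (shift H z).domain}
    (hx : shift H z x = 0) : (x : E) - (z - w) • R x = 0 := by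
  have h := mem_graph_shift.1 ((shift H z).mem_graph x)
  rw [hx, zero_add] at h
  have h2 := (isResolventAt_iff.1 hR).2 _ _ h
  rw [← sub_smul, map_smul] at h2
  rw [h2, sub_self]

omit [CompleteSpace E] in
theorem IsResolventAt.isClosed_shift (hR : IsResolventAt H w R) : (shift H z).IsClosed := by
  have : ((shift H z).graph : Set (E × E)) =
      (fun p : E × E => (p.1, p.2 + z • p.1)) ⁻¹' (H.graph : Set (E × E)) := by
    ext ⟨x, y⟩; exact mem_graph_shift
  rw [LinearPMap.IsClosed, this]
  exact hR.isClosed.preimage (by fun_prop)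

/-- Away from the spectrum of `H₀`, a compact perturbation of the resolvent of `H₀` belongs to a
Fredholm operator. -/
theorem isFredholm_shift_of_compact_sub (hR : IsResolventAt H w R) (hR₀ : IsResolventAt H₀ w R₀)
    (hRz : IsResolventAt H₀ z Rz) (hd : Dense (H.domain : Set E))
    (hK : IsCompactOperator (R - R₀)) : IsFredholm (shift H z) := by
  set T : E →L[ℂ] E := 1 - (z - w) • R with hT
  -- For `H₀` the bounded operator `1 - (z - w) R₀` is invertible because `z ∈ ρ(H₀)`; for `H` it
  -- changes only by a compact operator.
  have e1 : (1 + (z - w) • Rz) * (1 - (z - w) • R₀) = 1 := by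
    ext f
    have := hRz.identity' hR₀ f
    change (f - (z - w) • R₀ f) + (z - w) • Rz (f - (z - w) • R₀ f) = f
    rw [map_sub, map_smul]
    nth_rewrite 1 [this]
    simp only [smul_add, smul_sub]
    abel
  have e2 : (1 - (z - w) • R₀) * (1 + (z - w) • Rz) = 1 := by
    ext f
    have := hRz.identity hR₀ f
    change (f + (z - w) • Rz f) - (z - w) • R₀ (f + (z - w) • Rz f) = f
    rw [map_add, map_smul]
    nth_rewrite 1 [this]
    simp only [smul_add]
    abel
  have hF : ContinuousLinearMap.IsFredholm T := by
    refine isFredholm_of_isUnit_add_compact (W := 1 + (z - w) • Rz)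
      (K := -((1 + (z - w) • Rz) * ((z - w) • (R - R₀))))
      ⟨⟨1 + (z - w) • Rz, 1 - (z - w) • R₀, e1, e2⟩, rfl⟩ ?_ ?_
    · rw [hT, show (1 - (z - w) • R : E →L[ℂ] E) = (1 - (z - w) • R₀) - (z - w) • (R - R₀) by
        rw [smul_sub]; abel, mul_sub, e1, sub_eq_add_neg]
    · exact ((hK.smul (z - w)).clm_comp (1 + (z - w) • Rz)).neg
  have hrange := hR.range_shift (z := z)
  exact
  { closed := hR.isClosed_shift
    dense := hd
    finite_ker := by
      have := hF.finite_ker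
      let g : LinearMap.ker (shift H z).toFun →ₗ[ℂ] T.ker :=
        { toFun := fun x => ⟨(x : (shift H z).domain), by
            have := hR.mem_ker_shift (LinearMap.mem_ker.1 x.2)
            exact this⟩
          map_add' := fun _ _ => rfl
          map_smul' := fun _ _ => rfl }
      refine FiniteDimensional.of_injective g fun x y hxy => ?_
      exact Subtype.ext (Subtype.ext (congrArg (fun u : T.ker => (u : E)) hxy))
    closed_range := by rw [hrange]; exact hF.isClosed_range
    finite_coker := by rw [hrange]; exact hF.finite_coker }

/-- Ranges agree, and null vectors `x = (z - w) R x` automatically lie in the domain of `H`.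
Strictness comes from the open mapping theorem, the range being complete. -/
theorem isFredholm_resolvent_of_isFredholm (hR : IsResolventAt H w R)
    (hF : IsFredholm (shift H z)) :
    ContinuousLinearMap.IsFredholm (1 - (z - w) • R : E →L[ℂ] E) := by
  set T : E →L[ℂ] E := 1 - (z - w) • R with hT
  have hrange := hR.range_shift (z := z)
  have hcl : IsClosed (T.range : Set E) := by rw [← hrange]; exact hF.closed_range
  have hker : FiniteDimensional ℂ T.ker := by
    have := hF.finite_ker
    have hmem : ∀ x : T.ker, ((x : E), (0 : E)) ∈ (shift H z).graph := by
      intro x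
      have h0 : (x : E) - (z - w) • R x = 0 := x.2
      have h1 := (isResolventAt_iff.1 hR).1 ((z - w) • (x : E))
      rw [map_smul, ← sub_eq_zero.1 h0] at h1
      rw [mem_graph_shift]
      simpa [sub_smul] using h1
    let g : T.ker →ₗ[ℂ] LinearMap.ker (shift H z).toFun :=
      { toFun := fun x => ⟨⟨x, LinearPMap.mem_domain_of_mem_graph (hmem x)⟩, by
          obtain ⟨u, hu, h0⟩ := (LinearPMap.mem_graph_iff _).1 (hmem x)
          exact (congrArg (shift H z) (Subtype.ext hu.symm)).trans h0⟩
        map_add' := fun _ _ => rfl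
        map_smul' := fun _ _ => rfl }
    refine FiniteDimensional.of_injective g fun x y hxy => ?_
    exact Subtype.ext (congrArg (fun u : LinearMap.ker (shift H z).toFun =>
      ((u : (shift H z).domain) : E)) hxy)
  have := hcl.completeSpace_coe
  exact
  { isStrictMap := by
      rw [Topology.isStrictMap_iff_isQuotientMap_rangeFactorization]
      exact ContinuousLinearMap.isQuotientMap T.rangeRestrict
        (LinearMap.surjective_rangeRestrict _)
    isClosed_range := hcl
    finite_ker := hker
    finite_coker := by rw [← hrange]; exact hF.finite_coker
    closedComplemented_ker := Submodule.ClosedComplemented.of_finiteDimensional _ }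

omit [CompleteSpace E] in
theorem isCompactOperator_of_hasFiniteRange {F : E →L[ℂ] E}
    (hF : (F : E →ₗ[ℂ] E).HasFiniteRange) : IsCompactOperator F := by
  rw [LinearMap.hasFiniteRange_iff_range, Submodule.fg_iff_finiteDimensional] at hF
  have := FiniteDimensional.proper ℂ F.range
  have h1 : IsCompactOperator F.rangeRestrict :=
    isCompactOperator_of_locallyCompactSpace_dom F.rangeRestrict
  exact h1.clm_comp F.range.subtypeL

/-- An orthonormal sequence of approximate eigenvectors of `H₀` excludes that `H - z` is Fredholm
when the resolvents of `H` and `H₀` differ by a compact operator. -/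
theorem not_isFredholm_shift_of_orthonormal (hR : IsResolventAt H w R)
    (hR₀ : IsResolventAt H₀ w R₀) (hK : IsCompactOperator (R - R₀))
    {u e : ℕ → E} (hu : Orthonormal ℂ u) (hmem : ∀ n, (u n, e n + z • u n) ∈ H₀.graph)
    (he : Tendsto e atTop (𝓝 0)) : ¬ IsFredholm (shift H z) := by
  intro hF
  obtain ⟨v, hv, -⟩ := (isFredholm_resolvent_of_isFredholm hR hF).exists_isQuasiInverse
  set T : E →L[ℂ] E := 1 - (z - w) • R with hT
  set P : E →L[ℂ] E := v * T - 1 with hP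
  have hPc : IsCompactOperator P := by
    refine isCompactOperator_of_hasFiniteRange ?_
    have := LinearMap.FiniteRangeSetoid.equiv_iff_hasFiniteRange.1 hv
    exact this
  -- This is `(H₀ - w) u n`, a bounded sequence. With the quasi-inverse `v` of `T`, `v T = 1 + P`,
  -- it satisfies `y = v e - L y` with `L` compact.
  let y : ℕ → E := fun n => e n + (z - w) • u n
  have hy0 : ∀ n, R₀ (y n) = u n := by
    intro n
    have := (isResolventAt_iff.1 hR₀).2 _ _ (hmem n)
    rwa [add_sub_assoc, ← sub_smul] at this
  set L : E →L[ℂ] E := v * ((z - w) • (R - R₀)) + P with hL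
  have hLc : IsCompactOperator L := by
    rw [hL]
    exact ((hK.smul (z - w)).clm_comp v).add hPc
  have hTy : ∀ n, y n = v (e n) - L (y n) := by
    intro n
    have h1 : T (y n) = e n - (z - w) • (R - R₀) (y n) := by
      simp only [hT, sub_apply, one_apply_eq_self, smul_apply, hy0, y, smul_sub]
      abel
    have h2 : y n = v (T (y n)) - P (y n) := by simp [hP]
    have h3 : L (y n) = v ((z - w) • (R - R₀) (y n)) + P (y n) := rfl
    rw [h1, map_sub] at h2
    rw [h3, ← sub_sub]
    exact h2
  obtain ⟨C, hC⟩ := he.norm.isBoundedUnder_le.bddAbove_range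
  have hyb : ∀ n, ‖y n‖ ≤ C + ‖z - w‖ := by
    intro n
    refine (norm_add_le _ _).trans (add_le_add (hC ⟨n, rfl⟩) ?_)
    rw [norm_smul, hu.1 n, mul_one]
  have hc := hLc.isCompact_closure_image_closedBall (C + ‖z - w‖)
  obtain ⟨a, -, φ, hφ, ha⟩ := hc.tendsto_subseq (x := fun n => L (y n)) fun n =>
    subset_closure ⟨y n, by simpa using hyb n, rfl⟩
  -- Compactness of `L` makes a subsequence of `y`, hence of `u = R₀ y`, convergent. No subsequence
  -- of an orthonormal sequence converges: consecutive inner products are `0` while the norms are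
  -- `1`.
  have hylim : Tendsto (fun n => u (φ n)) atTop (𝓝 (R₀ (v 0 - a))) := by
    have h1 : Tendsto (fun n => v (e (φ n)) - L (y (φ n))) atTop (𝓝 (v 0 - a)) :=
      ((v.continuous.tendsto 0).comp (he.comp hφ.tendsto_atTop)).sub ha
    have h2 := (R₀.continuous.tendsto _).comp h1
    refine h2.congr fun n => ?_
    rw [Function.comp_apply, ← hTy, hy0]
  have h1 : Tendsto (fun n => inner ℂ (u (φ n)) (u (φ (n + 1)))) atTop
      (𝓝 (inner ℂ (R₀ (v 0 - a)) (R₀ (v 0 - a)))) :=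
    hylim.inner (hylim.comp (tendsto_add_atTop_nat 1))
  have h2 : Tendsto (fun n => inner ℂ (u (φ n)) (u (φ n))) atTop
      (𝓝 (inner ℂ (R₀ (v 0 - a)) (R₀ (v 0 - a)))) := hylim.inner hylim
  have h3 : ∀ n, inner ℂ (u (φ n)) (u (φ (n + 1))) = (0 : ℂ) := fun n =>
    hu.2 (hφ.injective.ne (by omega))
  have h4 : ∀ n, inner ℂ (u (φ n)) (u (φ n)) = (1 : ℂ) := fun n => by
    rw [inner_self_eq_norm_sq_to_K, hu.1]; simp
  simp only [h3] at h1
  simp only [h4] at h2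
  exact zero_ne_one ((tendsto_nhds_unique h1 tendsto_const_nhds).symm.trans
    (tendsto_nhds_unique h2 tendsto_const_nhds))

end Fredholm

end UnboundedOp

namespace Dirac

open UnboundedOp

/-! ### Polar decomposition of operators on `ℂ²` -/

section Polar

theorem finite_spectrum_spinor (T : Spinor →L[ℂ] Spinor) : (spectrum ℝ T).Finite := by
  rw [← spectrum.preimage_algebraMap ℂ, ContinuousLinearMap.spectrum_eq]
  exact (Module.End.finite_spectrum _).preimage (FaithfulSMul.algebraMap_injective ℝ ℂ).injOn

theorem norm_mul_eq_abs_mul (T x : Spinor →L[ℂ] Spinor) : ‖T * x‖ = ‖CFC.abs T * x‖ := by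
  have h : star (T * x) * (T * x) = star (CFC.abs T * x) * (CFC.abs T * x) := by
    have h1 : star (CFC.abs T) = CFC.abs T := (CFC.abs_nonneg T).isSelfAdjoint
    rw [star_mul, star_mul, h1, mul_assoc, mul_assoc, ← mul_assoc (star T),
      ← mul_assoc (CFC.abs T) (CFC.abs T), CFC.abs_mul_abs]
  have h2 := CStarRing.norm_star_mul_self (x := T * x)
  have h3 := CStarRing.norm_star_mul_self (x := CFC.abs T * x)
  rw [h, h3] at h2
  exact ((mul_self_inj (norm_nonneg _) (norm_nonneg _)).1 h2).symm

theorem spectrum_abs_nonneg {T : Spinor →L[ℂ] Spinor} {t : ℝ}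
    (ht : t ∈ spectrum ℝ (CFC.abs T)) : 0 ≤ t :=
  spectrum_nonneg_of_nonneg (CFC.abs_nonneg T) ht

/-- The spectrum is finite, so the functional calculus accepts discontinuous functions such as `t ↦
t⁻¹`. -/
theorem continuousOn_spectrum (T : Spinor →L[ℂ] Spinor) (f : ℝ → ℝ) :
    ContinuousOn f (spectrum ℝ (CFC.abs T)) := by
  have := (finite_spectrum_spinor (CFC.abs T)).to_subtype
  rw [continuousOn_iff_continuous_domRestrict]
  exact continuous_of_discreteTopology

theorem absSqrt_eq_cfc (T : Spinor →L[ℂ] Spinor) :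
    absSqrt T = cfc Real.sqrt (CFC.abs T) := by
  rw [absSqrt, CFC.sqrt_eq_real_sqrt _ (CFC.abs_nonneg T), cfcₙ_eq_cfc]

theorem polarU_mul_absSqrt_eq_cfc (T : Spinor →L[ℂ] Spinor) :
    polarU T * absSqrt T = T * cfc (fun t : ℝ => t⁻¹ * √t) (CFC.abs T) := by
  rw [polarU, absSqrt_eq_cfc, mul_assoc, ← cfc_mul _ _ _ (continuousOn_spectrum T _)
    (continuousOn_spectrum T _)]

/-- Reduces norms involving `T` to scalar functions of `|T|`, because `T* T = |T|²`. -/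
theorem norm_mul_cfc (T : Spinor →L[ℂ] Spinor) (f : ℝ → ℝ) :
    ‖T * cfc f (CFC.abs T)‖ = ‖cfc (fun t => t * f t) (CFC.abs T)‖ := by
  have hsa : IsSelfAdjoint (CFC.abs T) := (CFC.abs_nonneg T).isSelfAdjoint
  rw [norm_mul_eq_abs_mul]
  nth_rewrite 1 [← cfc_id' ℝ (CFC.abs T)]
  rw [← cfc_mul _ _ _ (continuousOn_spectrum T _) (continuousOn_spectrum T _)]

theorem norm_absSqrt (T : Spinor →L[ℂ] Spinor) : ‖absSqrt T‖ = √‖T‖ := by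
  rw [absSqrt, CFC.norm_sqrt _ (CFC.abs_nonneg T), CFC.norm_abs]

theorem norm_polarU_mul_absSqrt (T : Spinor →L[ℂ] Spinor) :
    ‖polarU T * absSqrt T‖ = √‖T‖ := by
  rw [polarU_mul_absSqrt_eq_cfc, norm_mul_cfc, ← norm_absSqrt, absSqrt_eq_cfc]
  congr 1
  refine cfc_congr fun t ht => ?_
  rcases eq_or_ne t 0 with rfl | h
  · simp
  · field_simp

/-- The defect is `T (t⁻¹ √t √t - 1)(|T|)`, whose norm is that of `t (t⁻¹ t - 1)`; this vanishes
also at `t = 0`, where `t⁻¹ = 0` by convention. -/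
theorem polarU_mul_absSqrt_mul_absSqrt (T : Spinor →L[ℂ] Spinor) :
    polarU T * absSqrt T * absSqrt T = T := by
  have hsa : IsSelfAdjoint (CFC.abs T) := (CFC.abs_nonneg T).isSelfAdjoint
  rw [polarU_mul_absSqrt_eq_cfc, absSqrt_eq_cfc, mul_assoc,
    ← cfc_mul _ _ _ (continuousOn_spectrum T _) (continuousOn_spectrum T _), ← sub_eq_zero]
  nth_rewrite 3 [← mul_one T]
  rw [← mul_sub, ← cfc_const_one ℝ (CFC.abs T), ← cfc_sub _ _ _ (continuousOn_spectrum T _)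
    (continuousOn_spectrum T _), ← norm_eq_zero, norm_mul_cfc, norm_eq_zero]
  rw [← cfc_zero (R := ℝ) (a := CFC.abs T)]
  refine cfc_congr fun t ht => ?_
  have h0 := spectrum_abs_nonneg ht
  rcases eq_or_ne t 0 with rfl | h
  · simp
  · have : √t * √t = t := Real.mul_self_sqrt h0
    simp only [mul_assoc, this, Pi.zero_apply]
    field_simp; simp

theorem continuous_absSqrt : Continuous absSqrt := by
  have : absSqrt = fun T => cfc Real.sqrt (CFC.abs T) := funext absSqrt_eq_cfc
  rw [this]
  exact Continuous.cfc_of_mem_nhdsSet (s := Set.univ) _ Filter.univ_mem CFC.continuous_abs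
    (fun T => (CFC.abs_nonneg T).isSelfAdjoint) Real.continuous_sqrt.continuousOn

/-- The partial isometry alone is discontinuous, but `t⁻¹ √t` may be regularized to `√t / (t + ε)`
with error `√t ε / (t + ε) ≤ √ε` after multiplication by `t`, uniformly in `T`. The result provides
measurability of the factor `B`. -/
theorem continuous_polarU_mul_absSqrt :
    Continuous fun T : Spinor →L[ℂ] Spinor => polarU T * absSqrt T := by
  have hu : TendstoUniformly
      (fun (ε : ℝ) (T : Spinor →L[ℂ] Spinor) => T * cfc (fun t : ℝ => √t / (|t| + ε)) (CFC.abs T))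
      (fun T => polarU T * absSqrt T) (nhdsWithin 0 (Set.Ioi 0)) := by
    rw [Metric.tendstoUniformly_iff]
    intro δ hδ
    have hlim : Filter.Tendsto (fun ε : ℝ => √ε) (nhdsWithin 0 (Set.Ioi 0)) (nhds 0) := by
      have := (Real.continuous_sqrt.tendsto 0).mono_left
        (nhdsWithin_le_nhds (s := Set.Ioi (0 : ℝ)))
      simpa using this
    filter_upwards [hlim.eventually (gt_mem_nhds hδ), self_mem_nhdsWithin] with ε hε hε0 T
    refine lt_of_le_of_lt ?_ hε
    have hε0 : 0 < ε := hε0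
    rw [dist_eq_norm, polarU_mul_absSqrt_eq_cfc, ← mul_sub,
      ← cfc_sub _ _ _ (continuousOn_spectrum T _) (continuousOn_spectrum T _), norm_mul_cfc]
    refine norm_cfc_le (Real.sqrt_nonneg _) fun t ht => ?_
    have h0 := spectrum_abs_nonneg ht
    rw [abs_of_nonneg h0]
    rcases eq_or_lt_of_le h0 with rfl | h
    · simp
    · have e : t * (t⁻¹ * √t - √t / (t + ε)) = √t * ε / (t + ε) := by
        field_simp; ring
      rw [e, Real.norm_of_nonneg (by positivity), div_le_iff₀ (by positivity)]
      have h1 : √ε * √ε = ε := Real.mul_self_sqrt hε0.le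
      have h2 : √t * √t = t := Real.mul_self_sqrt h0
      have h3 : √t * ε = √ε * (√t * √ε) := by
        rw [mul_left_comm, h1]
      rw [h3]
      refine mul_le_mul_of_nonneg_left ?_ (Real.sqrt_nonneg _)
      nlinarith [sq_nonneg (√t - √ε), Real.sqrt_nonneg t, Real.sqrt_nonneg ε]
  refine hu.continuous (Filter.Eventually.frequently ?_)
  filter_upwards [self_mem_nhdsWithin] with ε hε
  have hε : 0 < ε := hε
  refine continuous_id.mul (Continuous.cfc_of_mem_nhdsSet (s := Set.univ) _ Filter.univ_mem
    CFC.continuous_abs (fun T => (CFC.abs_nonneg T).isSelfAdjoint) (Continuous.continuousOn ?_))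
  exact Real.continuous_sqrt.div (by fun_prop) fun t => by positivity

end Polar

end Dirac

namespace Dirac

open UnboundedOp

/-! ### Convolution estimates on `L¹ + L²` -/

section Convolution

open scoped ENNReal NNReal

/-- The integral operator with the matrix valued convolution kernel `G`. -/
noncomputable def conv (G : ℝ → Spinor →L[ℂ] Spinor) (f : ℝ → Spinor) (x : ℝ) : Spinor :=
  ∫ y, G (x - y) (f y)

/-- The majorant `|G| * |f|` of `G * f`. -/
noncomputable def convMajorant (G : ℝ → Spinor →L[ℂ] Spinor) (f : ℝ → Spinor) (x : ℝ) : ℝ≥0∞ :=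
  ∫⁻ y, ‖G (x - y)‖ₑ * ‖f y‖ₑ

/-- A kernel bounded by `C` with integral bounded by `C s²`. -/
structure IsKernel (G : ℝ → Spinor →L[ℂ] Spinor) (C s : ℝ≥0) : Prop where
  meas : StronglyMeasurable G
  sup : ∀ x, ‖G x‖ₑ ≤ C
  int : ∫⁻ x, ‖G x‖ₑ ≤ C * s ^ 2

variable {G : ℝ → Spinor →L[ℂ] Spinor} {C s : ℝ≥0} {f g : ℝ → Spinor}

theorem sq_eLpNorm_two {F : Type*} [NormedAddCommGroup F] (f : ℝ → F) :
    eLpNorm f 2 volume ^ 2 = ∫⁻ x, ‖f x‖ₑ ^ 2 := by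
  rw [eLpNorm_eq_lintegral_rpow_enorm_toReal (by norm_num) (by norm_num), ← ENNReal.rpow_natCast,
    ← ENNReal.rpow_mul]
  simp

theorem enorm_conv_le (x : ℝ) : ‖conv G f x‖ₑ ≤ convMajorant G f x := by
  refine (enorm_integral_le_lintegral_enorm _).trans (lintegral_mono fun y => ?_)
  exact ContinuousLinearMap.le_opENorm _ _

theorem IsKernel.measurable_enorm (hG : IsKernel G C s) : Measurable fun x => ‖G x‖ₑ :=
  hG.meas.enorm

theorem IsKernel.lintegral_sub_left (hG : IsKernel G C s) (x : ℝ) :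
    ∫⁻ y, ‖G (x - y)‖ₑ ≤ C * s ^ 2 := by
  rw [lintegral_sub_left_eq_self (fun y => ‖G y‖ₑ) x]; exact hG.int

theorem IsKernel.convMajorant_le_one (hG : IsKernel G C s) (x : ℝ) :
    convMajorant G f x ≤ C * eLpNorm f 1 volume := by
  rw [eLpNorm_one_eq_lintegral_enorm, ← lintegral_const_mul' _ _ ENNReal.coe_ne_top]
  exact lintegral_mono fun y => mul_le_mul_left (hG.sup _) _

theorem IsKernel.lintegral_mul_le (hG : IsKernel G C s) {h : ℝ → ℝ≥0∞} (hh : AEMeasurable h) :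
    ∫⁻ x, ∫⁻ y, ‖G (x - y)‖ₑ * h y ≤ C * s ^ 2 * ∫⁻ y, h y := by
  rw [lintegral_lintegral_swap]
  · rw [← lintegral_const_mul'' _ hh]
    refine lintegral_mono fun y => ?_
    rw [lintegral_mul_const _ (f := fun x => ‖G (x - y)‖ₑ)
      (hG.measurable_enorm.comp (measurable_id.sub_const y)),
      lintegral_sub_right_eq_self (fun x => ‖G x‖ₑ) y]
    exact mul_le_mul_left hG.int _
  · exact (hG.measurable_enorm.comp (measurable_fst.sub measurable_snd)).aemeasurable.mul
      hh.comp_snd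

/-- Cauchy-Schwarz after splitting `|G| |f| = |G|^{1/2} · |G|^{1/2} |f|`. -/
theorem IsKernel.sq_convMajorant_le (hG : IsKernel G C s) (hf : AEStronglyMeasurable f)
    (x : ℝ) : convMajorant G f x ^ 2 ≤ C * s ^ 2 * ∫⁻ y, ‖G (x - y)‖ₑ * ‖f y‖ₑ ^ 2 := by
  have hGm : AEMeasurable fun y => ‖G (x - y)‖ₑ :=
    (hG.measurable_enorm.comp (measurable_id.const_sub x)).aemeasurable
  have h := ENNReal.lintegral_mul_le_Lp_mul_Lq volume Real.HolderConjugate.two_two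
    (f := fun y => ‖G (x - y)‖ₑ ^ (1 / 2 : ℝ))
    (g := fun y => ‖G (x - y)‖ₑ ^ (1 / 2 : ℝ) * ‖f y‖ₑ) (hGm.pow_const _)
    ((hGm.pow_const _).mul hf.enorm)
  have e1 : ∀ y, ‖G (x - y)‖ₑ ^ (1 / 2 : ℝ) * (‖G (x - y)‖ₑ ^ (1 / 2 : ℝ) * ‖f y‖ₑ) =
      ‖G (x - y)‖ₑ * ‖f y‖ₑ := fun y => by
    rw [← mul_assoc, ← ENNReal.rpow_add_of_nonneg _ _ (by norm_num) (by norm_num)]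
    norm_num
  have e2 : ∀ a : ℝ≥0∞, (a ^ (1 / 2 : ℝ)) ^ (2 : ℝ) = a := fun a => by
    rw [← ENNReal.rpow_mul]; norm_num
  simp only [Pi.mul_apply, e1, ENNReal.mul_rpow_of_nonneg _ _ zero_le_two, e2] at h
  have h2 := pow_le_pow_left' h 2
  rw [mul_pow, ← ENNReal.rpow_natCast, ← ENNReal.rpow_natCast, ← ENNReal.rpow_natCast] at h2
  simp only [Nat.cast_ofNat, e2] at h2
  rw [← ENNReal.rpow_natCast]
  simp only [Nat.cast_ofNat]
  refine h2.trans ?_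
  simp only [ENNReal.rpow_ofNat]
  exact mul_le_mul_left (hG.lintegral_sub_left x) _

theorem IsKernel.convMajorant_le_two (hG : IsKernel G C s) (hf : AEStronglyMeasurable f)
    (x : ℝ) : convMajorant G f x ≤ C * (s * eLpNorm f 2 volume) := by
  refine (ENNReal.pow_le_pow_left_iff two_ne_zero).1 ?_
  refine (hG.sq_convMajorant_le hf x).trans ?_
  have : ∫⁻ y, ‖G (x - y)‖ₑ * ‖f y‖ₑ ^ 2 ≤ C * eLpNorm f 2 volume ^ 2 := by
    rw [sq_eLpNorm_two, ← lintegral_const_mul' _ _ ENNReal.coe_ne_top]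
    exact lintegral_mono fun y => mul_le_mul_left (hG.sup _) _
  refine (mul_le_mul_right this _).trans (le_of_eq ?_)
  ring

/-- One of the two factors is bounded by the supremum of the kernel, the other is integrated. -/
theorem IsKernel.lintegral_sq_convMajorant_one (hG : IsKernel G C s) (hf : MemLp f 1) :
    ∫⁻ x, convMajorant G f x ^ 2 ≤ (C * (s * eLpNorm f 1 volume)) ^ 2 := by
  calc ∫⁻ x, convMajorant G f x ^ 2
      ≤ ∫⁻ x, (C * eLpNorm f 1 volume) * convMajorant G f x := by
        refine lintegral_mono fun x => ?_
        rw [sq]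
        exact mul_le_mul_left (hG.convMajorant_le_one x) _
    _ ≤ (C * eLpNorm f 1 volume) * ∫⁻ x, convMajorant G f x := by
        rw [lintegral_const_mul' _ _ (ENNReal.mul_ne_top ENNReal.coe_ne_top hf.2.ne)]
    _ ≤ (C * eLpNorm f 1 volume) * (C * s ^ 2 * eLpNorm f 1 volume) := by
        rw [eLpNorm_one_eq_lintegral_enorm]
        exact mul_le_mul_right (hG.lintegral_mul_le hf.1.enorm) _
    _ = (C * (s * eLpNorm f 1 volume)) ^ 2 := by ring

theorem IsKernel.lintegral_sq_convMajorant_two (hG : IsKernel G C s)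
    (hf : AEStronglyMeasurable f) :
    ∫⁻ x, convMajorant G f x ^ 2 ≤ (C * (s ^ 2 * eLpNorm f 2 volume)) ^ 2 := by
  calc ∫⁻ x, convMajorant G f x ^ 2
      ≤ ∫⁻ x, C * s ^ 2 * ∫⁻ y, ‖G (x - y)‖ₑ * ‖f y‖ₑ ^ 2 :=
        lintegral_mono fun x => hG.sq_convMajorant_le hf x
    _ = C * s ^ 2 * ∫⁻ x, ∫⁻ y, ‖G (x - y)‖ₑ * ‖f y‖ₑ ^ 2 := by
        rw [lintegral_const_mul' _ _ (by finiteness)]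
    _ ≤ C * s ^ 2 * (C * s ^ 2 * ∫⁻ y, ‖f y‖ₑ ^ 2) :=
        mul_le_mul_right (hG.lintegral_mul_le (hf.enorm.pow_const 2)) _
    _ = (C * (s ^ 2 * eLpNorm f 2 volume)) ^ 2 := by rw [← sq_eLpNorm_two]; ring

theorem IsKernel.aestronglyMeasurable_uncurry (hG : IsKernel G C s)
    (hf : AEStronglyMeasurable f) :
    AEStronglyMeasurable (fun p : ℝ × ℝ => G (p.1 - p.2) (f p.2)) (volume.prod volume) := by
  have h1 : AEStronglyMeasurable (fun p : ℝ × ℝ => G (p.1 - p.2)) (volume.prod volume) :=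
    (hG.meas.comp_measurable (measurable_fst.sub measurable_snd)).aestronglyMeasurable
  exact (ContinuousLinearMap.apply ℂ Spinor).flip.aestronglyMeasurable_comp₂ h1 hf.comp_snd

theorem IsKernel.aestronglyMeasurable_conv (hG : IsKernel G C s)
    (hf : AEStronglyMeasurable f) : AEStronglyMeasurable (conv G f) :=
  (hG.aestronglyMeasurable_uncurry hf).integral_prod_right'

theorem IsKernel.eLpNorm_conv_of_lintegral {a : ℝ≥0∞}
    (h : ∫⁻ x, convMajorant G f x ^ 2 ≤ a ^ 2) : eLpNorm (conv G f) 2 volume ≤ a := by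
  refine (ENNReal.pow_le_pow_left_iff two_ne_zero).1 ?_
  rw [sq_eLpNorm_two]
  exact (lintegral_mono fun x => pow_le_pow_left' (enorm_conv_le x) 2).trans h

theorem IsKernel.aestronglyMeasurable_integrand (hG : IsKernel G C s)
    (hf : AEStronglyMeasurable f) (x : ℝ) :
    AEStronglyMeasurable fun y => G (x - y) (f y) := by
  have h1 : AEStronglyMeasurable fun y => G (x - y) :=
    (hG.meas.comp_measurable (measurable_id.const_sub x)).aestronglyMeasurable
  exact (ContinuousLinearMap.apply ℂ Spinor).flip.aestronglyMeasurable_comp₂ h1 hf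

theorem IsKernel.integrable_of_convMajorant (hG : IsKernel G C s)
    (hf : AEStronglyMeasurable f) {x : ℝ} (h : convMajorant G f x < ⊤) :
    Integrable fun y => G (x - y) (f y) :=
  ⟨hG.aestronglyMeasurable_integrand hf x, lt_of_le_of_lt
    (lintegral_mono fun _ => ContinuousLinearMap.le_opENorm _ _) h⟩

theorem IsKernel.integrable_one (hG : IsKernel G C s) (hf : MemLp f 1) (x : ℝ) :
    Integrable fun y => G (x - y) (f y) :=
  hG.integrable_of_convMajorant hf.1 ((hG.convMajorant_le_one x).trans_lt
    (ENNReal.mul_lt_top ENNReal.coe_lt_top hf.2))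

theorem IsKernel.integrable_two (hG : IsKernel G C s) (hf : MemLp f 2) (x : ℝ) :
    Integrable fun y => G (x - y) (f y) :=
  hG.integrable_of_convMajorant hf.1 ((hG.convMajorant_le_two hf.1 x).trans_lt
    (ENNReal.mul_lt_top ENNReal.coe_lt_top (ENNReal.mul_lt_top ENNReal.coe_lt_top hf.2)))

/-- `f` is the sum of `f₁ ∈ L¹` and `f₂ ∈ L²` with norms at most `a` and `b`. -/
def IsSum (f : ℝ → Spinor) (a b : ℝ≥0) : Prop :=
  ∃ f₁ f₂ : ℝ → Spinor, f = f₁ + f₂ ∧ AEStronglyMeasurable f₁ ∧ AEStronglyMeasurable f₂ ∧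
    eLpNorm f₁ 1 volume ≤ a ∧ eLpNorm f₂ 2 volume ≤ b

variable {a b : ℝ≥0}

theorem IsSum.aestronglyMeasurable (h : IsSum f a b) : AEStronglyMeasurable f := by
  obtain ⟨f₁, f₂, rfl, h1, h2, -⟩ := h
  exact h1.add h2

theorem IsKernel.integrable (hG : IsKernel G C s) (hf : IsSum f a b) (x : ℝ) :
    Integrable fun y => G (x - y) (f y) := by
  obtain ⟨f₁, f₂, rfl, h1, h2, h3, h4⟩ := hf
  simp only [Pi.add_apply, map_add]
  exact (hG.integrable_one ⟨h1, h3.trans_lt ENNReal.coe_lt_top⟩ x).add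
    (hG.integrable_two ⟨h2, h4.trans_lt ENNReal.coe_lt_top⟩ x)

theorem IsKernel.conv_add {a' b' : ℝ≥0} (hG : IsKernel G C s) (hf : IsSum f a b)
    (hg : IsSum g a' b') : conv G (f + g) = conv G f + conv G g := by
  ext1 x
  simp only [conv, Pi.add_apply, map_add]
  exact integral_add (hG.integrable hf x) (hG.integrable hg x)

theorem conv_smul (c : ℂ) : conv G (c • f) = c • conv G f := by
  ext1 x
  simp only [conv, Pi.smul_apply, map_smul]
  exact integral_smul c _

theorem conv_congr (h : f =ᵐ[volume] g) : conv G f = conv G g := by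
  ext1 x
  refine integral_congr_ae ?_
  filter_upwards [h] with y hy
  rw [hy]

theorem IsKernel.conv_eq_add {f₁ f₂ : ℝ → Spinor} (hG : IsKernel G C s)
    (h1 : MemLp f₁ 1) (h2 : MemLp f₂ 2) :
    conv G (f₁ + f₂) = conv G f₁ + conv G f₂ := by
  ext1 x
  simp only [conv, Pi.add_apply, map_add]
  exact integral_add (hG.integrable_one h1 x) (hG.integrable_two h2 x)

theorem IsKernel.enorm_conv_le_isSum (hG : IsKernel G C s) (hf : IsSum f a b) (x : ℝ) :
    ‖conv G f x‖ₑ ≤ C * (a + s * b) := by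
  obtain ⟨f₁, f₂, rfl, h1, h2, h3, h4⟩ := hf
  rw [hG.conv_eq_add ⟨h1, h3.trans_lt ENNReal.coe_lt_top⟩ ⟨h2, h4.trans_lt ENNReal.coe_lt_top⟩,
    mul_add]
  refine (enorm_add_le _ _).trans (add_le_add ?_ ?_)
  · exact (enorm_conv_le x).trans ((hG.convMajorant_le_one x).trans (by gcongr))
  · exact (enorm_conv_le x).trans ((hG.convMajorant_le_two h2 x).trans (by gcongr))

/-- Bookkeeping of `s`: a source in `L²` instead of `L¹` costs one factor `s`, and so does a target
in `L²` instead of `L^∞`. -/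
theorem IsKernel.eLpNorm_conv_le (hG : IsKernel G C s) (hf : IsSum f a b) :
    eLpNorm (conv G f) 2 volume ≤ C * (s * (a + s * b)) := by
  obtain ⟨f₁, f₂, rfl, h1, h2, h3, h4⟩ := hf
  rw [hG.conv_eq_add ⟨h1, h3.trans_lt ENNReal.coe_lt_top⟩ ⟨h2, h4.trans_lt ENNReal.coe_lt_top⟩,
    mul_add, mul_add]
  refine (eLpNorm_add_le (hG.aestronglyMeasurable_conv h1) (hG.aestronglyMeasurable_conv h2)
    one_le_two).trans (add_le_add ?_ ?_)
  · exact (IsKernel.eLpNorm_conv_of_lintegral (hG.lintegral_sq_convMajorant_one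
      ⟨h1, h3.trans_lt ENNReal.coe_lt_top⟩)).trans (by gcongr)
  · refine (IsKernel.eLpNorm_conv_of_lintegral (hG.lintegral_sq_convMajorant_two h2)).trans ?_
    rw [← mul_assoc (s : ℝ≥0∞) s, ← sq]
    gcongr

end Convolution

/-! ### Integral operators between two multipliers -/

section Multipliers

open scoped ENNReal NNReal

/-- `M` is the sum of a function in `L²` with norm at most `a` and of a function bounded by `N`. -/
def HasSplit (M : ℝ → Spinor →L[ℂ] Spinor) (a N : ℝ≥0) : Prop :=
  ∃ M₁ M₂ : ℝ → Spinor →L[ℂ] Spinor, M = M₁ + M₂ ∧ AEStronglyMeasurable M₁ ∧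
    AEStronglyMeasurable M₂ ∧ eLpNorm M₁ 2 volume ≤ a ∧ ∀ᵐ x, ‖M₂ x‖ₑ ≤ N

variable {M A B G : ℝ → Spinor →L[ℂ] Spinor} {C s a b N K : ℝ≥0}

theorem HasSplit.aestronglyMeasurable (h : HasSplit M a N) : AEStronglyMeasurable M := by
  obtain ⟨M₁, M₂, rfl, h1, h2, -⟩ := h
  exact h1.add h2

theorem hasSplit_const (T : Spinor →L[ℂ] Spinor) : HasSplit (fun _ => T) 0 ‖T‖₊ := by
  refine ⟨0, fun _ => T, (zero_add _).symm, aestronglyMeasurable_zero,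
    aestronglyMeasurable_const, ?_, Filter.Eventually.of_forall fun _ => ?_⟩
  · refine (ENNReal.pow_le_pow_left_iff two_ne_zero).1 ?_
    rw [sq_eLpNorm_two]
    simp
  · rw [enorm_eq_nnnorm]

theorem aestronglyMeasurable_apply {f : ℝ → Spinor} (hM : AEStronglyMeasurable M)
    (hf : AEStronglyMeasurable f) : AEStronglyMeasurable fun x => M x (f x) :=
  (ContinuousLinearMap.apply ℂ Spinor).flip.aestronglyMeasurable_comp₂ hM hf

theorem eLpNorm_apply_le {p q r : ℝ≥0∞} [p.HolderTriple q r] {f : ℝ → Spinor}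
    (hM : AEStronglyMeasurable M) (hf : AEStronglyMeasurable f) :
    eLpNorm (fun x => M x (f x)) r volume ≤ eLpNorm M p volume * eLpNorm f q volume := by
  have := eLpNorm_le_eLpNorm_mul_eLpNorm'_of_norm (p := p) (q := q) (r := r) hM hf
    (fun T v => T v) 1 (Filter.Eventually.of_forall fun x => by
      simpa using (M x).le_opNorm (f x))
  simpa using this

theorem eLpNorm_top_le {F : Type*} [NormedAddCommGroup F] {f : ℝ → F} {c : ℝ≥0∞}
    (h : ∀ᵐ x, ‖f x‖ₑ ≤ c) : eLpNorm f ⊤ volume ≤ c := by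
  rw [eLpNorm_exponent_top]
  exact essSup_le_of_ae_le c h

theorem HasSplit.isSum (h : HasSplit M a N) (k : SpinorL2) :
    IsSum (fun x => M x (k x)) (a * ‖k‖₊) (N * ‖k‖₊) := by
  obtain ⟨M₁, M₂, rfl, h1, h2, h3, h4⟩ := h
  have hk := (Lp.memLp k).1
  have hn : eLpNorm k 2 volume = ‖k‖₊ := (Lp.enorm_def k).symm
  refine ⟨fun x => M₁ x (k x), fun x => M₂ x (k x), rfl, aestronglyMeasurable_apply h1 hk,
    aestronglyMeasurable_apply h2 hk, ?_, ?_⟩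
  · refine (eLpNorm_apply_le (p := 2) (q := 2) h1 hk).trans ?_
    rw [hn, ENNReal.coe_mul]
    gcongr
  · refine (eLpNorm_apply_le (p := ⊤) (q := 2) h2 hk).trans ?_
    rw [hn, ENNReal.coe_mul]
    exact mul_le_mul_left (eLpNorm_top_le h4) _

/-- The `L²` part of `A` meets the sup bound of the convolution, the bounded part its `L²` bound.
Only the bounded parts carry a factor `s`, so smallness requires small `L²` parts and then small
`s`. -/
theorem HasSplit.eLpNorm_apply_conv_le (hA : HasSplit A a N) (hG : IsKernel G C s)
    {f : ℝ → Spinor} {b K : ℝ≥0} (hf : IsSum f b K) :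
    eLpNorm (fun x => A x (conv G f x)) 2 volume ≤ C * ((a + s * N) * (b + s * K)) := by
  obtain ⟨A₁, A₂, rfl, h1, h2, h3, h4⟩ := hA
  have hc := hG.aestronglyMeasurable_conv hf.aestronglyMeasurable
  refine (eLpNorm_add_le (aestronglyMeasurable_apply h1 hc) (aestronglyMeasurable_apply h2 hc)
    one_le_two).trans ?_
  have e1 := eLpNorm_apply_le (p := 2) (q := ⊤) (r := 2) h1 hc
  have e2 := eLpNorm_apply_le (p := ⊤) (q := 2) (r := 2) h2 hc
  have e3 : eLpNorm (conv G f) ⊤ volume ≤ C * (b + s * K) :=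
    eLpNorm_top_le (Filter.Eventually.of_forall fun x => hG.enorm_conv_le_isSum hf x)
  calc _ ≤ (a : ℝ≥0∞) * (C * (b + s * K)) + N * (C * (s * (b + s * K))) :=
        add_le_add (e1.trans (mul_le_mul' h3 e3))
          (e2.trans (mul_le_mul' (eLpNorm_top_le h4) (hG.eLpNorm_conv_le hf)))
    _ = _ := by ring

/-- The bounded operator `A (G * B ·)`. -/
theorem exists_convOp (hA : HasSplit A a N) (hG : IsKernel G C s) (hB : HasSplit B b K) :
    ∃ T : SpinorL2 →L[ℂ] SpinorL2,
      (∀ k : SpinorL2, T k =ᵐ[volume] fun x => A x (conv G (fun y => B y (k y)) x)) ∧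
      ‖T‖ ≤ C * ((a + s * N) * (b + s * K)) := by
  have hmem : ∀ k : SpinorL2, MemLp (fun x => A x (conv G (fun y => B y (k y)) x)) 2 volume :=
    fun k => ⟨aestronglyMeasurable_apply hA.aestronglyMeasurable
      (hG.aestronglyMeasurable_conv (hB.isSum k).aestronglyMeasurable),
      (hA.eLpNorm_apply_conv_le hG (hB.isSum k)).trans_lt (by finiteness)⟩
  let T : SpinorL2 →ₗ[ℂ] SpinorL2 :=
    { toFun := fun k => (hmem k).toLp
      map_add' := fun k l => by
        rw [← MemLp.toLp_add]
        refine MemLp.toLp_congr _ _ (Filter.Eventually.of_forall fun x => ?_)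
        have h1 := conv_congr (G := G) (mul_add_ae B k l).symm
        have h2 := hG.conv_add (hB.isSum k) (hB.isSum l)
        simp only [h1, h2, Pi.add_apply, map_add]
      map_smul' := fun c k => by
        rw [RingHom.id_apply, ← MemLp.toLp_const_smul]
        refine MemLp.toLp_congr _ _ (Filter.Eventually.of_forall fun x => ?_)
        have h1 := conv_congr (G := G) (mul_smul_ae B c k).symm
        simp only [h1, conv_smul, Pi.smul_apply, map_smul] }
  refine ⟨T.mkContinuous (C * ((a + s * N) * (b + s * K))) fun k => ?_, fun k => ?_, ?_⟩
  · change ‖(hmem k).toLp‖ ≤ _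
    rw [Lp.norm_toLp]
    have h : eLpNorm (fun x => A x (conv G (fun y => B y (k y)) x)) 2 volume ≤
        ((C * ((a + s * N) * (b * ‖k‖₊ + s * (K * ‖k‖₊))) : ℝ≥0) : ℝ≥0∞) := by
      push_cast
      exact hA.eLpNorm_apply_conv_le hG (hB.isSum k)
    refine (ENNReal.toReal_mono ENNReal.coe_ne_top h).trans (le_of_eq ?_)
    rw [ENNReal.coe_toReal]
    push_cast
    ring
  · exact (hmem k).coeFn_toLp
  · exact LinearMap.mkContinuous_norm_le _ (by positivity) _

end Multipliers

end Dirac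

namespace Dirac

open UnboundedOp

/-! ### Uniqueness for the weak equation `u' = μ u` -/

section WeakDerivative

open scoped ENNReal NNReal Convolution

/-- A mollification `F` of `u` solves `F' = μ F` classically, so it is an exponential; it is also
bounded by Hölder, hence zero. -/
theorem eq_zero_of_weakDeriv_eq_smul {u : SpinorL2} {μ : ℂ} (hμ : μ.re ≠ 0)
    (h : (u, μ • u) ∈ weakDerivGraph) : u = 0 := by
  have hloc : LocallyIntegrable (u : ℝ → Spinor) volume :=
    (Lp.memLp u).locallyIntegrable (by norm_num)
  refine (Lp.eq_zero_iff_ae_eq_zero).2 ?_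
  refine ae_eq_zero_of_integral_contDiff_smul_eq_zero hloc fun φ h1 h2 => ?_
  -- The reflection makes the convolution at `0` equal to `∫ φ u`.
  let ψ : ℝ → ℝ := fun x => φ (-x)
  have hψ1 : ContDiff ℝ ∞ ψ := h1.comp contDiff_neg
  have hψ2 : HasCompactSupport ψ := h2.comp_homeomorph (Homeomorph.neg ℝ)
  let F : ℝ → Spinor := ψ ⋆[ContinuousLinearMap.lsmul ℝ ℝ, volume] (u : ℝ → Spinor)
  have hFx : ∀ (χ : ℝ → ℝ) (x : ℝ),
      (χ ⋆[ContinuousLinearMap.lsmul ℝ ℝ, volume] (u : ℝ → Spinor)) x =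
        ∫ t, χ (x - t) • u t := by
    intro χ x
    rw [convolution_eq_swap]
    simp
  have hF : ∀ x, HasDerivAt F (μ • F x) x := by
    intro x
    have hd := hψ2.hasDerivAt_convolution_left (ContinuousLinearMap.lsmul ℝ ℝ)
      (hψ1.of_le (by simp)) hloc x
    have ht := h (fun t => ψ (x - t)) (hψ1.comp (contDiff_const.sub contDiff_id))
      (hψ2.comp_homeomorph (Homeomorph.subLeft x))
    have e : ∀ t, deriv (fun t => ψ (x - t)) t = -deriv ψ (x - t) := fun t =>
      deriv_comp_const_sub ψ x t
    refine hd.congr_deriv ?_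
    change _ = μ • (ψ ⋆[ContinuousLinearMap.lsmul ℝ ℝ, volume] (u : ℝ → Spinor)) x
    rw [hFx, hFx]
    simp only [e, neg_smul] at ht
    rw [integral_neg, neg_inj] at ht
    rw [ht, ← integral_smul]
    refine integral_congr_ae ?_
    filter_upwards [Lp.coeFn_smul μ u] with y hy
    rw [hy, Pi.smul_apply, smul_comm]
  have hconst : ∀ x, F x = Complex.exp (μ * x) • F 0 := by
    have hG : ∀ x : ℝ, HasDerivAt (fun x : ℝ => Complex.exp (-(μ * x)) • F x) 0 x := by
      intro x
      have he : HasDerivAt (fun x : ℝ => Complex.exp (-(μ * x))) 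
          (Complex.exp (-(μ * x)) * -(μ * 1)) x :=
        (((Complex.ofRealCLM.hasDerivAt (x := x)).const_mul μ).neg).cexp
      refine (he.smul (hF x)).congr_deriv ?_
      rw [smul_smul, ← add_smul, mul_one, mul_neg, add_neg_cancel]
      exact zero_smul ℂ (F x)
    have hc := is_const_of_deriv_eq_zero (fun x => (hG x).differentiableAt)
      (fun x => (hG x).deriv)
    intro x
    have := hc x 0
    simp only [Complex.ofReal_zero, mul_zero, neg_zero, Complex.exp_zero, one_smul] at this
    rw [← this, smul_smul, ← Complex.exp_add]; simp
  have hbdd : ∃ K : ℝ, ∀ x, ‖F x‖ ≤ K := by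
    have hψm : MemLp ψ 2 (volume : Measure ℝ) := hψ1.continuous.memLp_of_hasCompactSupport hψ2
    refine ⟨(eLpNorm ψ 2 volume * eLpNorm u 2 volume).toReal, fun x => ?_⟩
    have hm : MemLp (fun t => ψ (x - t)) 2 (volume : Measure ℝ) :=
      hψm.comp_measurePreserving (Measure.measurePreserving_sub_left volume x)
    have h3 : eLpNorm (fun t => ψ (x - t) • u t) 1 volume ≤
        eLpNorm ψ 2 volume * eLpNorm u 2 volume := by
      have := eLpNorm_smul_le_mul_eLpNorm (p := 2) (q := 2) (r := 1) (Lp.memLp u).1 hm.1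
      rwa [show eLpNorm (fun t => ψ (x - t)) 2 volume = eLpNorm ψ 2 volume from
        eLpNorm_comp_measurePreserving hψm.1
          (Measure.measurePreserving_sub_left volume x)] at this
    have h4 : ‖F x‖ₑ ≤ eLpNorm ψ 2 volume * eLpNorm u 2 volume := by
      change ‖(ψ ⋆[ContinuousLinearMap.lsmul ℝ ℝ, volume] (u : ℝ → Spinor)) x‖ₑ ≤ _
      rw [hFx]
      refine (enorm_integral_le_lintegral_enorm _).trans ?_
      rwa [← eLpNorm_one_eq_lintegral_enorm]
    have := ENNReal.toReal_mono (ENNReal.mul_ne_top hψm.2.ne (Lp.memLp u).2.ne) h4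
    simpa using this
  obtain ⟨K, hK⟩ := hbdd
  have hF0 : F 0 = 0 := by
    by_contra hne
    have hpos : 0 < ‖F 0‖ := norm_pos_iff.2 hne
    have hle : ∀ t : ℝ, Real.exp t * ‖F 0‖ ≤ K := by
      intro t
      -- At this point the exponential has modulus `exp t`, whatever the sign of the real part of
      -- `μ`.
      have := hK (t / μ.re)
      rw [hconst, norm_smul, Complex.norm_exp] at this
      simpa [hμ, mul_div_cancel₀] using this
    have h5 := hle (K / ‖F 0‖)
    have h6 := Real.add_one_le_exp (K / ‖F 0‖)
    have h7 : (K / ‖F 0‖ + 1) * ‖F 0‖ ≤ K := (mul_le_mul_of_nonneg_right h6 hpos.le).trans h5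
    rw [add_mul, div_mul_cancel₀ _ hpos.ne'] at h7
    linarith
  have := hFx ψ 0
  rw [show (ψ ⋆[ContinuousLinearMap.lsmul ℝ ℝ, volume] (u : ℝ → Spinor)) 0 = 0 from hF0] at this
  simpa [ψ] using this.symm

end WeakDerivative

/-! ### One-sided exponential kernels and their weak derivatives -/

section ExponentialKernels

open scoped ENNReal NNReal

noncomputable def expRight (l : ℂ) (x : ℝ) : ℂ := if 0 < x then Complex.exp (-(l * x)) else 0

noncomputable def expLeft (l : ℂ) (x : ℝ) : ℂ := if x < 0 then Complex.exp (l * x) else 0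

/-- The convolution kernel that is `exp (-l x) P` for `x > 0` and `exp (l x) P'` for `x < 0`. -/
noncomputable def expKernel (l : ℂ) (P P' : Spinor →L[ℂ] Spinor) (x : ℝ) : Spinor →L[ℂ] Spinor :=
  expRight l x • P + expLeft l x • P'

theorem measurable_expRight (l : ℂ) : Measurable (expRight l) :=
  Measurable.ite measurableSet_Ioi (by fun_prop) measurable_const

theorem measurable_expLeft (l : ℂ) : Measurable (expLeft l) :=
  Measurable.ite measurableSet_Iio (by fun_prop) measurable_const

theorem norm_expKernel_le (l : ℂ) {P P' : Spinor →L[ℂ] Spinor} {C : ℝ} (hP : ‖P‖ ≤ C)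
    (hP' : ‖P'‖ ≤ C) (x : ℝ) : ‖expKernel l P P' x‖ ≤ C * Real.exp (-(l.re * |x|)) := by
  have hC : 0 ≤ C := (norm_nonneg P).trans hP
  rcases lt_trichotomy x 0 with h | rfl | h
  · have e : expKernel l P P' x = Complex.exp (l * x) • P' := by
      simp only [expKernel, expRight, expLeft, if_pos h, if_neg h.le.not_gt]
      exact (congrArg (· + _) (zero_smul ℂ P)).trans (zero_add _)
    rw [e, norm_smul, Complex.norm_exp, abs_of_neg h, mul_comm]
    refine mul_le_mul hP' (le_of_eq ?_) (by positivity) hC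
    simp
  · have e : expKernel l P P' 0 = 0 := by
      simp only [expKernel, expRight, expLeft, lt_irrefl, if_false]
      exact (congrArg₂ (· + ·) (zero_smul ℂ P) (zero_smul ℂ P')).trans (add_zero _)
    rw [e, norm_zero]
    positivity
  · have e : expKernel l P P' x = Complex.exp (-(l * x)) • P := by
      simp only [expKernel, expRight, expLeft, if_pos h, if_neg h.le.not_gt]
      exact (congrArg (_ + ·) (zero_smul ℂ P')).trans (add_zero _)
    rw [e, norm_smul, Complex.norm_exp, abs_of_pos h, mul_comm]
    refine mul_le_mul hP (le_of_eq ?_) (by positivity) hC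
    simp

theorem lintegral_exp_neg_mul_abs {κ : ℝ≥0} (hκ : 0 < κ) :
    ∫⁻ x : ℝ, ENNReal.ofReal (Real.exp (-(κ * |x|))) = ((2 / κ : ℝ≥0) : ℝ≥0∞) := by
  have hκ' : (0 : ℝ) < κ := hκ
  have h1 : ∫ x in Set.Ioi (0 : ℝ), Real.exp (-(κ * x)) = 1 / κ := by
    have := integral_exp_mul_Ioi (a := -(κ : ℝ)) (by linarith) 0
    simpa [neg_mul] using this
  have h2 : IntegrableOn (fun x : ℝ => Real.exp (-(κ * x))) (Set.Ioi 0) := by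
    have := integrableOn_exp_mul_Ioi (a := -(κ : ℝ)) (by linarith) 0
    simpa [neg_mul] using this
  have h3 : Integrable fun x : ℝ => Real.exp (-(κ * |x|)) := by
    have h4 : IntegrableOn (fun x : ℝ => Real.exp (-(κ * |x|))) (Set.Ioi 0) :=
      h2.congr_fun (fun x hx => by simp only [abs_of_pos (Set.mem_Ioi.1 hx)]) measurableSet_Ioi
    have h5 : IntegrableOn (fun x : ℝ => Real.exp (-(κ * |x|))) (Set.Iic 0) :=
      (integrableOn_exp_mul_Iic hκ' 0).congr_fun
        (fun x hx => by simp only [abs_of_nonpos (Set.mem_Iic.1 hx), mul_neg, neg_neg])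
        measurableSet_Iic
    rw [← integrableOn_univ, ← Set.Iic_union_Ioi (a := (0 : ℝ))]
    exact h5.union h4
  rw [← ofReal_integral_eq_lintegral_ofReal h3 (Filter.Eventually.of_forall fun x => by positivity),
    integral_comp_abs (f := fun x => Real.exp (-(κ * x))), h1, ← ENNReal.ofReal_coe_nnreal]
  congr 1
  push_cast
  ring

/-- The value of `s` comes from `∫ exp (-κ |x|) = 2 / κ` with `κ = re l`. -/
theorem isKernel_expKernel {l : ℂ} (hl : 0 < l.re) {P P' : Spinor →L[ℂ] Spinor} {C : ℝ≥0}
    (hP : ‖P‖ ≤ C) (hP' : ‖P'‖ ≤ C) :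
    IsKernel (expKernel l P P') C (NNReal.sqrt (2 / l.re.toNNReal)) where
  meas := ((measurable_expRight l).stronglyMeasurable.smul_const P).add
    ((measurable_expLeft l).stronglyMeasurable.smul_const P')
  sup x := by
    rw [← ofReal_norm, ← ENNReal.ofReal_coe_nnreal]
    refine ENNReal.ofReal_le_ofReal ((norm_expKernel_le l hP hP' x).trans ?_)
    refine mul_le_of_le_one_right C.2 (Real.exp_le_one_iff.2 ?_)
    simp only [Left.neg_nonpos_iff]
    positivity
  int := by
    have hκ : 0 < l.re.toNNReal := Real.toNNReal_pos.2 hl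
    rw [← ENNReal.coe_pow, NNReal.sq_sqrt, ← lintegral_exp_neg_mul_abs hκ,
      ← lintegral_const_mul' _ _ ENNReal.coe_ne_top]
    refine lintegral_mono fun x => ?_
    rw [← ofReal_norm, ← ENNReal.ofReal_coe_nnreal, ← ENNReal.ofReal_mul C.coe_nonneg,
      Real.coe_toNNReal _ hl.le]
    exact ENNReal.ofReal_le_ofReal (norm_expKernel_le l hP hP' x)

theorem IsKernel.integrable_prod_smul {G : ℝ → Spinor →L[ℂ] Spinor} {C s : ℝ≥0}
    (hG : IsKernel G C s) {f : ℝ → Spinor} (hf : MemLp f 2) {η : ℝ → ℝ} (hη : Continuous η)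
    (hc : HasCompactSupport η) :
    Integrable (fun p : ℝ × ℝ => η p.1 • G (p.1 - p.2) (f p.2)) (volume.prod volume) := by
  have hm : AEStronglyMeasurable (fun p : ℝ × ℝ => η p.1 • G (p.1 - p.2) (f p.2))
      (volume.prod volume) :=
    (hη.comp continuous_fst).aestronglyMeasurable.smul (hG.aestronglyMeasurable_uncurry hf.1)
  refine ⟨hm, ?_⟩
  rw [hasFiniteIntegral_iff_enorm, lintegral_prod _ hm.enorm]
  have hη1 : Integrable η := hη.integrable_of_hasCompactSupport hc
  calc ∫⁻ x, ∫⁻ y, ‖η x • G (x - y) (f y)‖ₑ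
      ≤ ∫⁻ x, ‖η x‖ₑ * (C * (s * eLpNorm f 2 volume)) := by
        refine lintegral_mono fun x => ?_
        simp only [enorm_smul]
        rw [lintegral_const_mul' _ _ enorm_ne_top]
        refine mul_le_mul_right ((lintegral_mono fun y => ?_).trans
          (hG.convMajorant_le_two hf.1 x)) _
        exact ContinuousLinearMap.le_opENorm _ _
    _ = (∫⁻ x, ‖η x‖ₑ) * (C * (s * eLpNorm f 2 volume)) :=
        lintegral_mul_const' _ _ (by have := hf.2.ne; finiteness)
    _ < ⊤ := ENNReal.mul_lt_top hη1.2 (by have := hf.2.ne; finiteness)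

theorem IsKernel.integral_smul_conv {G : ℝ → Spinor →L[ℂ] Spinor} {C s : ℝ≥0}
    (hG : IsKernel G C s) {f : ℝ → Spinor} (hf : MemLp f 2) {η : ℝ → ℝ} (hη : Continuous η)
    (hc : HasCompactSupport η) :
    ∫ x, η x • conv G f x = ∫ y, ∫ x, η x • G (x - y) (f y) := by
  rw [← integral_integral_swap (hG.integrable_prod_smul hf hη hc)]
  refine integral_congr_ae (Filter.Eventually.of_forall fun x => ?_)
  simp only [conv, integral_smul]

/-- A weak form of `G' = c G + d δ` implies the corresponding weak derivative of `G * f`. -/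
theorem IsKernel.conv_mem_weakDerivGraph {e : ℝ → ℂ} {G : ℝ → Spinor →L[ℂ] Spinor} {C s : ℝ≥0}
    (hG : IsKernel G C s)
    (hGe : ∀ x v, G x v = e x • v) {c d : ℂ}
    (he : ∀ φ : ℝ → ℝ, ContDiff ℝ ∞ φ → HasCompactSupport φ → ∀ y,
      ∫ x, ((deriv φ x : ℝ) : ℂ) * e (x - y) = -(d * φ y + c * ∫ x, (φ x : ℂ) * e (x - y)))
    {p f : SpinorL2} (hp : p =ᵐ[volume] conv G f) :
    (p, c • p + d • f) ∈ weakDerivGraph := by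
  intro φ h1 h2
  have hd : Continuous (deriv φ) := h1.continuous_deriv (by simp)
  have hf := Lp.memLp f
  have inner : ∀ (η : ℝ → ℝ) (y : ℝ),
      ∫ x, η x • G (x - y) (f y) = (∫ x, (η x : ℂ) * e (x - y)) • f y := by
    intro η y
    rw [← integral_smul_const]
    refine integral_congr_ae (Filter.Eventually.of_forall fun x => ?_)
    simp only [hGe, mul_smul, Complex.coe_smul]
  have hswap : ∀ {η : ℝ → ℝ}, Continuous η → HasCompactSupport η →
      ∫ x, η x • p x = ∫ y, (∫ x, (η x : ℂ) * e (x - y)) • f y := by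
    intro η hη hc
    simp only [← inner]
    rw [← hG.integral_smul_conv hf hη hc]
    refine integral_congr_ae ?_
    filter_upwards [hp] with x hx
    rw [hx]
  have hint : Integrable fun y => (∫ x, (φ x : ℂ) * e (x - y)) • f y := by
    have := (hG.integrable_prod_smul hf h1.continuous h2).integral_prod_right
    simpa only [inner] using this
  have e1 : ∫ x, φ x • (c • p + d • f : SpinorL2) x =
      (c • ∫ x, φ x • p x) + d • ∫ x, φ x • f x := by
    rw [← integral_smul, ← integral_smul, ← integral_add]
    · refine integral_congr_ae ?_
      filter_upwards [Lp.coeFn_add (c • p) (d • f), Lp.coeFn_smul c p, Lp.coeFn_smul d f]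
        with x h3 h4 h5
      rw [h3, Pi.add_apply, h4, h5, smul_add, Pi.smul_apply, Pi.smul_apply, smul_comm c,
        smul_comm d]
    · exact (integrable_test_smul h1.continuous h2 p).smul c
    · exact (integrable_test_smul h1.continuous h2 f).smul d
  simp only
  rw [hswap hd h2.deriv, e1, hswap h1.continuous h2]
  simp only [he φ h1 h2]
  rw [← integral_smul, ← integral_smul, ← integral_add, ← integral_neg]
  · refine integral_congr_ae (Filter.Eventually.of_forall fun y => ?_)
    simp only [neg_smul, add_smul, mul_smul, Complex.coe_smul]
    rw [add_comm]
  · exact hint.smul c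
  · exact (integrable_test_smul h1.continuous h2 f).smul d

theorem hasDerivAt_test_mul_exp {φ : ℝ → ℝ} (h1 : ContDiff ℝ ∞ φ) (l : ℂ) (y x : ℝ) :
    HasDerivAt (fun x : ℝ => (φ x : ℂ) * Complex.exp (l * ((x - y : ℝ) : ℂ)))
      (((deriv φ x : ℝ) : ℂ) * Complex.exp (l * ((x - y : ℝ) : ℂ)) +
        l * ((φ x : ℂ) * Complex.exp (l * ((x - y : ℝ) : ℂ)))) x := by
  have a1 : HasDerivAt (fun x : ℝ => (φ x : ℂ)) ((deriv φ x : ℝ) : ℂ) x :=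
    ((h1.differentiable (by simp) x).hasDerivAt).ofReal_comp
  have a2 : HasDerivAt (fun x : ℝ => ((x - y : ℝ) : ℂ)) 1 x := by
    simpa using ((hasDerivAt_id x).sub_const y).ofReal_comp
  refine (a1.mul (a2.const_mul l).cexp).congr_deriv ?_
  ring

/-- Weak form of `e' = -l e + δ`: integration by parts on `(y, ∞)` leaves the jump at `y` as
boundary term. The coefficients `1` and `-l` are kept explicit to match
`IsKernel.conv_mem_weakDerivGraph`. -/
theorem integral_deriv_mul_expRight (l : ℂ) {φ : ℝ → ℝ} (h1 : ContDiff ℝ ∞ φ)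
    (h2 : HasCompactSupport φ) (y : ℝ) :
    ∫ x, ((deriv φ x : ℝ) : ℂ) * expRight l (x - y) =
      -(1 * φ y + -l * ∫ x, (φ x : ℂ) * expRight l (x - y)) := by
  have hE : Continuous fun x : ℝ => Complex.exp (-l * ((x - y : ℝ) : ℂ)) := by fun_prop
  have e : ∀ η : ℝ → ℝ, ∫ x, (η x : ℂ) * expRight l (x - y) =
      ∫ x in Set.Ioi y, (η x : ℂ) * Complex.exp (-l * ((x - y : ℝ) : ℂ)) := by
    intro η
    rw [← integral_indicator measurableSet_Ioi]
    refine integral_congr_ae (Filter.Eventually.of_forall fun x => ?_)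
    by_cases hx : y < x
    · simp [expRight, hx]
    · simp [expRight, hx]
  have hi : ∀ {η : ℝ → ℝ}, Continuous η → HasCompactSupport η →
      Integrable fun x : ℝ => (η x : ℂ) * Complex.exp (-l * ((x - y : ℝ) : ℂ)) := by
    intro η hη hc
    refine Continuous.integrable_of_hasCompactSupport (by fun_prop) ?_
    exact (hc.comp_left (g := fun t : ℝ => (t : ℂ)) (by simp)).mul_right
  have hd : Continuous (deriv φ) := h1.continuous_deriv (by simp)
  have i1 := hi hd h2.deriv
  have i2 := hi h1.continuous h2
  have hcs : HasCompactSupport fun x : ℝ => (φ x : ℂ) * Complex.exp (-l * ((x - y : ℝ) : ℂ)) :=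
    (h2.comp_left (g := fun t : ℝ => (t : ℂ)) (by simp)).mul_right
  have key := integral_Ioi_of_hasDerivAt_of_tendsto' (a := y) (m := 0)
    (fun x _ => hasDerivAt_test_mul_exp h1 (-l) y x)
    (i1.add (i2.const_mul (-l))).integrableOn (by
      rw [hasCompactSupport_iff_eventuallyEq, Filter.coclosedCompact_eq_cocompact] at hcs
      exact (hcs.filter_mono _root_.atTop_le_cocompact).tendsto)
  rw [integral_add i1.integrableOn (i2.const_mul (-l)).integrableOn, integral_const_mul] at key
  rw [e, e, eq_sub_of_add_eq key]
  simp [add_comm]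

theorem integral_deriv_mul_expLeft (l : ℂ) {φ : ℝ → ℝ} (h1 : ContDiff ℝ ∞ φ)
    (h2 : HasCompactSupport φ) (y : ℝ) :
    ∫ x, ((deriv φ x : ℝ) : ℂ) * expLeft l (x - y) =
      -(-1 * φ y + l * ∫ x, (φ x : ℂ) * expLeft l (x - y)) := by
  have e : ∀ η : ℝ → ℝ, ∫ x, (η x : ℂ) * expLeft l (x - y) =
      ∫ x in Set.Iic y, (η x : ℂ) * Complex.exp (l * ((x - y : ℝ) : ℂ)) := by
    intro η
    rw [integral_Iic_eq_integral_Iio, ← integral_indicator measurableSet_Iio]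
    refine integral_congr_ae (Filter.Eventually.of_forall fun x => ?_)
    by_cases hx : x < y
    · simp [expLeft, hx]
    · simp [expLeft, hx]
  have hi : ∀ {η : ℝ → ℝ}, Continuous η → HasCompactSupport η →
      Integrable fun x : ℝ => (η x : ℂ) * Complex.exp (l * ((x - y : ℝ) : ℂ)) := by
    intro η hη hc
    refine Continuous.integrable_of_hasCompactSupport (by fun_prop) ?_
    exact (hc.comp_left (g := fun t : ℝ => (t : ℂ)) (by simp)).mul_right
  have hd : Continuous (deriv φ) := h1.continuous_deriv (by simp)
  have i1 := hi hd h2.deriv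
  have i2 := hi h1.continuous h2
  have hcs : HasCompactSupport fun x : ℝ => (φ x : ℂ) * Complex.exp (l * ((x - y : ℝ) : ℂ)) :=
    (h2.comp_left (g := fun t : ℝ => (t : ℂ)) (by simp)).mul_right
  have key := integral_Iic_of_hasDerivAt_of_tendsto' (a := y) (m := 0)
    (fun x _ => hasDerivAt_test_mul_exp h1 l y x)
    (i1.add (i2.const_mul l)).integrableOn (by
      rw [hasCompactSupport_iff_eventuallyEq, Filter.coclosedCompact_eq_cocompact] at hcs
      exact (hcs.filter_mono _root_.atBot_le_cocompact).tendsto)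
  rw [integral_add i1.integrableOn (i2.const_mul l).integrableOn, integral_const_mul] at key
  rw [e, e, eq_sub_of_add_eq key]
  simp
  ring

end ExponentialKernels

end Dirac

namespace Dirac

open UnboundedOp

/-! ### Constant matrices and the graph of the free operator -/

section ConstantMatrices

variable {M N : Matrix (Fin 2) (Fin 2) ℂ}

theorem constMat_ae (M : Matrix (Fin 2) (Fin 2) ℂ) (f : SpinorL2) :
    constMat M f =ᵐ[volume] fun x => matOp M (f x) :=
  ContinuousLinearMap.coeFn_compLpL _ _

theorem constMat_mul (f : SpinorL2) : constMat (M * N) f = constMat M (constMat N f) := by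
  refine Lp.ext ?_
  filter_upwards [constMat_ae (M * N) f, constMat_ae M (constMat N f), constMat_ae N f]
    with x h1 h2 h3
  rw [h1, h2, h3, matOp, map_mul]
  rfl

theorem constMat_add (f : SpinorL2) : constMat (M + N) f = constMat M f + constMat N f := by
  rw [constMat, matOp, map_add, ContinuousLinearMap.add_compLpL]
  rfl

theorem constMat_smul (c : ℂ) (f : SpinorL2) : constMat (c • M) f = c • constMat M f := by
  rw [constMat, matOp, map_smul, ContinuousLinearMap.smul_compLpL]
  rfl

theorem constMat_one (f : SpinorL2) : constMat 1 f = f := by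
  refine Lp.ext ?_
  filter_upwards [constMat_ae 1 f] with x h1
  rw [h1, matOp, map_one]
  rfl

theorem compLpL_mem_weakDerivGraph (L : Spinor →L[ℂ] Spinor) {u u' : SpinorL2}
    (h : (u, u') ∈ weakDerivGraph) :
    (L.compLpL 2 volume u, L.compLpL 2 volume u') ∈ weakDerivGraph := by
  intro φ h1 h2
  have e : ∀ {η : ℝ → ℝ} (v : SpinorL2), Continuous η → HasCompactSupport η →
      ∫ x, η x • (L.compLpL 2 volume v) x = L (∫ x, η x • v x) := by
    intro η v hη hc
    rw [← L.integral_comp_comm (integrable_test_smul hη hc v)]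
    refine integral_congr_ae ?_
    filter_upwards [L.coeFn_compLpL (p := 2) (μ := volume) v] with x hx
    rw [hx, L.map_smul_of_tower]
  simp only
  rw [e _ (h1.continuous_deriv (by simp)) h2.deriv, e _ h1.continuous h2, ← map_neg]
  exact congrArg L (h φ h1 h2)

theorem constMat_mem_weakDerivGraph (M : Matrix (Fin 2) (Fin 2) ℂ) {u u' : SpinorL2}
    (h : (u, u') ∈ weakDerivGraph) : (constMat M u, constMat M u') ∈ weakDerivGraph :=
  compLpL_mem_weakDerivGraph (matOp M) h

theorem mem_graph_freeDirac {m : ℝ} {u v : SpinorL2} :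
    (u, v) ∈ (freeDirac m).graph ↔ ∃ u', (u, u') ∈ weakDerivGraph ∧
      v = (-Complex.I) • constMat !![0, 1; 1, 0] u' + (m : ℂ) • constMat !![1, 0; 0, -1] u := by
  rw [LinearPMap.mem_graph_iff]
  simp only [← weakDeriv_graph, LinearPMap.mem_graph_iff]
  constructor
  · rintro ⟨w, rfl, rfl⟩
    exact ⟨weakDeriv w, ⟨w, rfl, rfl⟩, rfl⟩
  · rintro ⟨_, ⟨w, rfl, rfl⟩, rfl⟩
    exact ⟨w, rfl, rfl⟩

end ConstantMatrices

/-! ### Classical derivatives and density of the domain -/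

section SmoothFunctions

theorem mem_weakDerivGraph_of_hasDerivAt {g g' : ℝ → Spinor} (hg : ∀ x, HasDerivAt g (g' x) x)
    (hg' : Continuous g') (hm : MemLp g 2 volume) (hm' : MemLp g' 2 volume) :
    (hm.toLp, hm'.toLp) ∈ weakDerivGraph := by
  intro φ h1 h2
  have hgc : Continuous g := continuous_iff_continuousAt.2 fun x => (hg x).continuousAt
  have hd : Continuous (deriv φ) := h1.continuous_deriv (by simp)
  have e : ∀ (η : ℝ → ℝ) {k : ℝ → Spinor} (hk : MemLp k 2),
      ∫ x, η x • (hk.toLp : SpinorL2) x = ∫ x, η x • k x := fun η k hk => by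
    refine integral_congr_ae ?_
    filter_upwards [hk.coeFn_toLp] with x hx
    rw [hx]
  simp only [e]
  refine eq_neg_of_add_eq_zero_left ?_
  have hi : ∀ {η : ℝ → ℝ} {k : ℝ → Spinor}, Continuous η → HasCompactSupport η → Continuous k →
      Integrable fun x => ContinuousLinearMap.lsmul ℝ ℝ (η x) (k x) := fun hη hc hk =>
    (hη.smul hk).integrable_of_hasCompactSupport hc.smul_right
  have hib := integral_bilinear_hasDerivAt_right_eq_neg_left_of_integrable
    (L := ContinuousLinearMap.lsmul ℝ ℝ) (u := φ) (v := g) (u' := deriv φ) (v' := g')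
    (fun x _ => (h1.differentiable (by simp) x).hasDerivAt) (fun x _ => hg x)
    (hi h1.continuous h2 hg') (hi hd h2.deriv hgc) (hi h1.continuous h2 hgc)
  simp only [ContinuousLinearMap.lsmul_apply] at hib
  rw [hib, add_neg_cancel]

theorem memLp_smul_const {φ : ℝ → ℝ} (h1 : Continuous φ) (h2 : HasCompactSupport φ)
    (v : Spinor) : MemLp (fun x => φ x • v) 2 :=
  (h1.smul continuous_const).memLp_of_hasCompactSupport h2.smul_right

/-- Orthogonality to all `φ v` with `φ` a test function and `v` a fixed spinor means `∫ φ h = 0` for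
all `φ`. -/
theorem dense_weakDeriv_domain : Dense (weakDeriv.domain : Set SpinorL2) := by
  rw [Submodule.dense_iff_topologicalClosure_eq_top,
    Submodule.topologicalClosure_eq_top_iff, Submodule.eq_bot_iff]
  intro h hh
  have hloc : LocallyIntegrable (h : ℝ → Spinor) volume :=
    (Lp.memLp h).locallyIntegrable (by norm_num)
  refine (Lp.eq_zero_iff_ae_eq_zero).2
    (ae_eq_zero_of_integral_contDiff_smul_eq_zero hloc fun φ h1 h2 => ?_)
  refine ext_inner_left ℂ fun v => ?_
  have hd : Continuous (deriv φ) := h1.continuous_deriv (by simp)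
  have hmem := mem_weakDerivGraph_of_hasDerivAt (g := fun x => φ x • v)
    (g' := fun x => deriv φ x • v)
    (fun x => ((h1.differentiable (by simp) x).hasDerivAt).smul_const v)
    (hd.smul continuous_const) (memLp_smul_const h1.continuous h2 v)
    (memLp_smul_const hd h2.deriv v)
  rw [← weakDeriv_graph] at hmem
  have := (Submodule.mem_orthogonal _ _).1 hh _ (LinearPMap.mem_domain_of_mem_graph hmem)
  rw [inner_zero_right, ← integral_inner (integrable_test_smul h1.continuous h2 h), ← this,
    L2.inner_def]
  refine integral_congr_ae ?_
  filter_upwards [(memLp_smul_const h1.continuous h2 v).coeFn_toLp] with x hx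
  rw [hx, inner_smul_right_eq_smul, inner_smul_left_eq_smul]

theorem dense_freeDirac_domain (m : ℝ) : Dense ((freeDirac m).domain : Set SpinorL2) :=
  dense_weakDeriv_domain

end SmoothFunctions

/-! ### The resolvent of the free Dirac operator -/

section FreeResolvent

open scoped ENNReal NNReal

theorem IsKernel.exists_conv {G : ℝ → Spinor →L[ℂ] Spinor} {C s : ℝ≥0} (hG : IsKernel G C s) :
    ∃ T : SpinorL2 →L[ℂ] SpinorL2, ∀ k : SpinorL2, T k =ᵐ[volume] conv G k := by
  obtain ⟨T, hT, -⟩ := exists_convOp (hasSplit_const 1) hG (hasSplit_const 1)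
  exact ⟨T, hT⟩

theorem IsKernel.conv_comp_add {G G₁ G₂ : ℝ → Spinor →L[ℂ] Spinor} {C₁ s₁ C₂ s₂ : ℝ≥0}
    (hG₁ : IsKernel G₁ C₁ s₁) (hG₂ : IsKernel G₂ C₂ s₂) {P₁ P₂ : Spinor →L[ℂ] Spinor}
    (h : ∀ x v, G x v = P₁ (G₁ x v) + P₂ (G₂ x v)) {f : ℝ → Spinor} (hf : MemLp f 2) (x : ℝ) :
    conv G f x = P₁ (conv G₁ f x) + P₂ (conv G₂ f x) := by
  simp only [conv, h]
  rw [integral_add (P₁.integrable_comp (hG₁.integrable_two hf x))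
    (P₂.integrable_comp (hG₂.integrable_two hf x)),
    P₁.integral_comp_comm (hG₁.integrable_two hf x),
    P₂.integral_comp_comm (hG₂.integrable_two hf x)]

/-- The coefficients `± (i / 2) σ₁ + (m σ₃ + z) / (2 l)` of the kernel of the free resolvent. -/
noncomputable def freeCoeff (m : ℝ) (z l c : ℂ) : Matrix (Fin 2) (Fin 2) ℂ :=
  !![(z + m) / (2 * l), c * (Complex.I / 2); c * (Complex.I / 2), (z - m) / (2 * l)]

/-- The convolution kernel of `(H₀ - z)⁻¹`, where `l ^ 2 = m ^ 2 - z ^ 2` and `0 < re l`. -/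
noncomputable def freeKernel (m : ℝ) (z l : ℂ) : ℝ → Spinor →L[ℂ] Spinor :=
  expKernel l (matOp (freeCoeff m z l 1)) (matOp (freeCoeff m z l (-1)))

variable {m : ℝ} {z l : ℂ}

theorem isKernel_freeKernel (hl : 0 < l.re) {C : ℝ≥0} (h1 : ‖matOp (freeCoeff m z l 1)‖ ≤ C)
    (h2 : ‖matOp (freeCoeff m z l (-1))‖ ≤ C) :
    IsKernel (freeKernel m z l) C (NNReal.sqrt (2 / l.re.toNNReal)) :=
  isKernel_expKernel hl h1 h2

theorem exists_isKernel_freeKernel (m : ℝ) (z : ℂ) (hl : 0 < l.re) :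
    ∃ C s, IsKernel (freeKernel m z l) C s :=
  ⟨max ‖matOp (freeCoeff m z l 1)‖₊ ‖matOp (freeCoeff m z l (-1))‖₊, _,
    isKernel_freeKernel hl (by simp) (by simp)⟩

/-- The eigenvalue equation reads `u' = M u` with `M² = l²`. The combinations `M u ∓ l u` satisfy
scalar equations with constants `∓ l`, so both vanish, and their difference is a multiple of `l u`.
-/
theorem eq_zero_of_mem_graph_freeDirac (hl : 0 < l.re) (h : l ^ 2 = m ^ 2 - z ^ 2)
    {u : SpinorL2} (hu : (u, z • u) ∈ (freeDirac m).graph) : u = 0 := by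
  obtain ⟨u', hu', e⟩ := mem_graph_freeDirac.1 hu
  have hl0 : l ≠ 0 := fun h0 => by simp [h0] at hl
  set M : Matrix (Fin 2) (Fin 2) ℂ :=
    !![0, Complex.I * (z + m); Complex.I * (z - m), 0] with hM
  have hM2 : M * M = (l ^ 2) • 1 := by
    rw [h, hM, Matrix.mul_fin_two, Matrix.one_fin_two]
    ext i j
    fin_cases i <;> fin_cases j <;> simp <;> linear_combination (z ^ 2 - m ^ 2) * Complex.I_sq
  have hσ : (!![0, 1; 1, 0] : Matrix (Fin 2) (Fin 2) ℂ) * !![0, 1; 1, 0] = 1 := by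
    rw [Matrix.mul_fin_two, Matrix.one_fin_two]
    simp
  have hMσ : (-Complex.I) • M + (m : ℂ) • (!![0, 1; 1, 0] * !![1, 0; 0, -1]) =
      z • !![0, 1; 1, 0] := by
    rw [hM, Matrix.mul_fin_two]
    ext i j
    fin_cases i <;> fin_cases j <;> simp <;> ring_nf <;> simp
  have e1 : u' = constMat M u := by
    have j1 := congrArg (constMat !![0, 1; 1, 0]) e
    have j2 := congrArg (fun M => constMat M u) hMσ
    simp only [constMat_add, constMat_smul, map_add, map_smul, ← constMat_mul, hσ,
      constMat_one] at j1 j2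
    rw [constMat_mul] at j2
    have : Complex.I • (-Complex.I) • u' = Complex.I • (-Complex.I) • constMat M u := by
      congr 1
      rw [← constMat_mul] at j2
      linear_combination (norm := module) -j1 - j2
    simpa [smul_smul] using this
  have h1 : (u, constMat M u) ∈ weakDerivGraph := e1 ▸ hu'
  have h2 : (constMat M u, (l ^ 2) • u) ∈ weakDerivGraph := by
    have := constMat_mem_weakDerivGraph M h1
    have e2 : constMat M (constMat M u) = (l ^ 2) • u := by
      rw [← constMat_mul, hM2, constMat_smul, constMat_one]
    rw [← e2]
    exact this
  have h3 : constMat M u - l • u = 0 := by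
    refine eq_zero_of_weakDeriv_eq_smul (μ := -l) (by simpa using hl.ne') ?_
    have := weakDerivGraph.sub_mem h2 (weakDerivGraph.smul_mem l h1)
    convert this using 1
    refine Prod.ext rfl ?_
    simp only [Prod.snd_sub, Prod.smul_snd]
    module
  have h4 : constMat M u + l • u = 0 := by
    refine eq_zero_of_weakDeriv_eq_smul (μ := l) hl.ne' ?_
    have := weakDerivGraph.add_mem h2 (weakDerivGraph.smul_mem l h1)
    convert this using 1
    refine Prod.ext rfl ?_
    simp only [Prod.snd_add, Prod.smul_snd]
    module
  have h5 : (2 * l) • u = 0 := by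
    have : (2 * l) • u = (constMat M u + l • u) - (constMat M u - l • u) := by module
    rw [this, h3, h4, sub_zero]
  exact (smul_eq_zero.1 h5).resolve_left (mul_ne_zero two_ne_zero hl0)

/-- Jump condition: `-i σ₁` times the jump of the kernel at `0` is the identity. The next two lemmas
say that each exponential branch solves `(H₀ - z) G = 0`. -/
theorem freeCoeff_sub (m : ℝ) (z l : ℂ) :
    (-Complex.I) • (!![0, 1; 1, 0] * freeCoeff m z l 1) +
      Complex.I • (!![0, 1; 1, 0] * freeCoeff m z l (-1)) = 1 := by
  rw [freeCoeff, freeCoeff, Matrix.mul_fin_two, Matrix.mul_fin_two, Matrix.one_fin_two]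
  ext i j
  fin_cases i <;> fin_cases j <;> simp <;> linear_combination -Complex.I_sq

theorem freeCoeff_one (h : l ^ 2 = m ^ 2 - z ^ 2) (hl : l ≠ 0) :
    (Complex.I * l) • (!![0, 1; 1, 0] * freeCoeff m z l 1) +
      (m : ℂ) • (!![1, 0; 0, -1] * freeCoeff m z l 1) = z • freeCoeff m z l 1 := by
  rw [freeCoeff, Matrix.mul_fin_two, Matrix.mul_fin_two]
  ext i j
  fin_cases i <;> fin_cases j <;> simp <;> field_simp <;>
    first | ring1 | linear_combination l ^ 2 * Complex.I_sq - h

theorem freeCoeff_neg_one (h : l ^ 2 = m ^ 2 - z ^ 2) (hl : l ≠ 0) :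
    (-(Complex.I * l)) • (!![0, 1; 1, 0] * freeCoeff m z l (-1)) +
      (m : ℂ) • (!![1, 0; 0, -1] * freeCoeff m z l (-1)) = z • freeCoeff m z l (-1) := by
  rw [freeCoeff, Matrix.mul_fin_two, Matrix.mul_fin_two]
  ext i j
  fin_cases i <;> fin_cases j <;> simp <;> field_simp <;>
    first | ring1 | linear_combination l ^ 2 * Complex.I_sq - h

/-- Splitting the kernel into its two branches, the jump and branch identities give `(H₀ - z) R =
1`; absence of eigenvalues turns this right inverse into a two-sided one. -/
theorem isResolventAt_freeDirac (hl : 0 < l.re) (h : l ^ 2 = m ^ 2 - z ^ 2)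
    {R : SpinorL2 →L[ℂ] SpinorL2} (hR : ∀ f : SpinorL2, R f =ᵐ[volume] conv (freeKernel m z l) f) :
    IsResolventAt (freeDirac m) z R := by
  have hl0 : l ≠ 0 := fun h0 => by simp [h0] at hl
  have hk₁ := isKernel_expKernel hl (P := 1) (P' := 0) (C := ‖(1 : Spinor →L[ℂ] Spinor)‖₊) le_rfl
    (by simp)
  have hk₂ := isKernel_expKernel hl (P := 0) (P' := 1) (C := ‖(1 : Spinor →L[ℂ] Spinor)‖₊)
    (by simp) le_rfl
  obtain ⟨J₁, hJ₁⟩ := hk₁.exists_conv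
  obtain ⟨J₂, hJ₂⟩ := hk₂.exists_conv
  set N₁ := freeCoeff m z l 1 with hN₁
  set N₂ := freeCoeff m z l (-1) with hN₂
  have ap : ∀ (P P' : Spinor →L[ℂ] Spinor) x v,
      expKernel l P P' x v = expRight l x • P v + expLeft l x • P' v := fun _ _ _ _ => rfl
  have hRJ : ∀ f, R f = constMat N₁ (J₁ f) + constMat N₂ (J₂ f) := by
    intro f
    refine Lp.ext ?_
    filter_upwards [hR f, hJ₁ f, hJ₂ f, constMat_ae N₁ (J₁ f), constMat_ae N₂ (J₂ f),
      Lp.coeFn_add (constMat N₁ (J₁ f)) (constMat N₂ (J₂ f))] with x h1 h2 h3 h4 h5 h6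
    rw [h1, h6, Pi.add_apply, h4, h5, h2, h3]
    refine hk₁.conv_comp_add hk₂ (fun x v => ?_) (Lp.memLp f) x
    rw [freeKernel, ap, ap, ap]
    simp [← hN₁, ← hN₂]
  have hD₁ : ∀ f, (J₁ f, (-l) • J₁ f + (1 : ℂ) • f) ∈ weakDerivGraph := fun f =>
    hk₁.conv_mem_weakDerivGraph (e := expRight l) (fun x v => by rw [ap]; simp)
      (fun φ h1 h2 y => integral_deriv_mul_expRight l h1 h2 y) (hJ₁ f)
  have hD₂ : ∀ f, (J₂ f, l • J₂ f + (-1 : ℂ) • f) ∈ weakDerivGraph := fun f =>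
    hk₂.conv_mem_weakDerivGraph (e := expLeft l) (fun x v => by rw [ap]; simp)
      (fun φ h1 h2 y => integral_deriv_mul_expLeft l h1 h2 y) (hJ₂ f)
  have mem : ∀ f, (R f, f + z • R f) ∈ (freeDirac m).graph := by
    intro f
    refine mem_graph_freeDirac.2 ⟨constMat N₁ ((-l) • J₁ f + (1 : ℂ) • f) +
      constMat N₂ (l • J₂ f + (-1 : ℂ) • f), ?_, ?_⟩
    · have := weakDerivGraph.add_mem (constMat_mem_weakDerivGraph N₁ (hD₁ f))
        (constMat_mem_weakDerivGraph N₂ (hD₂ f))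
      rwa [Prod.mk_add_mk, ← hRJ] at this
    · have j1 := congrArg (fun M => constMat M f) (freeCoeff_sub m z l)
      have j2 := congrArg (fun M => constMat M (J₁ f)) (freeCoeff_one h hl0)
      have j3 := congrArg (fun M => constMat M (J₂ f)) (freeCoeff_neg_one h hl0)
      simp only [constMat_add, constMat_smul, constMat_mul, constMat_one] at j1 j2 j3
      rw [hRJ]
      simp only [map_add, map_smul]
      linear_combination (norm := module) -j1 - j2 - j3
  rw [isResolventAt_iff]
  refine ⟨mem, fun g k hg => ?_⟩
  have := (freeDirac m).graph.sub_mem (mem (k - z • g)) hg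
  refine sub_eq_zero.1 (eq_zero_of_mem_graph_freeDirac hl h (m := m) ?_)
  convert this using 1
  refine Prod.ext rfl ?_
  simp only [Prod.snd_sub]
  module

/-- A square root with positive real part of `m² - z²` exists away from the spectrum. -/
theorem exists_sqrt_of_notMem (hm : 0 ≤ m)
    (hz : z ∉ (fun t : ℝ => (t : ℂ)) '' (Set.Iic (-m) ∪ Set.Ici m)) :
    ∃ l : ℂ, 0 < l.re ∧ l ^ 2 = m ^ 2 - z ^ 2 := by
  obtain ⟨l, hl⟩ := IsAlgClosed.exists_pow_nat_eq ((m : ℂ) ^ 2 - z ^ 2) two_pos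
  rcases lt_trichotomy l.re 0 with h | h | h
  · exact ⟨-l, by simpa using h, by rw [neg_sq, hl]⟩
  -- If `l` is purely imaginary, `m² - z²` is real and nonpositive, which forces `z` to be real with
  -- `z² ≥ m²`.
  · exfalso
    have hre := congrArg Complex.re hl
    have him := congrArg Complex.im hl
    simp only [sq, Complex.mul_re, Complex.mul_im, Complex.sub_re, Complex.sub_im,
      Complex.ofReal_re, Complex.ofReal_im, h] at hre him
    have hxy : z.re * z.im = 0 := by nlinarith
    have key : z.im = 0 ∧ m ^ 2 ≤ z.re ^ 2 := by
      rcases mul_eq_zero.1 hxy with h0 | h0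
      · rw [h0] at hre ⊢
        have hi : z.im = 0 := by nlinarith [sq_nonneg z.im, sq_nonneg l.im, sq_nonneg m]
        exact ⟨hi, by nlinarith [sq_nonneg l.im]⟩
      · rw [h0] at hre
        exact ⟨h0, by nlinarith [sq_nonneg l.im]⟩
    refine hz ⟨z.re, ?_, Complex.ext rfl (by simp [key.1])⟩
    rcases le_abs.1 ((abs_of_nonneg hm).symm.trans_le (sq_le_sq.1 key.2)) with h1 | h1
    · exact Or.inr h1
    · exact Or.inl (le_neg_of_le_neg h1)
  · exact ⟨l, h, hl⟩

end FreeResolvent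

end Dirac

namespace Dirac

open UnboundedOp

/-! ### Closedness and dense domains of multiplication operators -/

section Multipliers

open scoped ENNReal NNReal

variable {M A B G : ℝ → Spinor →L[ℂ] Spinor} {C s a b N K : ℝ≥0}

theorem mem_graph_mulOp {f g : SpinorL2} :
    (f, g) ∈ (mulOp M).graph ↔ g =ᵐ[volume] fun x => M x (f x) := by
  rw [LinearPMap.mem_graph_iff]
  constructor
  · rintro ⟨u, rfl, rfl⟩
    exact MemLp.coeFn_toLp u.2
  · intro h
    have hf : MemLp (fun x => M x (f x)) 2 volume := (Lp.memLp g).ae_eq h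
    exact ⟨⟨f, hf⟩, rfl, Lp.ext (hf.coeFn_toLp.trans h.symm)⟩

theorem exists_seq_tendsto_ae_of_tendsto {f : ℕ → SpinorL2} {f₀ : SpinorL2}
    (h : Filter.Tendsto f Filter.atTop (nhds f₀)) :
    ∃ ns : ℕ → ℕ, StrictMono ns ∧
      ∀ᵐ x : ℝ, Filter.Tendsto (fun i => f (ns i) x) Filter.atTop (nhds (f₀ x)) :=
  (tendstoInMeasure_of_tendsto_Lp h).exists_seq_tendsto_ae

theorem exists_seq_tendsto_ae_prod {f g : ℕ → SpinorL2} {f₀ g₀ : SpinorL2}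
    (hf : Filter.Tendsto f Filter.atTop (nhds f₀)) (hg : Filter.Tendsto g Filter.atTop (nhds g₀)) :
    ∃ ns : ℕ → ℕ, StrictMono ns ∧
      (∀ᵐ x : ℝ, Filter.Tendsto (fun i => f (ns i) x) Filter.atTop (nhds (f₀ x))) ∧
      ∀ᵐ x : ℝ, Filter.Tendsto (fun i => g (ns i) x) Filter.atTop (nhds (g₀ x)) := by
  obtain ⟨n₁, h1, h2⟩ := exists_seq_tendsto_ae_of_tendsto hf
  obtain ⟨n₂, h3, h4⟩ := exists_seq_tendsto_ae_of_tendsto (hg.comp h1.tendsto_atTop)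
  refine ⟨n₁ ∘ n₂, h1.comp h3, ?_, h4⟩
  filter_upwards [h2] with x hx
  exact hx.comp h3.tendsto_atTop

/-- Convergence in `L²` gives almost everywhere convergence along a subsequence, and each `M x` is
continuous. -/
theorem isClosed_mulOp (M : ℝ → Spinor →L[ℂ] Spinor) : (mulOp M).IsClosed := by
  refine IsSeqClosed.isClosed fun p q hp hpq => ?_
  obtain ⟨h1, h2⟩ := (Prod.tendsto_iff _ _).1 hpq
  obtain ⟨ns, -, h3, h4⟩ := exists_seq_tendsto_ae_prod h1 h2
  refine mem_graph_mulOp.2 ?_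
  have h5 : ∀ᵐ x : ℝ, ∀ i, (p (ns i)).2 x = M x ((p (ns i)).1 x) :=
    ae_all_iff.2 fun i => mem_graph_mulOp.1 (hp (ns i))
  filter_upwards [h3, h4, h5] with x h3 h4 h5
  refine tendsto_nhds_unique h4 ?_
  simp only [h5]
  exact ((M x).continuous.tendsto _).comp h3

theorem HasSplit.mono (h : HasSplit M a N) {a' N' : ℝ≥0} (ha : a ≤ a') (hN : N ≤ N') :
    HasSplit M a' N' := by
  obtain ⟨M₁, M₂, rfl, h1, h2, h3, h4⟩ := h
  refine ⟨M₁, M₂, rfl, h1, h2, h3.trans (ENNReal.coe_le_coe.2 ha), ?_⟩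
  filter_upwards [h4] with x hx
  exact hx.trans (ENNReal.coe_le_coe.2 hN)

theorem HasSplit.memLp_apply (h : HasSplit M a N) {f : ℝ → Spinor} (hf : MemLp f 2)
    (hf' : MemLp f ⊤) : MemLp (fun x => M x (f x)) 2 := by
  obtain ⟨M₁, M₂, rfl, h1, h2, h3, h4⟩ := h
  have m1 : MemLp (fun x => M₁ x (f x)) 2 volume := ⟨aestronglyMeasurable_apply h1 hf.1,
    (eLpNorm_apply_le (p := 2) (q := ⊤) (r := 2) h1 hf.1).trans_lt
      (ENNReal.mul_lt_top (h3.trans_lt ENNReal.coe_lt_top) hf'.2)⟩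
  have m2 : MemLp (fun x => M₂ x (f x)) 2 volume := ⟨aestronglyMeasurable_apply h2 hf.1,
    (eLpNorm_apply_le (p := ⊤) (q := 2) (r := 2) h2 hf.1).trans_lt
      (ENNReal.mul_lt_top ((eLpNorm_top_le h4).trans_lt ENNReal.coe_lt_top) hf.2)⟩
  exact m1.add m2

/-- The square integrable spinors that are essentially bounded. -/
def essBounded : Set SpinorL2 := {f | MemLp f ⊤ volume}

theorem dense_essBounded : Dense essBounded := by
  refine (Lp.boundedContinuousFunction_dense Spinor volume (p := 2) (by norm_num)).mono ?_
  rintro f ⟨g, hg⟩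
  refine ⟨(Lp.memLp f).1, lt_of_le_of_lt (eLpNorm_top_le (c := ‖g‖₊) ?_) ENNReal.coe_lt_top⟩
  have h1 : (f : ℝ → Spinor) =ᵐ[volume] g := by
    rw [← show _ = (f : ℝ →ₘ[volume] Spinor) from hg]
    exact ContinuousMap.coeFn_toAEEqFun _ _
  filter_upwards [h1] with x hx
  rw [hx, enorm_eq_nnnorm]
  exact ENNReal.coe_le_coe.2 (g.norm_coe_le_norm x)

theorem HasSplit.mem_domain (h : HasSplit M a N) {f : SpinorL2} (hf : f ∈ essBounded) :
    f ∈ (mulOp M).domain :=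
  h.memLp_apply (Lp.memLp f) hf

theorem HasSplit.dense_domain (h : HasSplit M a N) : Dense ((mulOp M).domain : Set SpinorL2) :=
  dense_essBounded.mono fun _ hf => h.mem_domain hf

end Multipliers

/-! ### Approximation by bounded multipliers of bounded support -/

section Tame

open scoped ENNReal NNReal

theorem enorm_le_coe_iff {T : Spinor →L[ℂ] Spinor} {N : ℝ≥0} : ‖T‖ₑ ≤ N ↔ ‖T‖ ≤ N := by
  rw [← ofReal_norm, ← ENNReal.ofReal_coe_nnreal]
  exact ENNReal.ofReal_le_ofReal_iff N.2

/-- Up to an error small in `L² + L^∞`, the multiplier `M` is bounded with bounded support. -/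
def IsTame (M : ℝ → Spinor →L[ℂ] Spinor) : Prop :=
  ∀ ε : ℝ≥0, 0 < ε → ∃ (K : ℝ≥0) (r : ℝ) (M' M'' : ℝ → Spinor →L[ℂ] Spinor), M = M' + M'' ∧
    AEStronglyMeasurable M' ∧ (∀ x, ‖M' x‖ₑ ≤ K) ∧ (∀ x, r < |x| → M' x = 0) ∧ HasSplit M'' ε ε

theorem IsTame.exists_hasSplit {M : ℝ → Spinor →L[ℂ] Spinor} (h : IsTame M) {ε : ℝ≥0}
    (hε : 0 < ε) : ∃ N, HasSplit M ε N := by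
  obtain ⟨K, r, M', M'', rfl, h1, h2, -, M₁, M₂, rfl, h3, h4, h5, h6⟩ := h ε hε
  refine ⟨K + ε, M₁, M' + M₂, by abel, h3, h1.add h4, h5, ?_⟩
  filter_upwards [h6] with x hx
  rw [enorm_le_coe_iff] at hx ⊢
  exact (norm_add_le _ _).trans (add_le_add (enorm_le_coe_iff.1 (h2 x)) hx)

/-- Cut `M` off on the set `T n` where `|x|` or `‖M x‖` exceeds `n`. There, values at most `ε` form
the small bounded part; where `‖M x‖ > ε`, the term `y` is at most half of `‖M x‖²`, so `‖M x‖² ≤ 2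
|w|`, whose integral over `T n` tends to `0`. -/
theorem isTame_of_sq_norm_le {M : ℝ → Spinor →L[ℂ] Spinor} (hM : AEStronglyMeasurable M)
    {w y : ℝ → ℝ} (hw : Integrable w) (hle : ∀ᵐ x, ‖M x‖ ^ 2 ≤ w x + y x) {C : ℝ}
    (hC : ∀ᵐ x, y x ≤ C) (hy : ∀ ε > 0, ∃ r : ℝ, ∀ᵐ x : ℝ, r ≤ |x| → y x ≤ ε) : IsTame M := by
  intro ε hε
  have hε2 : (0 : ℝ) < (ε : ℝ) ^ 2 / 2 := by positivity
  obtain ⟨r, hr⟩ := hy _ hε2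
  let T : ℕ → Set ℝ := fun n => {x | (n : ℝ) < |x|} ∪ {x | (n : ℝ) < ‖M x‖}
  have hT : ∀ n, NullMeasurableSet (T n) volume := fun n =>
    (measurableSet_lt measurable_const (by fun_prop)).nullMeasurableSet.union
      (nullMeasurableSet_lt aemeasurable_const hM.norm.aemeasurable)
  have hT' : NullMeasurableSet {x | (ε : ℝ) < ‖M x‖} volume :=
    nullMeasurableSet_lt aemeasurable_const hM.norm.aemeasurable
  have hlim : Filter.Tendsto (fun n : ℕ => ∫⁻ x, (T n).indicator (fun x => 2 * ‖w x‖ₑ) x)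
      Filter.atTop (nhds 0) := by
    have h0 : (0 : ℝ≥0∞) = ∫⁻ _ : ℝ, 0 := by simp
    rw [h0]
    refine tendsto_lintegral_of_dominated_convergence' (fun x => 2 * ‖w x‖ₑ)
      (fun n => (hw.1.enorm.const_mul 2).indicator₀ (hT n))
      (fun n => Filter.Eventually.of_forall fun x => Set.indicator_le_self _ _ x) ?_ ?_
    · rw [lintegral_const_mul' _ _ (by norm_num)]
      exact (ENNReal.mul_lt_top (by norm_num) hw.2).ne
    · refine Filter.Eventually.of_forall fun x => ?_
      obtain ⟨n₀, hn₀⟩ := exists_nat_ge (max |x| ‖M x‖)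
      refine tendsto_const_nhds.congr' ?_
      filter_upwards [Filter.eventually_ge_atTop n₀] with n hn
      have hn' : (n₀ : ℝ) ≤ n := Nat.cast_le.2 hn
      refine (Set.indicator_of_notMem ?_ _).symm
      rintro (h | h)
      · exact absurd (h.trans_le ((le_max_left _ _).trans (hn₀.trans hn'))) (lt_irrefl _)
      · exact absurd (h.trans_le ((le_max_right _ _).trans (hn₀.trans hn'))) (lt_irrefl _)
  have hev : ∀ᶠ n : ℕ in Filter.atTop,
      ∫⁻ x, (T n).indicator (fun x => 2 * ‖w x‖ₑ) x ≤ (ε : ℝ≥0∞) ^ 2 :=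
    hlim.eventually (Filter.Eventually.filter_mono le_rfl (ge_mem_nhds (by positivity)))
  -- `n ≥ r` handles large `|x|`, and `n² ≥ 2 |C|` handles large `‖M x‖`.
  obtain ⟨n, hn, hn1, hn2⟩ := (hev.and ((Filter.eventually_ge_atTop ⌈r⌉₊).and
    (Filter.eventually_ge_atTop (⌈2 * |C|⌉₊ + 1)))).exists
  have hnr : r ≤ n := Nat.ceil_le.1 hn1
  have hnC : 2 * |C| ≤ (n : ℝ) ^ 2 := by
    have h1 : 2 * |C| ≤ (⌈2 * |C|⌉₊ : ℝ) := Nat.le_ceil _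
    have h2 : (⌈2 * |C|⌉₊ : ℝ) + 1 ≤ n := by exact_mod_cast hn2
    nlinarith [abs_nonneg C]
  refine ⟨n, n, (T n)ᶜ.indicator M, (T n).indicator M, ?_, hM.indicator₀ (hT n).compl, ?_, ?_,
    (T n ∩ {x | (ε : ℝ) < ‖M x‖}).indicator M, (T n ∩ {x | (ε : ℝ) < ‖M x‖}ᶜ).indicator M, ?_,
    hM.indicator₀ ((hT n).inter hT'), hM.indicator₀ ((hT n).inter hT'.compl), ?_, ?_⟩
  · rw [Set.indicator_compl_add_self]
  · intro x
    rw [enorm_le_coe_iff]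
    by_cases hx : x ∈ (T n)ᶜ
    · rw [Set.indicator_of_mem hx]
      refine le_of_not_gt fun h => hx (Or.inr ?_)
      simpa using h
    · rw [Set.indicator_of_notMem hx, norm_zero]
      exact NNReal.coe_nonneg _
  · intro x hx
    have hxT : x ∉ (T n)ᶜ := Set.notMem_compl_iff.2 (Or.inl hx)
    exact Set.indicator_of_notMem hxT _
  · ext1 x
    by_cases h1 : x ∈ T n <;> by_cases h2 : (ε : ℝ) < ‖M x‖ <;> simp [Set.indicator, h1, h2]
  · refine (ENNReal.pow_le_pow_left_iff two_ne_zero).1 ?_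
    rw [sq_eLpNorm_two]
    refine (lintegral_mono_ae ?_).trans hn
    filter_upwards [hle, hC, hr] with x h1 h2 h3
    rw [← ofReal_norm, ← ENNReal.ofReal_pow (norm_nonneg _)]
    by_cases hx : x ∈ T n ∩ {x | (ε : ℝ) < ‖M x‖}
    · rw [Set.indicator_of_mem hx, Set.indicator_of_mem hx.1]
      have h4 : (ε : ℝ) < ‖M x‖ := hx.2
      have key : ‖M x‖ ^ 2 ≤ 2 * ‖w x‖ := by
        have h5 : w x ≤ ‖w x‖ := le_abs_self _
        have h6 : y x ≤ ‖M x‖ ^ 2 / 2 := by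
          rcases hx.1 with h7 | h7
          · have := h3 (hnr.trans (le_of_lt h7))
            have : (ε : ℝ) ^ 2 ≤ ‖M x‖ ^ 2 := pow_le_pow_left₀ ε.2 h4.le 2
            linarith
          · have : (n : ℝ) ^ 2 ≤ ‖M x‖ ^ 2 :=
              pow_le_pow_left₀ n.cast_nonneg (le_of_lt h7) 2
            linarith [le_abs_self C]
        linarith
      refine (ENNReal.ofReal_le_ofReal key).trans (le_of_eq ?_)
      rw [ENNReal.ofReal_mul zero_le_two, ofReal_norm, ENNReal.ofReal_ofNat]
    · rw [Set.indicator_of_notMem hx, norm_zero]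
      simp
  · refine Filter.Eventually.of_forall fun x => ?_
    rw [enorm_le_coe_iff]
    by_cases hx : x ∈ T n ∩ {x | (ε : ℝ) < ‖M x‖}ᶜ
    · rw [Set.indicator_of_mem hx]
      exact le_of_not_gt hx.2
    · rw [Set.indicator_of_notMem hx, norm_zero]
      exact ε.2

end Tame

/-! ### The factors of a potential in `L¹ + L^∞_0` -/

section Potentials

open scoped ENNReal NNReal

theorem matOp_eq_sum (M : Matrix (Fin 2) (Fin 2) ℂ) :
    matOp M = ∑ i, ∑ j, M i j • matOp (Matrix.single i j 1) := by
  simp only [matOp]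
  conv_lhs => rw [Matrix.matrix_eq_sum_single M]
  simp only [map_sum, ← map_smul, Matrix.smul_single, smul_eq_mul, mul_one]

/-- A bound for the norms of the elementary matrices. -/
noncomputable def matBound : ℝ := ∑ i : Fin 2, ∑ j : Fin 2, ‖matOp (Matrix.single i j 1)‖

theorem norm_matOp_le (M : Matrix (Fin 2) (Fin 2) ℂ) :
    ‖matOp M‖ ≤ matBound * ∑ i, ∑ j, ‖M i j‖ := by
  rw [matOp_eq_sum, Finset.mul_sum]
  refine (norm_sum_le _ _).trans (Finset.sum_le_sum fun i _ => ?_)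
  rw [Finset.mul_sum]
  refine (norm_sum_le _ _).trans (Finset.sum_le_sum fun j _ => ?_)
  rw [norm_smul, mul_comm]
  refine mul_le_mul_of_nonneg_right ?_ (norm_nonneg _)
  refine (Finset.single_le_sum (f := fun j => ‖matOp (Matrix.single i j 1)‖)
    (fun _ _ => norm_nonneg _) (Finset.mem_univ j)).trans ?_
  exact Finset.single_le_sum (f := fun i => ∑ j, ‖matOp (Matrix.single i j 1)‖)
    (fun _ _ => Finset.sum_nonneg fun _ _ => norm_nonneg _) (Finset.mem_univ i)

theorem matBound_nonneg : 0 ≤ matBound :=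
  Finset.sum_nonneg fun _ _ => Finset.sum_nonneg fun _ _ => norm_nonneg _

variable {V W X : ℝ → Matrix (Fin 2) (Fin 2) ℂ}

theorem aestronglyMeasurable_matOp (hV : ∀ i j, AEStronglyMeasurable fun x => V x i j) :
    AEStronglyMeasurable fun x => matOp (V x) := by
  simp only [fun x => matOp_eq_sum (V x)]
  exact Finset.aestronglyMeasurable_fun_sum _ fun i _ =>
    Finset.aestronglyMeasurable_fun_sum _ fun j _ => (hV i j).smul_const _

theorem MemLinfZero.exists_sum_bound (hX : ∀ i j, MemLinfZero fun x => X x i j) :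
    (∃ C, ∀ᵐ x : ℝ, matBound * ∑ i, ∑ j, ‖X x i j‖ ≤ C) ∧
      ∀ ε > 0, ∃ r : ℝ, ∀ᵐ x : ℝ, r ≤ |x| → matBound * ∑ i, ∑ j, ‖X x i j‖ ≤ ε := by
  have hb := matBound_nonneg
  constructor
  · have h1 : ∀ i j, ∃ C, ∀ᵐ x : ℝ, ‖X x i j‖ ≤ C := fun i j => by
      refine ⟨(eLpNorm (fun x => X x i j) ⊤ volume).toReal, ?_⟩
      have := ae_le_eLpNormEssSup (f := fun x => X x i j) (μ := volume)
      filter_upwards [this] with x hx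
      rw [← eLpNorm_exponent_top] at hx
      simpa using ENNReal.toReal_mono (hX i j).1.2.ne hx
    choose C hC using h1
    refine ⟨matBound * ∑ i, ∑ j, C i j, ?_⟩
    filter_upwards [ae_all_iff.2 fun i => ae_all_iff.2 fun j => hC i j] with x hx
    exact mul_le_mul_of_nonneg_left
      (Finset.sum_le_sum fun i _ => Finset.sum_le_sum fun j _ => hx i j) hb
  · intro ε hε
    -- There are four entries; the added `1` avoids dividing by a possibly vanishing bound.
    have hδ : 0 < ε / (4 * (matBound + 1)) := by positivity
    choose r hr using fun i j => (hX i j).2 _ hδ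
    refine ⟨∑ i, ∑ j, |r i j|, ?_⟩
    filter_upwards [ae_all_iff.2 fun i => ae_all_iff.2 fun j => hr i j] with x hx hxr
    have h1 : ∀ i j, ‖X x i j‖ ≤ ε / (4 * (matBound + 1)) := fun i j => by
      refine hx i j ((le_abs_self _).trans (le_trans ?_ hxr))
      refine (Finset.single_le_sum (f := fun j => |r i j|) (fun _ _ => abs_nonneg _)
        (Finset.mem_univ j)).trans ?_
      exact Finset.single_le_sum (f := fun i => ∑ j, |r i j|)
        (fun _ _ => Finset.sum_nonneg fun _ _ => abs_nonneg _) (Finset.mem_univ i)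
    calc matBound * ∑ i, ∑ j, ‖X x i j‖
        ≤ matBound * ∑ _i : Fin 2, ∑ _j : Fin 2, ε / (4 * (matBound + 1)) :=
          mul_le_mul_of_nonneg_left
            (Finset.sum_le_sum fun i _ => Finset.sum_le_sum fun j _ => h1 i j) hb
      _ = ε * (matBound / (matBound + 1)) := by
          simp only [Finset.sum_const, Finset.card_univ, Fintype.card_fin, nsmul_eq_mul]
          field_simp
          norm_num
      _ ≤ ε := mul_le_of_le_one_right hε.le ((div_le_one (by positivity)).2 (by linarith))

theorem IsDecomposition.aestronglyMeasurable (h : IsDecomposition V W X) (i j : Fin 2) :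
    AEStronglyMeasurable fun x => V x i j := by
  refine ((h.integrable i j).1.add (h.linf_zero i j).1.1).congr ?_
  filter_upwards [h.eq_add] with x hx
  rw [hx]
  rfl

/-- The square of the norm of either factor is `‖V‖`, which the entries of `W` and `X` dominate. -/
theorem IsDecomposition.isTame (h : IsDecomposition V W X) {M : ℝ → Spinor →L[ℂ] Spinor}
    (hM : AEStronglyMeasurable M) (hn : ∀ x, ‖M x‖ = √‖matOp (V x)‖) : IsTame M := by
  obtain ⟨⟨C, hC⟩, hy⟩ := MemLinfZero.exists_sum_bound h.linf_zero
  refine isTame_of_sq_norm_le hM (w := fun x => matBound * ∑ i, ∑ j, ‖W x i j‖) ?_ ?_ hC hy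
  · exact (integrable_finsetSum _ fun i _ => integrable_finsetSum _ fun j _ =>
      (h.integrable i j).norm).const_mul _
  · filter_upwards [h.eq_add] with x hx
    rw [hn, Real.sq_sqrt (norm_nonneg _)]
    refine (norm_matOp_le _).trans ?_
    rw [← mul_add, ← Finset.sum_add_distrib]
    refine mul_le_mul_of_nonneg_left (Finset.sum_le_sum fun i _ => ?_) matBound_nonneg
    rw [← Finset.sum_add_distrib]
    refine Finset.sum_le_sum fun j _ => ?_
    rw [hx]
    exact norm_add_le _ _

/-- The function of which `factorA V` is the multiplication operator. -/
noncomputable def funA (V : ℝ → Matrix (Fin 2) (Fin 2) ℂ) (x : ℝ) : Spinor →L[ℂ] Spinor :=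
  absSqrt (matOp (V x))

/-- The function of which `factorB V` is the multiplication operator. -/
noncomputable def funB (V : ℝ → Matrix (Fin 2) (Fin 2) ℂ) (x : ℝ) : Spinor →L[ℂ] Spinor :=
  polarU (matOp (V x)) * absSqrt (matOp (V x))

theorem funB_funA (V : ℝ → Matrix (Fin 2) (Fin 2) ℂ) (x : ℝ) (v : Spinor) :
    funB V x (funA V x v) = matOp (V x) v :=
  DFunLike.congr_fun (polarU_mul_absSqrt_mul_absSqrt (matOp (V x))) v

theorem norm_funA (V : ℝ → Matrix (Fin 2) (Fin 2) ℂ) (x : ℝ) : ‖funA V x‖ = √‖matOp (V x)‖ :=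
  norm_absSqrt _

theorem norm_funB (V : ℝ → Matrix (Fin 2) (Fin 2) ℂ) (x : ℝ) : ‖funB V x‖ = √‖matOp (V x)‖ :=
  norm_polarU_mul_absSqrt _

theorem aestronglyMeasurable_funA (hV : ∀ i j, AEStronglyMeasurable fun x => V x i j) :
    AEStronglyMeasurable (funA V) :=
  continuous_absSqrt.comp_aestronglyMeasurable (aestronglyMeasurable_matOp hV)

theorem aestronglyMeasurable_funB (hV : ∀ i j, AEStronglyMeasurable fun x => V x i j) :
    AEStronglyMeasurable (funB V) :=
  continuous_polarU_mul_absSqrt.comp_aestronglyMeasurable (aestronglyMeasurable_matOp hV)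

theorem IsDecomposition.isTame_funA (h : IsDecomposition V W X) : IsTame (funA V) :=
  h.isTame (aestronglyMeasurable_funA h.aestronglyMeasurable) (norm_funA V)

theorem IsDecomposition.isTame_funB (h : IsDecomposition V W X) : IsTame (funB V) :=
  h.isTame (aestronglyMeasurable_funB h.aestronglyMeasurable) (norm_funB V)

theorem memLinfZero_zero : MemLinfZero fun _ => 0 :=
  ⟨MemLp.zero', fun ε hε => ⟨0, by simp [hε.le]⟩⟩

theorem IsDecomposition.left (h : IsDecomposition V W X) : IsDecomposition W W 0 where
  eq_add := by simp
  integrable := h.integrable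
  linf_zero _ _ := memLinfZero_zero

theorem IsDecomposition.right (h : IsDecomposition V W X) : IsDecomposition X 0 X where
  eq_add := by simp
  integrable _ _ := integrable_zero _ _ _
  linf_zero := h.linf_zero

theorem IsDecomposition.exists_enorm_funB_le (h : IsDecomposition V W X) :
    ∃ N : ℝ≥0, ∀ᵐ x, ‖funB X x‖ₑ ≤ N := by
  obtain ⟨⟨C, hC⟩, -⟩ := MemLinfZero.exists_sum_bound h.linf_zero
  refine ⟨(√C).toNNReal, ?_⟩
  filter_upwards [hC] with x hx
  rw [← ofReal_norm, norm_funB]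
  exact ENNReal.ofReal_le_ofReal (Real.sqrt_le_sqrt ((norm_matOp_le _).trans hx))

theorem exists_isDecomposition (hV : ∀ i j, ∃ w y : ℝ → ℂ, Integrable w ∧ MemLinfZero y ∧
    ∀ᵐ x : ℝ, V x i j = w x + y x) : ∃ W X, IsDecomposition V W X := by
  choose w y h1 h2 h3 using hV
  refine ⟨fun x => Matrix.of fun i j => w i j x, fun x => Matrix.of fun i j => y i j x, ?_, h1, h2⟩
  filter_upwards [ae_all_iff.2 fun i => ae_all_iff.2 fun j => h3 i j] with x hx
  ext i j
  exact hx i j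

end Potentials

end Dirac

namespace UnboundedOp

/-! ### Column and row operators -/

section Blocks

variable {E F G : Type*}
  [NormedAddCommGroup E] [InnerProductSpace ℂ E]
  [NormedAddCommGroup F] [InnerProductSpace ℂ F]
  [NormedAddCommGroup G] [InnerProductSpace ℂ G]

theorem mem_graph_column {A₁ : E →ₗ.[ℂ] F} {A₂ : E →ₗ.[ℂ] G} {f : E} {p : WithLp 2 (F × G)} :
    (f, p) ∈ (column A₁ A₂).graph ↔ (f, p.fst) ∈ A₁.graph ∧ (f, p.snd) ∈ A₂.graph := by
  simp only [LinearPMap.mem_graph_iff]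
  constructor
  · rintro ⟨u, rfl, rfl⟩
    exact ⟨⟨⟨u, u.2.1⟩, rfl, rfl⟩, ⟨⟨u, u.2.2⟩, rfl, rfl⟩⟩
  · rintro ⟨⟨u, rfl, hu⟩, ⟨v, hv, hv'⟩⟩
    have hv0 : (u : E) ∈ A₂.domain := hv ▸ v.2
    refine ⟨⟨u, u.2, hv0⟩, rfl, ?_⟩
    have : v = ⟨u, hv0⟩ := Subtype.ext hv
    rw [this] at hv'
    refine WithLp.ofLp_injective 2 (Prod.ext ?_ ?_)
    · exact hu
    · exact hv'

theorem mem_graph_row {B₁ : F →ₗ.[ℂ] E} {B₂ : G →ₗ.[ℂ] E} {p : WithLp 2 (F × G)} {b : E} :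
    (p, b) ∈ (row B₁ B₂).graph ↔
      ∃ b₁ b₂, (p.fst, b₁) ∈ B₁.graph ∧ (p.snd, b₂) ∈ B₂.graph ∧ b = b₁ + b₂ := by
  simp only [LinearPMap.mem_graph_iff]
  constructor
  · rintro ⟨u, rfl, rfl⟩
    exact ⟨_, _, ⟨⟨_, u.2.1⟩, rfl, rfl⟩, ⟨⟨_, u.2.2⟩, rfl, rfl⟩, rfl⟩
  · rintro ⟨_, _, ⟨u, hu, rfl⟩, ⟨v, hv, rfl⟩, rfl⟩
    have hu0 : p.fst ∈ B₁.domain := hu ▸ u.2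
    have hv0 : p.snd ∈ B₂.domain := hv ▸ v.2
    refine ⟨⟨p, hu0, hv0⟩, rfl, ?_⟩
    have e1 : u = ⟨p.fst, hu0⟩ := Subtype.ext hu
    have e2 : v = ⟨p.snd, hv0⟩ := Subtype.ext hv
    rw [e1, e2]
    rfl

theorem isClosed_column {A₁ : E →ₗ.[ℂ] F} {A₂ : E →ₗ.[ℂ] G} (h₁ : A₁.IsClosed)
    (h₂ : A₂.IsClosed) : (column A₁ A₂).IsClosed := by
  have : ((column A₁ A₂).graph : Set (E × WithLp 2 (F × G))) =
      {p | (p.1, p.2.fst) ∈ (A₁.graph : Set (E × F))} ∩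
        {p | (p.1, p.2.snd) ∈ (A₂.graph : Set (E × G))} := by
    ext ⟨f, p⟩
    exact mem_graph_column
  rw [LinearPMap.IsClosed, this]
  exact (h₁.preimage (by fun_prop)).inter (h₂.preimage (by fun_prop))

theorem dense_row_domain {B₁ : F →ₗ.[ℂ] E} {B₂ : G →ₗ.[ℂ] E} (h₁ : Dense (B₁.domain : Set F))
    (h₂ : Dense (B₂.domain : Set G)) :
    Dense ((row B₁ B₂).domain : Set (WithLp 2 (F × G))) :=
  (h₁.prod h₂).preimage (WithLp.prodContinuousLinearEquiv 2 ℂ F G).toHomeomorph.isOpenMap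

/-- A column of bounded operators. -/
noncomputable def columnCLM (T₁ : E →L[ℂ] F) (T₂ : E →L[ℂ] G) : E →L[ℂ] WithLp 2 (F × G) :=
  ((WithLp.prodContinuousLinearEquiv 2 ℂ F G).symm : F × G →L[ℂ] WithLp 2 (F × G)) ∘L T₁.prod T₂

/-- A row of bounded operators. -/
noncomputable def rowCLM (S₁ : F →L[ℂ] E) (S₂ : G →L[ℂ] E) : WithLp 2 (F × G) →L[ℂ] E :=
  S₁.coprod S₂ ∘L ((WithLp.prodContinuousLinearEquiv 2 ℂ F G) : WithLp 2 (F × G) →L[ℂ] F × G)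

@[simp] theorem columnCLM_fst (T₁ : E →L[ℂ] F) (T₂ : E →L[ℂ] G) (f : E) :
    (columnCLM T₁ T₂ f).fst = T₁ f := rfl

@[simp] theorem columnCLM_snd (T₁ : E →L[ℂ] F) (T₂ : E →L[ℂ] G) (f : E) :
    (columnCLM T₁ T₂ f).snd = T₂ f := rfl

theorem rowCLM_apply (S₁ : F →L[ℂ] E) (S₂ : G →L[ℂ] E) (p : WithLp 2 (F × G)) :
    rowCLM S₁ S₂ p = S₁ p.fst + S₂ p.snd := rfl

theorem norm_rowCLM_le (S₁ : F →L[ℂ] E) (S₂ : G →L[ℂ] E) :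
    ‖rowCLM S₁ S₂‖ ≤ ‖S₁‖ + ‖S₂‖ := by
  refine ContinuousLinearMap.opNorm_le_bound _ (by positivity) fun p => ?_
  rw [rowCLM_apply, add_mul]
  exact (norm_add_le _ _).trans (add_le_add (S₁.le_opNorm_of_le (WithLp.norm_fst_le _ p))
    (S₂.le_opNorm_of_le (WithLp.norm_snd_le _ p)))

theorem norm_columnCLM_le (T₁ : E →L[ℂ] F) (T₂ : E →L[ℂ] G) :
    ‖columnCLM T₁ T₂‖ ≤ ‖T₁‖ + ‖T₂‖ := by
  refine ContinuousLinearMap.opNorm_le_bound _ (by positivity) fun f => ?_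
  have h : ‖columnCLM T₁ T₂ f‖ ≤ ‖T₁ f‖ + ‖T₂ f‖ := by
    rw [WithLp.prod_norm_eq_of_L2, columnCLM_fst, columnCLM_snd]
    refine Real.sqrt_le_iff.2 ⟨by positivity, ?_⟩
    nlinarith [norm_nonneg (T₁ f), norm_nonneg (T₂ f)]
  rw [add_mul]
  exact h.trans (add_le_add (T₁.le_opNorm f) (T₂.le_opNorm f))

theorem FactorData.block {A₁ : E →ₗ.[ℂ] F} {A₂ : E →ₗ.[ℂ] G} {B₁ : F →ₗ.[ℂ] E} {B₂ : G →ₗ.[ℂ] E}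
    {R : E →L[ℂ] E} {T₁ : E →L[ℂ] F} {T₂ : E →L[ℂ] G} {S₁ : F →L[ℂ] E} {S₂ : G →L[ℂ] E}
    {Q₁₁ : F →L[ℂ] F} {Q₁₂ : G →L[ℂ] F} {Q₂₁ : F →L[ℂ] G} {Q₂₂ : G →L[ℂ] G}
    (D₁ : FactorData A₁ B₁ R T₁ S₁ Q₁₁) (D₂ : FactorData A₂ B₂ R T₂ S₂ Q₂₂)
    (h₁₂ : ∀ k, (S₂ k, Q₁₂ k) ∈ A₁.graph) (h₂₁ : ∀ k, (S₁ k, Q₂₁ k) ∈ A₂.graph) :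
    FactorData (column A₁ A₂) (row B₁ B₂) R (columnCLM T₁ T₂) (rowCLM S₁ S₂)
      (columnCLM (rowCLM Q₁₁ Q₁₂) (rowCLM Q₂₁ Q₂₂)) where
  left f := mem_graph_column.2 ⟨D₁.left f, D₂.left f⟩
  right k b hk := by
    obtain ⟨b₁, b₂, h1, h2, rfl⟩ := mem_graph_row.1 hk
    rw [rowCLM_apply, D₁.right _ _ h1, D₂.right _ _ h2, map_add]
  both k := mem_graph_column.2 ⟨A₁.graph.add_mem (D₁.both k.fst) (h₁₂ k.snd),
    A₂.graph.add_mem (h₂₁ k.fst) (D₂.both k.snd)⟩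

/-- A row of two closed operators need not be closed. A bounded second entry can be moved to the
other side of the equation; for the Dirac operator this is the factor of the bounded part `X`. -/
theorem isClosed_row {B₁ : F →ₗ.[ℂ] E} {B₂ : G →ₗ.[ℂ] E} {S : G →L[ℂ] E} (h₁ : B₁.IsClosed)
    (h₂ : B₂ = ofCLM S) : (row B₁ B₂).IsClosed := by
  have : ((row B₁ B₂).graph : Set (WithLp 2 (F × G) × E)) =
      {p | (p.1.fst, p.2 - S p.1.snd) ∈ (B₁.graph : Set (F × E))} := by
    ext ⟨p, b⟩
    refine mem_graph_row.trans ?_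
    simp only [h₂, mem_graph_ofCLM]
    constructor
    · rintro ⟨b₁, b₂, h, rfl, rfl⟩
      simpa using h
    · intro h
      exact ⟨_, _, h, rfl, by simp⟩
  rw [LinearPMap.IsClosed, this]
  exact h₁.preimage (by fun_prop)

end Blocks

end UnboundedOp

namespace Dirac

open UnboundedOp

/-! ### The perturbed graph in terms of the potential alone -/

section Factorizations

open scoped ENNReal NNReal

variable {A B A₁ A₂ B₁ B₂ G : ℝ → Spinor →L[ℂ] Spinor} {C s a b N K : ℝ≥0}

theorem HasSplit.exists_conv_right (hB : HasSplit B b K) (hG : IsKernel G C s) :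
    ∃ S : SpinorL2 →L[ℂ] SpinorL2,
      ∀ k : SpinorL2, S k =ᵐ[volume] conv G fun y => B y (k y) := by
  obtain ⟨T, hT, -⟩ := exists_convOp (hasSplit_const 1) hG hB
  exact ⟨T, hT⟩

theorem HasSplit.exists_conv_left (hA : HasSplit A a N) (hG : IsKernel G C s) :
    ∃ T : SpinorL2 →L[ℂ] SpinorL2,
      ∀ k : SpinorL2, T k =ᵐ[volume] fun x => A x (conv G k x) := by
  obtain ⟨T, hT, -⟩ := exists_convOp hA hG (hasSplit_const 1)
  exact ⟨T, hT⟩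

variable {R T S Q₀ : SpinorL2 →L[ℂ] SpinorL2}

theorem factorData_mulOp (hR : ∀ k : SpinorL2, R k =ᵐ[volume] conv G k)
    (hT : ∀ k : SpinorL2, T k =ᵐ[volume] fun x => A x (conv G k x))
    (hS : ∀ k : SpinorL2, S k =ᵐ[volume] conv G fun y => B y (k y))
    (hQ : ∀ k : SpinorL2, Q₀ k =ᵐ[volume] fun x => A x (conv G (fun y => B y (k y)) x)) :
    FactorData (mulOp A) (mulOp B) R T S Q₀ where
  left f := by
    refine mem_graph_mulOp.2 ?_
    filter_upwards [hR f, hT f] with x h1 h2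
    rw [h1, h2]
  right k b hk := by
    refine Lp.ext ((hS k).trans ((hR b).trans ?_).symm)
    rw [conv_congr (mem_graph_mulOp.1 hk)]
  both k := by
    refine mem_graph_mulOp.2 ?_
    filter_upwards [hS k, hQ k] with x h1 h2
    rw [h1, h2]

theorem HasSplit.memLp_top (hB : HasSplit B b K) (hG : IsKernel G C s)
    (hS : ∀ k : SpinorL2, S k =ᵐ[volume] conv G fun y => B y (k y)) (k : SpinorL2) :
    MemLp (S k) ⊤ volume := by
  refine ⟨(Lp.memLp _).1, ?_⟩
  rw [eLpNorm_congr_ae (hS _)]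
  refine (eLpNorm_top_le (Filter.Eventually.of_forall fun x =>
    hG.enorm_conv_le_isSum (hB.isSum k) x)).trans_lt ?_
  finiteness

/-- The domain of the perturbed operator consists of bounded solutions of the resolvent equation
`g + G * (V g) = R (h - z g)`. -/
theorem mem_perturbedGraph_mulOp {V : ℝ → Spinor →L[ℂ] Spinor} (hA : HasSplit A a N)
    (hB : HasSplit B b K) (hG : IsKernel G C s) (hBA : ∀ᵐ x, ∀ v, B x (A x v) = V x v)
    (hR : ∀ k : SpinorL2, R k =ᵐ[volume] conv G k)
    (hS : ∀ k : SpinorL2, S k =ᵐ[volume] conv G fun y => B y (k y)) {g h : SpinorL2} {z : ℂ} :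
    (g, h) ∈ perturbedGraph (mulOp A) S R z ↔ g ∈ essBounded ∧
      (fun x => g x + conv G (fun y => V y (g y)) x) =ᵐ[volume] R (h - z • g) := by
  have key : ∀ k : SpinorL2, (g, k) ∈ (mulOp A).graph →
      S k =ᵐ[volume] conv G fun y => V y (g y) := by
    intro k hk
    refine (hS k).trans (Filter.EventuallyEq.of_eq (conv_congr ?_))
    filter_upwards [mem_graph_mulOp.1 hk, hBA] with x h1 h2
    rw [h1, h2]
  rw [mem_perturbedGraph]
  constructor
  · rintro ⟨k, hk, e⟩
    refine ⟨?_, ?_⟩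
    -- Both terms are convolutions of `G` with elements of `L¹ + L²`, hence bounded.
    · have e' : g = R (h - z • g) - S k := eq_sub_of_add_eq e
      have h1 : MemLp (R (h - z • g)) ⊤ volume := (hasSplit_const 1).memLp_top hG hR _
      have h2 : MemLp (S k) ⊤ volume := hB.memLp_top hG hS k
      change MemLp g ⊤ volume
      rw [e']
      exact (h1.sub h2).ae_eq (Lp.coeFn_sub _ _).symm
    · rw [← e]
      filter_upwards [key k hk, Lp.coeFn_add g (S k)] with x h1 h2
      rw [h2, Pi.add_apply, h1]
  · rintro ⟨hg, e⟩
    -- Conversely, boundedness alone puts `g` in the domain of `A`, so no trace of the factorization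
    -- remains.
    have hmem := (mulOp A).mem_graph ⟨g, hA.mem_domain hg⟩
    refine ⟨_, hmem, Lp.ext (Filter.EventuallyEq.trans ?_ e)⟩
    filter_upwards [key _ hmem, Lp.coeFn_add g (S (mulOp A ⟨g, hA.mem_domain hg⟩))] with x h1 h2
    rw [h2, Pi.add_apply, h1]

theorem mem_perturbedGraph_column {V : ℝ → Spinor →L[ℂ] Spinor} {a₁ a₂ N₁ N₂ b₁ b₂ K₁ K₂ : ℝ≥0}
    {S₁ S₂ : SpinorL2 →L[ℂ] SpinorL2} (hA₁ : HasSplit A₁ a₁ N₁) (hA₂ : HasSplit A₂ a₂ N₂)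
    (hB₁ : HasSplit B₁ b₁ K₁) (hB₂ : HasSplit B₂ b₂ K₂) (hG : IsKernel G C s)
    (hBA : ∀ᵐ x, ∀ v, B₁ x (A₁ x v) + B₂ x (A₂ x v) = V x v)
    (hR : ∀ k : SpinorL2, R k =ᵐ[volume] conv G k)
    (hS₁ : ∀ k : SpinorL2, S₁ k =ᵐ[volume] conv G fun y => B₁ y (k y))
    (hS₂ : ∀ k : SpinorL2, S₂ k =ᵐ[volume] conv G fun y => B₂ y (k y)) {g h : SpinorL2} {z : ℂ} :
    (g, h) ∈ perturbedGraph (column (mulOp A₁) (mulOp A₂)) (rowCLM S₁ S₂) R z ↔ g ∈ essBounded ∧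
      (fun x => g x + conv G (fun y => V y (g y)) x) =ᵐ[volume] R (h - z • g) := by
  have key : ∀ p : WithLp 2 (SpinorL2 × SpinorL2),
      (g, p) ∈ (column (mulOp A₁) (mulOp A₂)).graph →
      rowCLM S₁ S₂ p =ᵐ[volume] conv G fun y => V y (g y) := by
    intro p hp
    obtain ⟨h1, h2⟩ := mem_graph_column.1 hp
    have h3 : conv G (fun y => V y (g y)) =
        conv G (fun y => B₁ y (p.fst y)) + conv G (fun y => B₂ y (p.snd y)) := by
      rw [← hG.conv_add (hB₁.isSum _) (hB₂.isSum _)]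
      refine conv_congr ?_
      filter_upwards [mem_graph_mulOp.1 h1, mem_graph_mulOp.1 h2, hBA] with x h4 h5 h6
      rw [Pi.add_apply, h4, h5, h6]
    rw [h3, rowCLM_apply]
    exact (Lp.coeFn_add _ _).trans ((hS₁ _).add (hS₂ _))
  rw [mem_perturbedGraph]
  constructor
  · rintro ⟨p, hp, e⟩
    refine ⟨?_, ?_⟩
    · have e' : g = R (h - z • g) - (S₁ p.fst + S₂ p.snd) := eq_sub_of_add_eq e
      have h1 : MemLp (R (h - z • g)) ⊤ volume := (hasSplit_const 1).memLp_top hG hR _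
      change MemLp g ⊤ volume
      rw [e']
      have h3 := ((hB₁.memLp_top hG hS₁ p.fst).add (hB₂.memLp_top hG hS₂ p.snd)).ae_eq (Lp.coeFn_add _ _).symm
      exact (h1.sub h3).ae_eq (Lp.coeFn_sub _ _).symm
    · rw [← e]
      filter_upwards [key p hp, Lp.coeFn_add g (rowCLM S₁ S₂ p)] with x h1 h2
      rw [h2, Pi.add_apply, h1]
  · rintro ⟨hg, e⟩
    have hmem := (column (mulOp A₁) (mulOp A₂)).mem_graph
      ⟨g, hA₁.mem_domain hg, hA₂.mem_domain hg⟩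
    refine ⟨_, hmem, Lp.ext (Filter.EventuallyEq.trans ?_ e)⟩
    filter_upwards [key _ hmem, Lp.coeFn_add g (rowCLM S₁ S₂ (column (mulOp A₁) (mulOp A₂)
      ⟨g, hA₁.mem_domain hg, hA₂.mem_domain hg⟩))] with x h1 h2
    rw [h2, Pi.add_apply, h1]

theorem exists_mulCLM {M : ℝ → Spinor →L[ℂ] Spinor} (hM : AEStronglyMeasurable M)
    (hN : ∀ᵐ x, ‖M x‖ₑ ≤ N) :
    ∃ T : SpinorL2 →L[ℂ] SpinorL2, mulOp M = ofCLM T := by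
  have hle : ∀ f : SpinorL2, eLpNorm (fun x => M x (f x)) 2 volume ≤ N * ‖f‖ₑ := fun f => by
    rw [Lp.enorm_def]
    exact (eLpNorm_apply_le (p := ⊤) (q := 2) (r := 2) hM (Lp.memLp f).1).trans
      (mul_le_mul_left (eLpNorm_top_le hN) _)
  have hmem : ∀ f : SpinorL2, f ∈ (mulOp M).domain := fun f =>
    ⟨aestronglyMeasurable_apply hM (Lp.memLp f).1, (hle f).trans_lt (by finiteness)⟩
  let T : SpinorL2 →ₗ[ℂ] SpinorL2 := (mulOp M).toFun ∘ₗ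
    LinearMap.codRestrict (mulOp M).domain LinearMap.id hmem
  have hT : ∀ f : SpinorL2, ‖T f‖ ≤ N * ‖f‖ := fun f => by
    have h1 : ‖T f‖ₑ ≤ N * ‖f‖ₑ := by
      refine le_trans (le_of_eq ?_) (hle f)
      rw [Lp.enorm_def]
      exact eLpNorm_congr_ae (MemLp.coeFn_toLp (hmem f))
    have := ENNReal.toReal_mono (by finiteness) h1
    simpa using this
  refine ⟨T.mkContinuous N hT, LinearPMap.eq_of_eq_graph ?_⟩
  ext ⟨f, g⟩
  rw [mem_graph_ofCLM, LinearPMap.mem_graph_iff]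
  constructor
  · rintro ⟨u, rfl, rfl⟩
    rfl
  · rintro rfl
    exact ⟨⟨f, hmem f⟩, rfl, rfl⟩

end Factorizations

/-! ### Small Birman-Schwinger operators on the imaginary axis -/

section Existence

open scoped ENNReal NNReal

variable {m : ℝ} {V W X : ℝ → Matrix (Fin 2) (Fin 2) ℂ}

/-- On the positive imaginary axis the kernels of the free resolvent are uniformly bounded, with
arbitrarily small integrals. -/
theorem exists_isKernel_small (m : ℝ) : ∃ C : ℝ≥0, ∀ δ : ℝ≥0, 0 < δ → ∃ z l : ℂ,
    0 < l.re ∧ l ^ 2 = m ^ 2 - z ^ 2 ∧ ∃ s ≤ δ, IsKernel (freeKernel m z l) C s := by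
  refine ⟨⟨2 * matBound * 2, by have := matBound_nonneg; positivity⟩, fun δ hδ => ?_⟩
  -- At `z = iη` one has `l = √(m² + η²) ≥ η`, so `s² = 2 / l ≤ 2 / η = δ²`. The kernel coefficients
  -- have four entries of modulus at most `1`, since `|z ± m| ≤ 2 l`.
  set η : ℝ := 2 / (δ : ℝ) ^ 2 with hη
  have hη0 : 0 < η := by positivity
  set l : ℝ := √(m ^ 2 + η ^ 2) with hl
  have hl2 : l ^ 2 = m ^ 2 + η ^ 2 := Real.sq_sqrt (by positivity)
  have hl0 : 0 < l := Real.sqrt_pos.2 (by positivity)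
  have hηl : η ≤ l := by nlinarith [sq_nonneg m]
  have hml : |m| ≤ l := abs_le_of_sq_le_sq (by nlinarith) hl0.le
  have hn : ∀ c : ℂ, ‖c‖ = 1 →
      ‖matOp (freeCoeff m (η * Complex.I) l c)‖ ≤ 2 * matBound * 2 := by
    intro c hc
    have hηn : ‖(η : ℂ) * Complex.I‖ ≤ l := by simpa [abs_of_pos hη0] using hηl
    have hmn : ‖(m : ℂ)‖ ≤ l := by simpa using hml
    have h1 : ‖((η : ℂ) * Complex.I + m) / (2 * l)‖ ≤ 1 := by
      rw [norm_div, div_le_one (by simp [hl0.ne'])]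
      refine (norm_add_le _ _).trans ?_
      simp only [norm_mul, Complex.norm_ofNat, Complex.norm_real, Real.norm_eq_abs, abs_of_pos hl0] at *
      linarith
    have h2 : ‖((η : ℂ) * Complex.I - m) / (2 * l)‖ ≤ 1 := by
      rw [norm_div, div_le_one (by simp [hl0.ne'])]
      refine (norm_sub_le _ _).trans ?_
      simp only [norm_mul, Complex.norm_ofNat, Complex.norm_real, Real.norm_eq_abs, abs_of_pos hl0] at *
      linarith
    have h3 : ‖c * (Complex.I / 2)‖ ≤ 1 := by
      rw [norm_mul, hc]
      norm_num
    refine (norm_matOp_le _).trans ?_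
    have : ∑ i, ∑ j, ‖freeCoeff m (η * Complex.I) l c i j‖ ≤ 4 := by
      simp only [Fin.sum_univ_two, freeCoeff]
      simp only [Matrix.of_apply, Matrix.cons_val_zero, Matrix.cons_val_one]
      linarith
    nlinarith [matBound_nonneg]
  refine ⟨η * Complex.I, l, by simpa using hl0, ?_, _, ?_, isKernel_freeKernel (by simpa using hl0)
    (hn 1 (by simp)) (hn (-1) (by simp))⟩
  · rw [mul_pow, Complex.I_sq, ← Complex.ofReal_pow, hl2]
    push_cast
    ring
  · rw [NNReal.sqrt_le_iff_le_sq, ← NNReal.coe_le_coe]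
    simp only [Complex.ofReal_re]
    push_cast
    rw [Real.coe_toNNReal _ hl0.le, div_le_iff₀ hl0]
    have : (δ : ℝ) ^ 2 * η = 2 := by rw [hη]; field_simp
    nlinarith [sq_nonneg (δ : ℝ), mul_le_mul_of_nonneg_left hηl (sq_nonneg (δ : ℝ))]

theorem isUnit_one_add_of_norm_lt {F : Type*} [NormedAddCommGroup F] [InnerProductSpace ℂ F]
    [CompleteSpace F] {Q : F →L[ℂ] F} (h : ‖Q‖ < 1) : IsUnit (1 + Q) := by
  have := isUnit_one_sub_of_norm_lt_one (x := -Q) (by rwa [norm_neg])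
  rwa [sub_neg_eq_add] at this

end Existence

end Dirac

namespace Dirac

open UnboundedOp

/-! ### Existence and uniqueness of the Dirac operator -/

section Existence

open scoped ENNReal NNReal

variable {m : ℝ} {V W X : ℝ → Matrix (Fin 2) (Fin 2) ℂ} {H : SpinorL2 →ₗ.[ℂ] SpinorL2}

/-- The graph of `H` consists of the bounded solutions of `g + G * (V g) = R (h - z g)`, for all
admissible spectral parameters. -/
def IsPerturbation (m : ℝ) (V : ℝ → Matrix (Fin 2) (Fin 2) ℂ) (H : SpinorL2 →ₗ.[ℂ] SpinorL2) :
    Prop :=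
  ∀ {z l : ℂ} {C s : ℝ≥0} {R : SpinorL2 →L[ℂ] SpinorL2}, 0 < l.re → l ^ 2 = m ^ 2 - z ^ 2 →
    IsKernel (freeKernel m z l) C s →
    (∀ k : SpinorL2, R k =ᵐ[volume] conv (freeKernel m z l) k) → ∀ {g h : SpinorL2},
    (g, h) ∈ H.graph ↔ g ∈ essBounded ∧
      (fun x => g x + conv (freeKernel m z l) (fun y => matOp (V y) (g y)) x) =ᵐ[volume]
        R (h - z • g)

/-- The graph built at one spectral parameter is carried to any other by `perturbedGraph_eq`, where
`right_unique` identifies the transferred `S` with the integral operator there. -/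
theorem exists_isPerturbation (m : ℝ) (h : IsDecomposition V W X) :
    ∃ H, IsPerturbation m V H := by
  obtain ⟨N, hA⟩ := h.isTame_funA.exists_hasSplit one_pos
  obtain ⟨K, hB⟩ := h.isTame_funB.exists_hasSplit one_pos
  obtain ⟨C, hC⟩ := exists_isKernel_small m
  obtain ⟨z, l, hl, hlz, s, -, hG⟩ := hC 1 one_pos
  obtain ⟨R, hR⟩ := hG.exists_conv
  have hres := isResolventAt_freeDirac hl hlz hR
  obtain ⟨T, hT⟩ := hA.exists_conv_left hG
  obtain ⟨S, hS⟩ := hB.exists_conv_right hG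
  obtain ⟨Q₀, hQ, -⟩ := exists_convOp hA hG hB
  have D := factorData_mulOp hR hT hS hQ
  refine ⟨(perturbedGraph (mulOp (funA V)) S R z).toLinearPMap, ?_⟩
  intro z' l' C' s' R' hl' hlz' hG' hR' g k
  rw [Submodule.toLinearPMap_graph_eq _ (perturbedGraph_snd hres)]
  have hres' := isResolventAt_freeDirac hl' hlz' hR'
  obtain ⟨T', hT'⟩ := hA.exists_conv_left hG'
  obtain ⟨S', hS'⟩ := hB.exists_conv_right hG'
  obtain ⟨Q', hQ', -⟩ := exists_convOp hA hG' hB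
  have D' := factorData_mulOp hR' hT' hS' hQ'
  rw [perturbedGraph_eq hres hres', (D.transfer hres hres').right_unique D' hB.dense_domain]
  exact mem_perturbedGraph_mulOp hA hB hG'
    (Filter.Eventually.of_forall fun x v => funB_funA V x v) hR' hS'

/-- The tolerance that makes Birman-Schwinger operators small. -/
noncomputable def tolerance (C : ℝ≥0) : ℝ≥0 := 1 / (4 * (C + 1))

theorem tolerance_pos (C : ℝ≥0) : 0 < tolerance C := by
  unfold tolerance
  positivity

/-- The bound `1 / 4` leaves room for the four blocks of a column factorization to add up to less
than `1`. -/
theorem norm_lt_of_tolerance {C s N : ℝ≥0} {Q : SpinorL2 →L[ℂ] SpinorL2}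
    (hs : s ≤ tolerance C / (N + 1))
    (hQ : ‖Q‖ ≤ C * ((tolerance C + s * N) * (tolerance C + s * N))) : ‖Q‖ < 1 / 4 := by
  have h1 : s * N ≤ tolerance C := by
    calc s * N ≤ tolerance C / (N + 1) * (N + 1) := mul_le_mul' hs (le_add_of_nonneg_right zero_le_one)
      _ = tolerance C := div_mul_cancel₀ _ (by positivity)
  have h1' : (s * N : ℝ) ≤ tolerance C := by exact_mod_cast h1
  have ht : (tolerance C : ℝ) * (4 * (C + 1)) = 1 := by
    rw [tolerance]
    push_cast
    field_simp
  have ht0 : (0 : ℝ) ≤ tolerance C := NNReal.coe_nonneg _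
  have hC0 : (0 : ℝ) ≤ C := C.2
  have hsN : (0 : ℝ) ≤ s * N := by positivity
  have h2 : (C : ℝ) * ((tolerance C + s * N) * (tolerance C + s * N)) ≤
      C * ((2 * tolerance C) * (2 * tolerance C)) := by
    gcongr <;> linarith
  refine (hQ.trans h2).trans_lt ?_
  have h3 : (0 : ℝ) < tolerance C := tolerance_pos C
  have h4 : (C : ℝ) * tolerance C < 1 / 4 := by nlinarith
  have h5 : (tolerance C : ℝ) ≤ 1 / 4 := by nlinarith
  nlinarith

/-- The order of choices matters: `C` is uniform along the imaginary axis and fixes the tolerance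
for the `L²` parts, this determines the sup bounds of the remainders, and only then is the spectral
parameter chosen. -/
theorem IsPerturbation.isFactorizedExtension_polar (hH : IsPerturbation m V H)
    (h : IsDecomposition V W X) :
    IsFactorizedExtension (freeDirac m) (factorA V) (factorB V) H := by
  obtain ⟨C, hC⟩ := exists_isKernel_small m
  obtain ⟨N₁, hA⟩ := h.isTame_funA.exists_hasSplit (tolerance_pos C)
  obtain ⟨N₂, hB⟩ := h.isTame_funB.exists_hasSplit (tolerance_pos C)
  replace hA := hA.mono le_rfl (le_max_left N₁ N₂)
  replace hB := hB.mono le_rfl (le_max_right N₁ N₂)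
  obtain ⟨z, l, hl, hlz, s, hs, hG⟩ := hC (tolerance C / (max N₁ N₂ + 1))
    (div_pos (tolerance_pos C) (by positivity))
  obtain ⟨R, hR⟩ := hG.exists_conv
  obtain ⟨T, hT⟩ := hA.exists_conv_left hG
  obtain ⟨S, hS⟩ := hB.exists_conv_right hG
  obtain ⟨Q₀, hQ, hQn⟩ := exists_convOp hA hG hB
  refine (factorData_mulOp hR hT hS hQ).isFactorizedExtension (isResolventAt_freeDirac hl hlz hR)
    (dense_freeDirac_domain m) (isClosed_mulOp _) hA.dense_domain (isClosed_mulOp _)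
    hB.dense_domain (isUnit_one_add_of_norm_lt ?_) ?_
  · exact (norm_lt_of_tolerance hs hQn).trans (by norm_num)
  · ext ⟨g, k⟩
    rw [hH hl hlz hG hR]
    exact (mem_perturbedGraph_mulOp hA hB hG
      (Filter.Eventually.of_forall fun x v => funB_funA V x v) hR hS).symm

theorem IsPerturbation.isFactorizedExtension_column (hH : IsPerturbation m V H)
    (h : IsDecomposition V W X) :
    IsFactorizedExtension (freeDirac m) (column (factorA W) (factorA X))
      (row (factorB W) (factorB X)) H := by
  obtain ⟨C, hC⟩ := exists_isKernel_small m
  have ht := tolerance_pos C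
  obtain ⟨N₁, hA₁⟩ := h.left.isTame_funA.exists_hasSplit ht
  obtain ⟨N₂, hB₁⟩ := h.left.isTame_funB.exists_hasSplit ht
  obtain ⟨N₃, hA₂⟩ := h.right.isTame_funA.exists_hasSplit ht
  obtain ⟨N₄, hB₂⟩ := h.right.isTame_funB.exists_hasSplit ht
  set N := max (max N₁ N₂) (max N₃ N₄)
  replace hA₁ := hA₁.mono le_rfl (show N₁ ≤ N by simp [N])
  replace hB₁ := hB₁.mono le_rfl (show N₂ ≤ N by simp [N])
  replace hA₂ := hA₂.mono le_rfl (show N₃ ≤ N by simp [N])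
  replace hB₂ := hB₂.mono le_rfl (show N₄ ≤ N by simp [N])
  obtain ⟨z, l, hl, hlz, s, hs, hG⟩ := hC (tolerance C / (N + 1)) (div_pos ht (by positivity))
  obtain ⟨R, hR⟩ := hG.exists_conv
  obtain ⟨T₁, hT₁⟩ := hA₁.exists_conv_left hG
  obtain ⟨T₂, hT₂⟩ := hA₂.exists_conv_left hG
  obtain ⟨S₁, hS₁⟩ := hB₁.exists_conv_right hG
  obtain ⟨S₂, hS₂⟩ := hB₂.exists_conv_right hG
  obtain ⟨Q₁₁, hQ₁₁, hn₁₁⟩ := exists_convOp hA₁ hG hB₁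
  obtain ⟨Q₁₂, hQ₁₂, hn₁₂⟩ := exists_convOp hA₁ hG hB₂
  obtain ⟨Q₂₁, hQ₂₁, hn₂₁⟩ := exists_convOp hA₂ hG hB₁
  obtain ⟨Q₂₂, hQ₂₂, hn₂₂⟩ := exists_convOp hA₂ hG hB₂
  have D := (factorData_mulOp hR hT₁ hS₁ hQ₁₁).block (factorData_mulOp hR hT₂ hS₂ hQ₂₂)
    (factorData_mulOp hR hT₁ hS₂ hQ₁₂).both (factorData_mulOp hR hT₂ hS₁ hQ₂₁).both
  obtain ⟨K, hK⟩ := h.exists_enorm_funB_le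
  obtain ⟨Y, hY⟩ := exists_mulCLM
    (aestronglyMeasurable_funB h.right.aestronglyMeasurable) hK
  have hdA : Dense ((column (factorA W) (factorA X)).domain : Set SpinorL2) :=
    dense_essBounded.mono fun f hf => ⟨hA₁.mem_domain hf, hA₂.mem_domain hf⟩
  refine D.isFactorizedExtension (isResolventAt_freeDirac hl hlz hR)
    (dense_freeDirac_domain m) (isClosed_column (isClosed_mulOp _) (isClosed_mulOp _)) hdA
    (isClosed_row (isClosed_mulOp _) hY) (dense_row_domain hB₁.dense_domain hB₂.dense_domain)
    (isUnit_one_add_of_norm_lt ?_) ?_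
  · refine (norm_columnCLM_le _ _).trans_lt ?_
    have h1 := norm_rowCLM_le Q₁₁ Q₁₂
    have h2 := norm_rowCLM_le Q₂₁ Q₂₂
    linarith [norm_lt_of_tolerance hs hn₁₁, norm_lt_of_tolerance hs hn₁₂,
      norm_lt_of_tolerance hs hn₂₁, norm_lt_of_tolerance hs hn₂₂]
  · ext ⟨g, k⟩
    rw [hH hl hlz hG hR]
    refine (mem_perturbedGraph_column hA₁ hA₂ hB₁ hB₂ hG ?_ hR hS₁ hS₂).symm
    filter_upwards [h.eq_add] with x hx v
    rw [funB_funA, funB_funA, hx, matOp, matOp, matOp, map_add]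
    rfl

theorem IsPerturbation.isDiracOperator (hH : IsPerturbation m V H) (h : IsDecomposition V W X) :
    IsDiracOperator m V H :=
  ⟨hH.isFactorizedExtension_polar h, fun _ _ h' => hH.isFactorizedExtension_column h'⟩

theorem existsUnique_isDiracOperator (m : ℝ) (h : IsDecomposition V W X) :
    ∃! H, IsDiracOperator m V H := by
  obtain ⟨H, hH⟩ := exists_isPerturbation m h
  exact ⟨H, hH.isDiracOperator h, fun H' h' =>
    h'.polar.unique (hH.isDiracOperator h).polar⟩

end Existence

end Dirac

namespace Dirac

open UnboundedOp

/-! ### Compactness of `A R₀` -/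

section Compactness

open scoped ENNReal NNReal

theorem exists_eLpNorm_translate_sub_le {F : Type*} [NormedAddCommGroup F] {g : ℝ → F}
    (hg : MemLp g 2 volume) {δ : ℝ≥0} (hδ : 0 < δ) :
    ∃ η > 0, ∀ h : ℝ, |h| < η → eLpNorm (fun t => g (h + t) - g t) 2 volume ≤ δ := by
  have : Fact ((2 : ℝ≥0∞) ≠ ⊤) := ⟨by norm_num⟩
  have hc : Continuous fun h : ℝ => DomAddAct.mk h +ᵥ hg.toLp :=
    (DomAddAct.continuous_mk).vadd continuous_const
  obtain ⟨η, hη, h⟩ := Metric.continuous_iff.1 hc 0 δ hδ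
  refine ⟨η, hη, fun t ht => ?_⟩
  have h1 := h t (by simpa using ht)
  have hm : MemLp (fun x => g (t + x)) 2 volume :=
    hg.comp_measurePreserving (measurePreserving_add_left volume t)
  have e0 : DomAddAct.mk (0 : ℝ) +ᵥ hg.toLp = hg.toLp := by
    rw [DomAddAct.mk_zero, zero_vadd]
  have e1 : DomAddAct.mk t +ᵥ hg.toLp = hm.toLp := DomAddAct.mk_vadd_toLp t hg
  rw [e0, e1, dist_eq_norm, ← MemLp.toLp_sub, Lp.norm_toLp] at h1
  have h2 := (hm.sub hg).2.ne
  exact (ENNReal.toReal_le_toReal h2 ENNReal.coe_ne_top).1 h1.le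

variable {A G : ℝ → Spinor →L[ℂ] Spinor} {C s a N : ℝ≥0} {T : SpinorL2 →L[ℂ] SpinorL2}

theorem IsKernel.memLp_two (hG : IsKernel G C s) : MemLp G 2 volume := by
  refine ⟨hG.meas.aestronglyMeasurable, ?_⟩
  have h : eLpNorm G 2 volume ^ 2 < ⊤ := by
    rw [sq_eLpNorm_two]
    calc ∫⁻ x, ‖G x‖ₑ ^ 2 ≤ ∫⁻ x, C * ‖G x‖ₑ := lintegral_mono fun x => by
          rw [sq]
          exact mul_le_mul_left (hG.sup x) _
      _ = C * ∫⁻ x, ‖G x‖ₑ := lintegral_const_mul' _ _ ENNReal.coe_ne_top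
      _ < ⊤ := ENNReal.mul_lt_top ENNReal.coe_lt_top (hG.int.trans_lt (by finiteness))
  by_contra h'
  rw [not_lt_top_iff.1 h'] at h
  simp at h

/-- Cauchy-Schwarz against the translate of `G`; together with continuity of translations in `L²`
this is equicontinuity on the unit ball. -/
theorem IsKernel.enorm_conv_sub_le (hG : IsKernel G C s) (f : SpinorL2) (x x' : ℝ) {δ : ℝ≥0}
    (h : eLpNorm (fun t => G (x - x' + t) - G t) 2 volume ≤ δ) :
    ‖conv G f x - conv G f x'‖ₑ ≤ δ * ‖f‖ₑ := by
  have hf := Lp.memLp f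
  have e : conv G f x - conv G f x' = ∫ y, (G (x - y) - G (x' - y)) (f y) := by
    rw [conv, conv, ← integral_sub (hG.integrable_two hf x) (hG.integrable_two hf x')]
    rfl
  have hm : ∀ x, AEStronglyMeasurable fun y => G (x - y) := fun x =>
    (hG.meas.comp_measurable (measurable_id.const_sub x)).aestronglyMeasurable
  rw [e]
  refine (enorm_integral_le_lintegral_enorm _).trans ?_
  rw [← eLpNorm_one_eq_lintegral_enorm]
  refine (eLpNorm_apply_le (p := 2) (q := 2) ((hm x).sub (hm x')) hf.1).trans ?_
  rw [Lp.enorm_def]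
  refine mul_le_mul_left (le_trans (le_of_eq ?_) h) _
  have h0 : AEStronglyMeasurable (fun t => G (x - x' + t) - G t) volume :=
    ((hG.meas.comp_measurable (measurable_const_add _)).sub hG.meas).aestronglyMeasurable
  rw [← eLpNorm_comp_measurePreserving h0 (Measure.measurePreserving_sub_left volume x')]
  congr 1
  ext1 y
  simp only [Function.comp_apply, Pi.sub_apply, sub_add_sub_cancel]

theorem isCompactOperator_of_forall_exists {E F : Type*} [NormedAddCommGroup E] [NormedSpace ℂ E]
    [NormedAddCommGroup F] [NormedSpace ℂ F] [CompleteSpace F] {T : E →L[ℂ] F}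
    (h : ∀ ε > 0, ∃ T' : E →L[ℂ] F, IsCompactOperator T' ∧ ‖T - T'‖ < ε) :
    IsCompactOperator T := by
  have := isClosed_setOfPred_isCompactOperator (σ₁₂ := RingHom.id ℂ) (M₁ := E) (M₂ := F)
  refine this.closure_subset (Metric.mem_closure_iff.2 fun ε hε => ?_)
  obtain ⟨T', h1, h2⟩ := h ε hε
  exact ⟨T', h1, by rwa [dist_eq_norm]⟩

/-- Evaluation of `G * f` at a point. -/
theorem IsKernel.exists_evalCLM (hG : IsKernel G C s) (x : ℝ) :
    ∃ L : SpinorL2 →L[ℂ] Spinor, ∀ f : SpinorL2, L f = conv G f x := by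
  let L : SpinorL2 →ₗ[ℂ] Spinor :=
    { toFun := fun f => conv G f x
      map_add' := fun f g => by
        rw [conv_congr (Lp.coeFn_add f g)]
        simp only [conv, Pi.add_apply, map_add]
        exact integral_add (hG.integrable_two (Lp.memLp f) x) (hG.integrable_two (Lp.memLp g) x)
      map_smul' := fun c f => by
        rw [conv_congr (Lp.coeFn_smul c f), conv_smul]
        rfl }
  refine ⟨L.mkContinuous (C * s) fun f => ?_, fun f => rfl⟩
  have h1 : ‖conv G f x‖ₑ ≤ C * (s * ‖f‖ₑ) := by
    rw [Lp.enorm_def]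
    exact (enorm_conv_le x).trans (hG.convMajorant_le_two (Lp.memLp f).1 x)
  have := ENNReal.toReal_mono (by finiteness) h1
  change ‖conv G f x‖ ≤ C * s * ‖f‖
  simpa [mul_assoc] using this

/-- The finite rank building blocks of approximations of `A (G * f)`. -/
theorem IsKernel.exists_isCompactOperator (hG : IsKernel G C s) (hA : MemLp A 2 volume) (x₀ : ℝ)
    {I : Set ℝ} (hI : MeasurableSet I) :
    ∃ F : SpinorL2 →L[ℂ] SpinorL2, IsCompactOperator F ∧
      ∀ f : SpinorL2, F f =ᵐ[volume] I.indicator fun x => A x (conv G f x₀) := by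
  obtain ⟨L, hL⟩ := hG.exists_evalCLM x₀
  have hm : ∀ v : Spinor, MemLp (I.indicator fun x => A x v) 2 volume := fun v =>
    ((ContinuousLinearMap.apply ℂ Spinor v).comp_memLp' hA).indicator hI
  let Θ : Spinor →ₗ[ℂ] SpinorL2 :=
    { toFun := fun v => (hm v).toLp
      map_add' := fun v w => by
        rw [← MemLp.toLp_add]
        refine MemLp.toLp_congr _ _ (Filter.Eventually.of_forall fun x => ?_)
        by_cases hx : x ∈ I <;> simp [hx]
      map_smul' := fun c v => by
        rw [RingHom.id_apply, ← MemLp.toLp_const_smul]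
        refine MemLp.toLp_congr _ _ (Filter.Eventually.of_forall fun x => ?_)
        by_cases hx : x ∈ I <;> simp [hx] }
  have hLc : IsCompactOperator L := isCompactOperator_of_locallyCompactSpace_dom L
  refine ⟨(LinearMap.toContinuousLinearMap Θ) ∘L L,
    hLc.clm_comp (LinearMap.toContinuousLinearMap Θ), fun f => ?_⟩
  rw [← hL]
  exact (hm (L f)).coeFn_toLp

/-- Replace `G * f` on each cell of a grid of mesh `η` by its value at the left endpoint. Finitely
many cells meet the support of `A`, and the error is at most `‖A‖₂ δ ‖f‖`. -/
theorem IsKernel.isCompactOperator_of_support (hG : IsKernel G C s) (hA : MemLp A 2 volume) {r : ℝ}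
    (hr : ∀ x, r < |x| → A x = 0)
    (hT : ∀ f : SpinorL2, T f =ᵐ[volume] fun x => A x (conv G f x)) : IsCompactOperator T := by
  refine isCompactOperator_of_forall_exists fun ε hε => ?_
  set α : ℝ≥0 := (eLpNorm A 2 volume).toNNReal with hα
  have hα' : eLpNorm A 2 volume = α := (ENNReal.coe_toNNReal hA.2.ne).symm
  have hδ : 0 < ε.toNNReal / (2 * (α + 1)) := by
    have := Real.toNNReal_pos.2 hε
    positivity
  obtain ⟨η, hη, hδη⟩ := exists_eLpNorm_translate_sub_le hG.memLp_two hδ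
  set δ := ε.toNNReal / (2 * (α + 1)) with hδdef
  obtain ⟨n, hn⟩ := exists_nat_ge (r / η + 1)
  have hI : ∀ j : ℤ, MeasurableSet {x : ℝ | ⌊x / η⌋ = j} := fun j =>
    (Int.measurable_floor.comp (measurable_id.div_const η)) (measurableSet_singleton j)
  choose F hF hF' using fun j : ℤ => hG.exists_isCompactOperator hA (η * j) (hI j)
  set J := Finset.Icc (-(n : ℤ)) n with hJ
  refine ⟨∑ j ∈ J, F j, ?_, ?_⟩
  · refine Finset.sum_induction F (fun T => IsCompactOperator T) (fun _ _ h1 h2 => h1.add h2)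
      isCompactOperator_zero fun j _ => hF j
  have hval : ∀ f : SpinorL2, (∑ j ∈ J, F j) f =ᵐ[volume]
      fun x => A x (conv G f (η * ⌊x / η⌋)) := by
    intro f
    have h1 : ((∑ j ∈ J, F j) f : SpinorL2) =ᵐ[volume] fun x => ∑ j ∈ J, F j f x := by
      rw [sum_apply]
      exact Lp.coeFn_fun_finsetSum _ _
    refine h1.trans ?_
    filter_upwards [ae_all_iff.2 fun j => hF' j f] with x hx
    simp only [hx, Set.indicator_apply, Set.mem_ofPred_eq]
    rw [Finset.sum_ite_eq]
    split_ifs with hj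
    · rfl
    · rw [hr x]
      · rfl
      · by_contra hxr
        refine hj (Finset.mem_Icc.2 ⟨?_, ?_⟩)
        · rw [Int.le_floor, le_div_iff₀ hη]
          have h2 := neg_le_of_abs_le (not_lt.1 hxr)
          have h3 : r ≤ n * η := by rw [← div_le_iff₀ hη]; linarith
          push_cast
          linarith
        · have h2 := le_of_abs_le (not_lt.1 hxr)
          have h3 : x / η ≤ n := by
            have := div_le_div_of_nonneg_right h2 hη.le
            linarith
          exact_mod_cast (Int.floor_le _).trans h3
  refine lt_of_le_of_lt (ContinuousLinearMap.opNorm_le_bound _ (M := α * δ) (by positivity)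
    fun f => ?_) ?_
  · have h1 : ((T - ∑ j ∈ J, F j) f : SpinorL2) =ᵐ[volume]
        fun x => A x (conv G f x - conv G f (η * ⌊x / η⌋)) := by
      filter_upwards [hT f, hval f, Lp.coeFn_sub (T f) ((∑ j ∈ J, F j) f)] with x h2 h3 h4
      rw [sub_apply, h4, Pi.sub_apply, h2, h3, map_sub]
    have hw : ∀ x, ‖conv G f x - conv G f (η * ⌊x / η⌋)‖ₑ ≤ δ * ‖f‖ₑ := fun x => by
      refine hG.enorm_conv_sub_le f _ _ (hδη _ ?_)
      have h2 := Int.floor_le (x / η)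
      have h3 := Int.lt_floor_add_one (x / η)
      rw [le_div_iff₀ hη] at h2
      rw [div_lt_iff₀ hη] at h3
      rw [abs_of_nonneg (by linarith)]
      linarith
    have hwm : AEStronglyMeasurable (fun x => conv G f x - conv G f (η * ⌊x / η⌋)) volume := by
      refine (hG.aestronglyMeasurable_conv (Lp.memLp f).1).sub ?_
      have : Measurable fun x : ℝ => ⌊x / η⌋ :=
        Int.measurable_floor.comp (measurable_id.div_const η)
      exact ((measurable_from_top (f := fun j : ℤ => conv G f (η * j))).comp
        this).aestronglyMeasurable
    have h5 : ‖(T - ∑ j ∈ J, F j) f‖ₑ ≤ α * (δ * ‖f‖ₑ) := by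
      rw [Lp.enorm_def, eLpNorm_congr_ae h1]
      refine (eLpNorm_apply_le (p := 2) (q := ⊤) (r := 2) hA.1 hwm).trans ?_
      rw [hα']
      exact mul_le_mul_right (eLpNorm_top_le (Filter.Eventually.of_forall hw)) _
    have := ENNReal.toReal_mono (by finiteness) h5
    simpa [mul_assoc] using this
  · have h6 : (δ : ℝ) * (2 * (α + 1)) = ε := by
      rw [hδdef]
      push_cast
      rw [Real.coe_toNNReal _ hε.le]
      field_simp
    have h7 : (0 : ℝ) < δ := hδ
    nlinarith [α.2]

/-- The bounded, boundedly supported part of `A` is in `L²` and gives a compact operator; the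
remainder is small in operator norm by `exists_convOp`. -/
theorem IsTame.isCompactOperator (hA : IsTame A) (hG : IsKernel G C s)
    (hT : ∀ f : SpinorL2, T f =ᵐ[volume] fun x => A x (conv G f x)) : IsCompactOperator T := by
  refine isCompactOperator_of_forall_exists fun ε hε => ?_
  set k : ℝ≥0 := C * ((1 + s) * (s * ‖(1 : Spinor →L[ℂ] Spinor)‖₊)) with hk
  have hδ : 0 < ε.toNNReal / (k + 1) := by
    have := Real.toNNReal_pos.2 hε
    positivity
  obtain ⟨K, r, A', A'', rfl, h1, h2, h3, h4⟩ := hA _ hδ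
  set δ := ε.toNNReal / (k + 1) with hδdef
  have hA' : MemLp A' 2 volume := by
    refine ⟨h1, ?_⟩
    have h5 : eLpNorm A' 2 volume ^ 2 < ⊤ := by
      rw [sq_eLpNorm_two]
      calc ∫⁻ x, ‖A' x‖ₑ ^ 2 ≤ ∫⁻ x, (Set.Icc (-r) r).indicator (fun _ => (K : ℝ≥0∞) ^ 2) x := by
            refine lintegral_mono fun x => ?_
            by_cases hx : x ∈ Set.Icc (-r) r
            · rw [Set.indicator_of_mem hx]
              exact pow_le_pow_left' (h2 x) 2
            · have : r < |x| := not_le.1 fun h => hx (abs_le.1 h)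
              simp only
              rw [h3 x this, ← ofReal_norm, norm_zero]
              simp
        _ = K ^ 2 * volume (Set.Icc (-r) r) := lintegral_indicator_const measurableSet_Icc _
        _ < ⊤ := ENNReal.mul_lt_top (by finiteness) measure_Icc_lt_top
    by_contra h'
    rw [not_lt_top_iff.1 h'] at h5
    simp at h5
  have hs : HasSplit A' (eLpNorm A' 2 volume).toNNReal 0 :=
    ⟨A', 0, (add_zero _).symm, h1, aestronglyMeasurable_zero,
      (ENNReal.coe_toNNReal hA'.2.ne).ge, Filter.Eventually.of_forall fun x =>
        enorm_le_coe_iff.2 (by rw [Pi.zero_apply, norm_zero]; rfl)⟩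
  obtain ⟨T', hT'⟩ := hs.exists_conv_left hG
  obtain ⟨T'', hT'', hn⟩ := exists_convOp h4 hG (hasSplit_const 1)
  refine ⟨T', hG.isCompactOperator_of_support hA' h3 hT', ?_⟩
  have e : T - T' = T'' := by
    ext1 f
    refine Lp.ext ?_
    filter_upwards [hT f, hT' f, hT'' f, Lp.coeFn_sub (T f) (T' f)] with x h5 h6 h7 h8
    rw [sub_apply, h8, Pi.sub_apply, h5, h6, h7]
    exact add_sub_cancel_left _ _
  rw [e]
  refine hn.trans_lt ?_
  have h6 : (δ : ℝ) * (k + 1) = ε := by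
    rw [hδdef]
    push_cast
    rw [Real.coe_toNNReal _ hε.le]
    field_simp
  have h7 : (0 : ℝ) < δ := hδ
  have h8 : (C : ℝ) * ((δ + s * δ) * ((0 : ℝ≥0) + s * ‖(1 : Spinor →L[ℂ] Spinor)‖₊)) = δ * k := by
    rw [hk]
    push_cast
    ring
  rw [h8]
  linarith

end Compactness

/-! ### Compactness of the difference of resolvents -/

section ResolventDifference

open scoped ENNReal NNReal

variable {m : ℝ} {V W X : ℝ → Matrix (Fin 2) (Fin 2) ℂ} {H : SpinorL2 →ₗ.[ℂ] SpinorL2}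

/-- `A R₀` is compact at one explicit point `w`; `transfer` writes it at `z` as a sum of products
containing `A R₀(w)`, and it is a factor of the resolvent formula. -/
theorem isCompactOperator_res_sub (h : IsDecomposition V W X)
    (hH : IsFactorizedExtension (freeDirac m) (factorA V) (factorB V) H) {z : ℂ}
    (hz : z ∈ rho H ∩ rho (freeDirac m)) :
    IsCompactOperator (res H z - res (freeDirac m) z) := by
  obtain ⟨N, hA⟩ := h.isTame_funA.exists_hasSplit one_pos
  obtain ⟨K, hB⟩ := h.isTame_funB.exists_hasSplit one_pos
  obtain ⟨C, hC⟩ := exists_isKernel_small m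
  obtain ⟨w, l, hl, hlw, s, -, hG⟩ := hC 1 one_pos
  obtain ⟨R, hR⟩ := hG.exists_conv
  obtain ⟨T, hT⟩ := hA.exists_conv_left hG
  obtain ⟨S, hS⟩ := hB.exists_conv_right hG
  obtain ⟨Q₀, hQ, -⟩ := exists_convOp hA hG hB
  have D := factorData_mulOp hR hT hS hQ
  have hRz := isResolventAt_res hz.2
  have D' := D.transfer (isResolventAt_freeDirac hl hlw hR) hRz
  have hTc : IsCompactOperator T := h.isTame_funA.isCompactOperator hG hT
  have hAR : boundedClosure (AR (freeDirac m) (factorA V) z) =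
      T + (z - w) • T ∘L res (freeDirac m) z := by
    refine boundedClosure_eq ?_
    rw [factorA, show (fun x => absSqrt (matOp (V x))) = funA V from rfl, D'.AR_eq hRz]
    exact closure_of_isClosed (isClosed_ofCLM _)
  have hc : IsCompactOperator (boundedClosure (AR (freeDirac m) (factorA V) z)) := by
    rw [hAR]
    exact hTc.add ((hTc.comp_clm (res (freeDirac m) z)).smul (z - w))
  rw [hH.res_eq z ⟨hz.2, hz.1⟩, sub_sub_cancel_left]
  exact ((hc.clm_comp _).clm_comp _).neg

end ResolventDifference

end Dirac

namespace Dirac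

open UnboundedOp

/-! ### Weyl sequences of wave packets -/

section WavePackets

variable {η φ : ℝ → ℝ} {a : ℝ}

/-- The wave packet with wave number `k`, envelope `η`, width `a` and amplitude `v`. -/
noncomputable def packet (η : ℝ → ℝ) (a k : ℝ) (v : Spinor) (x : ℝ) : Spinor :=
  η (x / a) • (Complex.exp (Complex.I * k * x) • v)

theorem continuous_packet (hη : Continuous η) (a k : ℝ) (v : Spinor) :
    Continuous (packet η a k v) := by
  unfold packet
  fun_prop

theorem memLp_packet (hη : Continuous η) (hc : HasCompactSupport η) (ha : 0 < a) (k : ℝ)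
    (v : Spinor) : MemLp (packet η a k v) 2 volume := by
  have h1 : HasCompactSupport fun x : ℝ => η (x * a⁻¹) :=
    hc.comp_homeomorph (Homeomorph.mulRight₀ a⁻¹ (inv_ne_zero ha.ne'))
  have h2 : HasCompactSupport (packet η a k v) := h1.mono' fun x hx =>
    subset_closure fun h0 => hx (by
    simp only at h0
    rw [packet, div_eq_mul_inv, h0]
    exact zero_smul ℝ _)
  exact (continuous_packet hη a k v).memLp_of_hasCompactSupport h2

theorem norm_packet (η : ℝ → ℝ) (a k : ℝ) (v : Spinor) (x : ℝ) :
    ‖packet η a k v x‖ ^ 2 = η (x / a) ^ 2 * ‖v‖ ^ 2 := by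
  have : ‖Complex.exp (Complex.I * k * x)‖ = 1 := by
    rw [show Complex.I * (k : ℂ) * x = ((k * x : ℝ) : ℂ) * Complex.I by push_cast; ring]
    exact Complex.norm_exp_ofReal_mul_I _
  rw [packet, norm_smul, norm_smul, this, one_mul, mul_pow, Real.norm_eq_abs, sq_abs]

theorem norm_toLp_packet (ha : 0 < a) (k : ℝ) (v : Spinor) (h : MemLp (packet η a k v) 2 volume) :
    ‖h.toLp‖ ^ 2 = a * (∫ x, η x ^ 2) * ‖v‖ ^ 2 := by
  have h1 : ((‖h.toLp‖ ^ 2 : ℝ) : ℂ) = ((∫ x, η (x / a) ^ 2 * ‖v‖ ^ 2 : ℝ) : ℂ) := by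
    rw [← integral_complex_ofReal]
    push_cast
    refine (inner_self_eq_norm_sq_to_K (𝕜 := ℂ) h.toLp).symm.trans ?_
    rw [L2.inner_def]
    refine integral_congr_ae ?_
    filter_upwards [h.coeFn_toLp] with x hx
    rw [inner_self_eq_norm_sq_to_K (𝕜 := ℂ), hx]
    have h2 := congrArg Complex.ofReal (norm_packet η a k v x)
    push_cast at h2
    exact h2
  rw [Complex.ofReal_inj.1 h1, integral_mul_const,
    Measure.integral_comp_div (fun x => η x ^ 2) a, abs_of_pos ha, smul_eq_mul]

theorem packet_mem_weakDerivGraph (hφ : ContDiff ℝ ∞ φ) (a k : ℝ) (v : Spinor)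
    (h : MemLp (packet φ a k v) 2 volume) (h' : MemLp (packet (deriv φ) a k v) 2 volume) :
    (h.toLp, ((a⁻¹ : ℝ) : ℂ) • h'.toLp + (Complex.I * k) • h.toLp) ∈ weakDerivGraph := by
  have hd : Continuous (deriv φ) := hφ.continuous_deriv (by simp)
  have hm : MemLp (((a⁻¹ : ℝ) : ℂ) • packet (deriv φ) a k v + (Complex.I * k) • packet φ a k v) 2
      volume := (h'.const_smul _).add (h.const_smul _)
  have key := mem_weakDerivGraph_of_hasDerivAt (g := packet φ a k v)
    (g' := ((a⁻¹ : ℝ) : ℂ) • packet (deriv φ) a k v + (Complex.I * k) • packet φ a k v)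
    (fun x => ?_) ?_ h hm
  · rwa [MemLp.toLp_add (h'.const_smul _) (h.const_smul _), MemLp.toLp_const_smul,
      MemLp.toLp_const_smul] at key
  · have d1 : HasDerivAt (fun x : ℝ => φ (x / a)) (deriv φ (x / a) * a⁻¹) x := by
      have := ((hφ.differentiable (by simp) (x / a)).hasDerivAt).comp x
        ((hasDerivAt_id x).div_const a)
      simpa [Function.comp_def] using this
    have d2 : HasDerivAt (fun x : ℝ => Complex.exp (Complex.I * k * x))
        (Complex.exp (Complex.I * k * x) * (Complex.I * k)) x := by
      have := ((Complex.ofRealCLM.hasDerivAt (x := x)).const_mul (Complex.I * (k : ℂ))).cexp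
      simpa using this
    refine (d1.smul (d2.smul_const v)).congr_deriv ?_
    simp only [packet, Pi.add_apply, Pi.smul_apply]
    simp only [← Complex.coe_smul, smul_smul]
    push_cast
    module
  · exact ((continuous_packet hd a k v).const_smul _).add
      ((continuous_packet hφ.continuous a k v).const_smul _)

theorem constMat_toLp_packet (M : Matrix (Fin 2) (Fin 2) ℂ) {k : ℝ} {v : Spinor} {c : ℂ}
    (hv : matOp M v = c • v) (h : MemLp (packet η a k v) 2 volume) :
    constMat M h.toLp = c • h.toLp := by
  refine Lp.ext ?_
  filter_upwards [constMat_ae M h.toLp, h.coeFn_toLp, Lp.coeFn_smul c h.toLp] with x h1 h2 h3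
  rw [h1, h3, Pi.smul_apply, h2, packet]
  rw [ContinuousLinearMap.map_smul_of_tower, map_smul, hv]
  module

theorem packet_mem_graph_freeDirac {m t k : ℝ} {v : Spinor} (hφ : ContDiff ℝ ∞ φ)
    (hv : matOp ((k : ℂ) • !![0, 1; 1, 0] + (m : ℂ) • !![1, 0; 0, -1]) v = (t : ℂ) • v)
    (h : MemLp (packet φ a k v) 2 volume) (h' : MemLp (packet (deriv φ) a k v) 2 volume) :
    (h.toLp, (-Complex.I * ((a⁻¹ : ℝ) : ℂ)) • constMat !![0, 1; 1, 0] h'.toLp + (t : ℂ) • h.toLp) ∈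
      (freeDirac m).graph := by
  refine mem_graph_freeDirac.2 ⟨_, packet_mem_weakDerivGraph hφ a k v h h', ?_⟩
  have h1 := constMat_toLp_packet _ hv h
  rw [constMat_add, constMat_smul, constMat_smul] at h1
  rw [← h1, map_add, map_smul, map_smul, smul_add, smul_smul, smul_smul]
  rw [show -Complex.I * (Complex.I * (k : ℂ)) = k by
    rw [← mul_assoc, neg_mul, Complex.I_mul_I, neg_neg, one_mul], add_assoc]

/-- A Weyl sequence at every point of `(-∞, -m] ∪ [m, ∞)`. -/
theorem exists_weyl_sequence {m t : ℝ} (h : m ^ 2 ≤ t ^ 2) :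
    ∃ u e : ℕ → SpinorL2, Orthonormal ℂ u ∧
      (∀ n, (u n, e n + (t : ℂ) • u n) ∈ (freeDirac m).graph) ∧
      Filter.Tendsto e Filter.atTop (nhds 0) := by
  set k : ℝ := √(t ^ 2 - m ^ 2) with hk
  have hk2 : k ^ 2 = t ^ 2 - m ^ 2 := Real.sq_sqrt (by linarith)
  -- The symbol `k σ₁ + m σ₃` has eigenvalues `± √(k² + m²)`, and `k` is chosen so that `t` is one
  -- of them.
  obtain ⟨v, hv0, hv⟩ : ∃ v : Spinor, v ≠ 0 ∧
      matOp ((k : ℂ) • !![0, 1; 1, 0] + (m : ℂ) • !![1, 0; 0, -1]) v = (t : ℂ) • v := by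
    have hdet : (((k : ℂ) • !![0, 1; 1, 0] + (m : ℂ) • !![1, 0; 0, -1] - (t : ℂ) • 1 :
        Matrix (Fin 2) (Fin 2) ℂ)).det = 0 := by
      have hk2' : (k : ℂ) ^ 2 = (t : ℂ) ^ 2 - (m : ℂ) ^ 2 := by exact_mod_cast hk2
      rw [Matrix.det_fin_two]
      simp
      linear_combination -hk2'
    obtain ⟨v, hv0, hv⟩ := Matrix.exists_mulVec_eq_zero_iff.2 hdet
    refine ⟨WithLp.toLp 2 v, fun h0 => hv0 (congrArg WithLp.ofLp h0), ?_⟩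
    rw [Matrix.sub_mulVec, Matrix.smul_mulVec, Matrix.one_mulVec, sub_eq_zero] at hv
    rw [matOp, Matrix.toEuclideanCLM_toLp, hv]
    rfl
  let b : ContDiffBump (3 / 2 : ℝ) := ⟨1 / 4, 1 / 2, by norm_num, by norm_num⟩
  have hb : ContDiff ℝ ∞ b := b.contDiff
  have hbc : HasCompactSupport b := b.hasCompactSupport
  have hd : Continuous (deriv b) := hb.continuous_deriv (by simp)
  have hsupp : ∀ x, b x ≠ 0 → 1 < x ∧ x < 2 := fun x hx => by
    have : x ∈ Metric.ball (3 / 2 : ℝ) (1 / 2) := by rw [← b.support_eq]; exact hx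
    rw [Metric.mem_ball, Real.dist_eq, abs_lt] at this
    constructor <;> linarith [this.1, this.2]
  set J : ℝ := ∫ x, b x ^ 2 with hJ
  set J' : ℝ := ∫ x, deriv b x ^ 2 with hJ'
  have hJpos : 0 < J := by
    refine Continuous.integral_pos_of_hasCompactSupport_nonneg_nonzero (x := 3 / 2)
      (b.continuous.pow 2) ?_ (fun x => sq_nonneg _) ?_
    · exact hbc.comp_left (g := fun y : ℝ => y ^ 2) (by simp)
    · rw [b.one_of_mem_closedBall (by simp; norm_num)]
      norm_num
  -- The bump lives in `(1, 2)`, so the packets live in `(4ⁿ, 2 · 4ⁿ)`: the supports are disjoint,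
  -- and widening the packets makes the error `O(4⁻ⁿ)`.
  let r : ℕ → ℝ := fun n => 4 ^ n
  have hr : ∀ n, 0 < r n := fun n => by positivity
  have hm : ∀ n, MemLp (packet b (r n) k v) 2 volume := fun n =>
    memLp_packet b.continuous hbc (hr n) k v
  have hm' : ∀ n, MemLp (packet (deriv b) (r n) k v) 2 volume := fun n =>
    memLp_packet hd hbc.deriv (hr n) k v
  let w : ℕ → SpinorL2 := fun n => (hm n).toLp
  let w' : ℕ → SpinorL2 := fun n => (hm' n).toLp
  have hvpos : 0 < ‖v‖ := norm_pos_iff.2 hv0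
  have hw : ∀ n, ‖w n‖ = √(r n) * (√J * ‖v‖) := fun n => by
    rw [← Real.sqrt_sq (norm_nonneg (w n)), norm_toLp_packet (hr n) k v (hm n), mul_assoc,
      Real.sqrt_mul (hr n).le, Real.sqrt_mul hJpos.le, Real.sqrt_sq hvpos.le]
  have hw' : ∀ n, ‖w' n‖ = √(r n) * (√J' * ‖v‖) := fun n => by
    rw [← Real.sqrt_sq (norm_nonneg (w' n)), norm_toLp_packet (hr n) k v (hm' n), mul_assoc,
      Real.sqrt_mul (hr n).le, Real.sqrt_mul (integral_nonneg fun _ => sq_nonneg _),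
      Real.sqrt_sq hvpos.le]
  have hwpos : ∀ n, 0 < ‖w n‖ := fun n => by
    rw [hw]
    have := hr n
    positivity
  have horth : ∀ i j, i < j → inner ℂ (w i) (w j) = (0 : ℂ) := by
    intro i j hij
    rw [L2.inner_def, ← integral_zero ℝ ℂ]
    refine integral_congr_ae ?_
    filter_upwards [(hm i).coeFn_toLp, (hm j).coeFn_toLp] with x h1 h2
    rw [show (w i : ℝ → Spinor) x = packet b (r i) k v x from h1,
      show (w j : ℝ → Spinor) x = packet b (r j) k v x from h2]
    have : b (x / r i) = 0 ∨ b (x / r j) = 0 := by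
      by_contra! hne
      have h3 := (hsupp _ hne.1).2
      have h4 := (hsupp _ hne.2).1
      rw [div_lt_iff₀ (hr i)] at h3
      rw [lt_div_iff₀ (hr j)] at h4
      have h5 : r (i + 1) ≤ r j := pow_le_pow_right₀ (by norm_num) hij
      have h6 : r (i + 1) = 4 * r i := pow_succ' _ _
      linarith [hr i]
    rcases this with h3 | h3
    · rw [packet, h3, zero_smul, inner_zero_left]
    · rw [packet, packet, h3, zero_smul, inner_zero_right]
  refine ⟨fun n => ((‖w n‖⁻¹ : ℝ) : ℂ) • w n, fun n => ((‖w n‖⁻¹ : ℝ) : ℂ) •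
    (-Complex.I * (((r n)⁻¹ : ℝ) : ℂ)) • constMat !![0, 1; 1, 0] (w' n), ⟨fun n => ?_, ?_⟩,
    fun n => ?_, ?_⟩
  · rw [norm_smul, Complex.norm_real, norm_inv, norm_norm, inv_mul_cancel₀ (hwpos n).ne']
  · intro i j hij
    simp only [inner_smul_left, inner_smul_right]
    rcases lt_or_gt_of_ne hij with h1 | h1
    · rw [horth i j h1, mul_zero, mul_zero]
    · rw [← inner_conj_symm, horth j i h1, map_zero, mul_zero, mul_zero]
  · have := (freeDirac m).graph.smul_mem ((‖w n‖⁻¹ : ℝ) : ℂ)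
      (packet_mem_graph_freeDirac hb hv (hm n) (hm' n))
    convert this using 1
    refine Prod.ext rfl ?_
    simp only [Prod.smul_snd, smul_add]
    rw [smul_comm (t : ℂ)]
  · refine squeeze_zero_norm (a := fun n =>
      ‖constMat !![0, 1; 1, 0]‖ * (√J' / √J) * (1 / 4 : ℝ) ^ n) (fun n => ?_) ?_
    · rw [norm_smul, norm_smul, norm_mul, norm_neg, Complex.norm_I, one_mul, Complex.norm_real,
        Complex.norm_real, norm_inv, norm_inv, norm_norm, Real.norm_of_nonneg (hr n).le]
      have h1 := (constMat !![0, 1; 1, 0]).le_opNorm (w' n)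
      have h2 : ‖w n‖⁻¹ * ‖w' n‖ = √J' / √J := by
        rw [hw, hw']
        have h3 := (Real.sqrt_pos.2 (hr n)).ne'
        have h4 := (Real.sqrt_pos.2 hJpos).ne'
        field_simp
      calc ‖w n‖⁻¹ * ((r n)⁻¹ * ‖constMat !![0, 1; 1, 0] (w' n)‖)
          ≤ ‖w n‖⁻¹ * ((r n)⁻¹ * (‖constMat !![0, 1; 1, 0]‖ * ‖w' n‖)) := by
            have := (hr n).le
            gcongr
        _ = ‖constMat !![0, 1; 1, 0]‖ * (‖w n‖⁻¹ * ‖w' n‖) * (r n)⁻¹ := by ring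
        _ = ‖constMat !![0, 1; 1, 0]‖ * (√J' / √J) * (1 / 4 : ℝ) ^ n := by
            rw [h2, one_div, inv_pow]
    · rw [← mul_zero (‖constMat !![0, 1; 1, 0]‖ * (√J' / √J))]
      exact (tendsto_pow_atTop_nhds_zero_of_lt_one (by norm_num) (by norm_num)).const_mul _

end WavePackets

/-! ### The essential spectrum -/

section EssentialSpectrum

variable {m : ℝ} {H : SpinorL2 →ₗ.[ℂ] SpinorL2}

theorem mem_rho_freeDirac (hm : 0 ≤ m) {z : ℂ}
    (hz : z ∉ (fun t : ℝ => (t : ℂ)) '' (Set.Iic (-m) ∪ Set.Ici m)) : z ∈ rho (freeDirac m) := by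
  obtain ⟨l, hl, hlz⟩ := exists_sqrt_of_notMem hm hz
  obtain ⟨C, s, hG⟩ := exists_isKernel_freeKernel m z hl
  obtain ⟨R, hR⟩ := hG.exists_conv
  exact (isResolventAt_freeDirac hl hlz hR).mem_rho

/-- Covers `H` and, with zero difference of resolvents, `H₀` itself. -/
theorem essSpectrum_eq_of_isCompactOperator (hm : 0 ≤ m) (hd : Dense (H.domain : Set SpinorL2))
    {w : ℂ} (hw : w ∈ rho H) (hw₀ : w ∈ rho (freeDirac m))
    (hK : IsCompactOperator (res H w - res (freeDirac m) w)) :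
    essSpectrum H = (fun t : ℝ => (t : ℂ)) '' (Set.Iic (-m) ∪ Set.Ici m) := by
  ext z
  constructor
  · intro hz
    by_contra hz'
    exact hz (isFredholm_shift_of_compact_sub (isResolventAt_res hw) (isResolventAt_res hw₀)
      (isResolventAt_res (mem_rho_freeDirac hm hz')) hd hK)
  · rintro ⟨t, ht, rfl⟩
    have h : m ^ 2 ≤ t ^ 2 := by
      rcases ht with ht | ht
      · have : t ≤ -m := ht
        nlinarith
      · exact pow_le_pow_left₀ hm ht 2
    obtain ⟨u, e, hu, hmem, he⟩ := exists_weyl_sequence h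
    exact not_isFredholm_shift_of_orthonormal (isResolventAt_res hw) (isResolventAt_res hw₀) hK hu
      hmem he

theorem essSpectrum_freeDirac (hm : 0 ≤ m) :
    essSpectrum (freeDirac m) = (fun t : ℝ => (t : ℂ)) '' (Set.Iic (-m) ∪ Set.Ici m) := by
  obtain ⟨C, hC⟩ := exists_isKernel_small m
  obtain ⟨w, l, hl, hlw, s, -, hG⟩ := hC 1 one_pos
  obtain ⟨R, hR⟩ := hG.exists_conv
  have hw := (isResolventAt_freeDirac hl hlw hR).mem_rho
  refine essSpectrum_eq_of_isCompactOperator hm (dense_freeDirac_domain m) hw hw ?_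
  rw [sub_self]
  exact isCompactOperator_zero

end EssentialSpectrum

end Dirac

theorem mainTheorem8 (m : ℝ) (hm : 0 ≤ m) (V : ℝ → Matrix (Fin 2) (Fin 2) ℂ)
    (hV : ∀ i j, ∃ w y : ℝ → ℂ, Integrable w ∧ Dirac.MemLinfZero y ∧
      ∀ᵐ x : ℝ, V x i j = w x + y x) :
    (∃! H, Dirac.IsDiracOperator m V H) ∧
    ∀ H, Dirac.IsDiracOperator m V H →
      (∀ z ∈ UnboundedOp.rho H ∩ UnboundedOp.rho (Dirac.freeDirac m),
        IsCompactOperator (UnboundedOp.res H z - UnboundedOp.res (Dirac.freeDirac m) z)) ∧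
      UnboundedOp.essSpectrum H = UnboundedOp.essSpectrum (Dirac.freeDirac m) ∧
      UnboundedOp.essSpectrum (Dirac.freeDirac m) =
        (fun t : ℝ => (t : ℂ)) '' (Set.Iic (-m) ∪ Set.Ici m) := by
  obtain ⟨W, X, h⟩ := Dirac.exists_isDecomposition hV
  refine ⟨Dirac.existsUnique_isDiracOperator m h, fun H hH => ?_⟩
  have hc := fun z hz => Dirac.isCompactOperator_res_sub h hH.polar (z := z) hz
  refine ⟨hc, ?_, Dirac.essSpectrum_freeDirac hm⟩
  obtain ⟨w, hw, hQ⟩ := hH.polar.admissible.exists_neg_one_mem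
  have hw' : w ∈ UnboundedOp.rho H ∩ UnboundedOp.rho (Dirac.freeDirac m) := by
    rw [hH.polar.rho_inter]
    exact ⟨hw, hQ⟩
  rw [Dirac.essSpectrum_freeDirac hm]
  exact Dirac.essSpectrum_eq_of_isCompactOperator hm hH.polar.dense hw'.1 hw (hc w hw')
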